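/- **Setting.** Let $d\ge 1$, let $\alpha,\beta\in[-1/2,\infty)^d$, and let $\mu=\mu_1\otimes\cdots\otimes\mu_d$ be the Jacobi probability measure on $X=(-1,1)^d$, where $$d\mu_i(x_i)=\frac{1}{C(\alpha_i,\beta_i)}(1-x_i)^{\alpha_i}(1+x_i)^{\beta_i}\,dx_i,\qquad C(\alpha_i,\beta_i)=\int_{-1}^1(1-t)^{\alpha_i}(1+t)^{\beta_i}\,dt .$$ All functions are real-valued and $L^p=L^p(X,\mu)$. For $k\in\mathbb N^d$ ($\mathbb N$ contains $0$) let $\varphi_k(x)=\prod_{i=1}^d\tilde P_{k_i}^{\alpha_i,\beta_i}(x_i)$, where $\tilde P_n^{\alpha_i,\beta_i}$ is the classical Jacobi polynomial $P_n^{(\alpha_i,\beta_i)}$ divided by its norm in $L^2(\mu_i)$. Put $$\lambda_k=\sum_{i=1}^d k_i(k_i+\alpha_i+\beta_i+1),\qquad \delta_i=\sqrt{1-x_i^2}\,\partial_{x_i},\quad i=1,\dots,d .$$ On $L^2$ the Jacobi–Riesz transforms are defined by $$R_if=\sum_{k\in\mathbb N^d,\ k\neq 0}\lambda_k^{-1/2}\,\langle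 f,\varphi_k\rangle_{L^2}\,\delta_i\varphi_k ,\qquad i=1,\dots,d,$$ and $\mathbf Rf=(R_1f,\dots,R_df)$. For an $\mathbb R^d$-valued function $\mathbf g=(g_1,\dots,g_d)$ write $\|\mathbf g\|_p=\big(\int_X|\mathbf g|^p\,d\mu\big)^{1/p}$ with $|\mathbf g|=\big(\sum_i g_i^2\big)^{1/2}$, and for $1<p<\infty$ set $p^*=\max\big(p,\tfrac{p}{p-1}\big)$. **Theorem 5.3.** For every $f\in L^2$ and every $i$, the series defining $R_if$ converges unconditionally in $L^2$. For every $1<p<\infty$ the operator $\mathbf R$, initially defined on $L^2\cap L^p$, has a unique extension to a bounded linear operator from $L^p$ to $L^p(X,\mu;\mathbb R^d)$, again denoted by $\mathbf R$, and $$\|\mathbf Rf\|_p\le 24\,(p^*-1)\,\|f\|_p\qquad\text{for all } f\in L^p \text{ with } \int_X f\,d\mu=0 .$$ In particular the constant depends neither on the dimension $d$ nor on the parameters $\alpha,\beta$. -/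

import Mathlib

open MeasureTheory
open scoped ENNReal

namespace JacobiRiesz

noncomputable section

/-- The normalizing constant `C(a,b) = ∫_{-1}^{1} (1-x)^a (1+x)^b dx`. -/
def normConst (a b : ℝ) : ℝ :=
  ∫ x in Set.Ioo (-1 : ℝ) 1, (1 - x) ^ a * (1 + x) ^ b

/-- The normalized Jacobi weight on `(-1,1)`. -/
def weight (a b x : ℝ) : ℝ :=
  (1 / normConst a b) * ((1 - x) ^ a * (1 + x) ^ b)

/-- The one-dimensional Jacobi probability measure, regarded as a measure on `ℝ`
carried by `(-1,1)`. -/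
def measure1 (a b : ℝ) : Measure ℝ :=
  (volume.restrict (Set.Ioo (-1 : ℝ) 1)).withDensity fun x => ENNReal.ofReal (weight a b x)

instance isFiniteMeasure_measure1 (a b : ℝ) : IsFiniteMeasure (measure1 a b) := by
  have h : Integrable (weight a b) (volume.restrict (Set.Ioo (-1 : ℝ) 1)) := by
    by_cases hi : Integrable (fun x : ℝ => (1 - x) ^ a * (1 + x) ^ b)
        (volume.restrict (Set.Ioo (-1 : ℝ) 1))
    · exact hi.const_mul _
    · have h0 : normConst a b = 0 := integral_undef hi
      have : weight a b = fun _ => 0 := by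
        funext x
        simp [weight, h0]
      rw [this]
      exact integrable_zero _ _ _
  exact isFiniteMeasure_withDensity_ofReal h.2

/-- The product Jacobi measure, regarded as a measure on `ℝ^d` carried by `(-1,1)^d`. -/
def measure {d : ℕ} (α β : Fin d → ℝ) : Measure (Fin d → ℝ) :=
  Measure.pi fun i => measure1 (α i) (β i)

instance isFiniteMeasure_measure {d : ℕ} (α β : Fin d → ℝ) :
    IsFiniteMeasure (measure α β) := by
  unfold measure
  infer_instance

/-- The classical Jacobi polynomial
`P_n^{(a,b)}(x) = (1/n!) ∑_{s ≤ n} (n choose s) (n+a+b+1)⋯(n+a+b+s) (a+s+1)⋯(a+n) ((x-1)/2)^s`. -/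
def jacobi (a b : ℝ) (n : ℕ) : Polynomial ℝ :=
  ∑ s ∈ Finset.range (n + 1),
    Polynomial.C ((1 / (n.factorial : ℝ)) * (n.choose s : ℝ) *
        (∏ j ∈ Finset.Icc 1 s, ((n : ℝ) + a + b + (j : ℝ))) *
        (∏ j ∈ Finset.Icc (s + 1) n, (a + (j : ℝ)))) *
      (Polynomial.C (1 / 2 : ℝ) * (Polynomial.X - 1)) ^ s

/-- The Jacobi polynomial normalized in `L²(measure1 a b)`. -/
def jacobiN (a b : ℝ) (n : ℕ) : Polynomial ℝ :=
  Polynomial.C (Real.sqrt (∫ x, ((jacobi a b n).eval x) ^ 2 ∂(measure1 a b)))⁻¹ * jacobi a b n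

/-- The tensor product normalized Jacobi polynomial, `k ∈ ℕ^d`. -/
def phi {d : ℕ} (α β : Fin d → ℝ) (k : Fin d → ℕ) (x : Fin d → ℝ) : ℝ :=
  ∏ j, (jacobiN (α j) (β j) (k j)).eval (x j)

/-- The first-order operator `δ_i = √(1 - x_i²) ∂/∂x_i`. -/
def delta {d : ℕ} (i : Fin d) (f : (Fin d → ℝ) → ℝ) (x : Fin d → ℝ) : ℝ :=
  Real.sqrt (1 - x i ^ 2) * deriv (fun t => f (Function.update x i t)) (x i)

/-- The eigenvalue `λ_k = ∑ i, k_i (k_i + α_i + β_i + 1)` of the Jacobi operator. -/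
def eigenvalue {d : ℕ} (α β : Fin d → ℝ) (k : Fin d → ℕ) : ℝ :=
  ∑ i, (k i : ℝ) * ((k i : ℝ) + α i + β i + 1)

theorem memLp_of_continuous {d : ℕ} (α β : Fin d → ℝ) {g : (Fin d → ℝ) → ℝ}
    (hg : Continuous g) : MemLp g 2 (measure α β) := by
  obtain ⟨C, hC⟩ := (isCompact_univ_pi fun _ : Fin d =>
    isCompact_Icc (a := (-1 : ℝ)) (b := 1)).exists_bound_of_continuousOn hg.continuousOn
  refine MemLp.of_bound hg.aestronglyMeasurable C ?_
  have h1 : ∀ i : Fin d, ∀ᵐ x ∂(measure α β), x i ∈ Set.Ioo (-1 : ℝ) 1 := by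
    intro i
    have h2 : ∀ᵐ t ∂(measure1 (α i) (β i)), t ∈ Set.Ioo (-1 : ℝ) 1 :=
      (withDensity_absolutelyContinuous _ _).ae_le (ae_restrict_mem measurableSet_Ioo)
    exact (Measure.tendsto_eval_ae_ae (μ := fun i => measure1 (α i) (β i)) (i := i)).eventually h2
  filter_upwards [ae_all_iff.2 h1] with x hx
  exact hC x fun i _ => ⟨(hx i).1.le, (hx i).2.le⟩

theorem delta_phi {d : ℕ} (α β : Fin d → ℝ) (i : Fin d) (k : Fin d → ℕ) (x : Fin d → ℝ) :
    delta i (phi α β k) x = Real.sqrt (1 - x i ^ 2) *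
      ((jacobiN (α i) (β i) (k i)).derivative.eval (x i) *
        ∏ j ∈ Finset.univ.erase i, (jacobiN (α j) (β j) (k j)).eval (x j)) := by
  have h : (fun t => phi α β k (Function.update x i t)) = fun t =>
      (jacobiN (α i) (β i) (k i)).eval t *
        ∏ j ∈ Finset.univ.erase i, (jacobiN (α j) (β j) (k j)).eval (x j) := by
    funext t
    rw [phi, ← Finset.mul_prod_erase _ _ (Finset.mem_univ i), Function.update_self]
    congr 1
    refine Finset.prod_congr rfl fun j hj => ?_
    rw [Function.update_of_ne (Finset.ne_of_mem_erase hj)]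
  rw [delta, h, deriv_mul_const (Polynomial.differentiableAt _), Polynomial.deriv]

theorem memLp_delta_phi {d : ℕ} (α β : Fin d → ℝ) (i : Fin d) (k : Fin d → ℕ) :
    MemLp (delta i (phi α β k)) 2 (measure α β) := by
  refine memLp_of_continuous α β ?_
  rw [funext (delta_phi α β i k)]
  fun_prop

/-- The term of index `k` in the series of the `i`-th Jacobi-Riesz transform:
`λ_k^{-1/2} ⟨f, φ_k⟩ δ_i φ_k`, as an element of `L²`. -/
def rieszTerm {d : ℕ} (α β : Fin d → ℝ) (i : Fin d) (f : Lp ℝ 2 (measure α β))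
    (k : {k : Fin d → ℕ // k ≠ 0}) : Lp ℝ 2 (measure α β) :=
  ((Real.sqrt (eigenvalue α β k.1))⁻¹ * ∫ x, f x * phi α β k.1 x ∂(measure α β)) •
    (memLp_delta_phi α β i k.1).toLp (delta i (phi α β k.1))

/-- The `i`-th Jacobi-Riesz transform on `L²`, as the sum of a series in `L²`. -/
def riesz {d : ℕ} (α β : Fin d → ℝ) (i : Fin d) (f : Lp ℝ 2 (measure α β)) :
    Lp ℝ 2 (measure α β) :=
  ∑' k, rieszTerm α β i f k

/-- The vector `(R_1 f, …, R_d f)` as a function with values in Euclidean space. -/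
def rieszVec {d : ℕ} (α β : Fin d → ℝ) (f : Lp ℝ 2 (measure α β)) (x : Fin d → ℝ) :
    EuclideanSpace ℝ (Fin d) :=
  WithLp.toLp 2 fun i => riesz α β i f x

/-- A bounded operator on `L^p` agrees with the vector of Riesz transforms on `L² ∩ L^p`. -/
def ExtendsRiesz {d : ℕ} (α β : Fin d → ℝ) (p : ℝ≥0∞) [Fact (1 ≤ p)]
    (T : Lp ℝ p (measure α β) →L[ℝ] Lp (EuclideanSpace ℝ (Fin d)) p (measure α β)) : Prop :=
  ∀ (f : Lp ℝ 2 (measure α β)) (g : Lp ℝ p (measure α β)),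
    f =ᵐ[measure α β] g → T g =ᵐ[measure α β] rieszVec α β f

/-- `p* = max (p, p/(p-1))`. -/
def pStar (p : ℝ) : ℝ := max p (p / (p - 1))

end

end JacobiRiesz

/-! ### Jacobi polynomials in one variable -/

/-! The proof is a Bellman function argument for a bilinear pairing. Let `L` be the Jacobi operator,
so that `L φ_k = λ_k φ_k`. For a polynomial `f = ∑ c_k φ_k` with `c_0 = 0` and a field `g_i = ∑
D_{i,k} δ_i φ_k`, take the Poisson extensions `F = ∑ c_k e^{-t√λ_k} φ_k` and `G_i = √(1 - x_i²) Q_i`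
with `Q_i = ∑ D_{i,k} e^{-t√λ_k} ∂_i φ_k`. Then `(∂_t² - L) F = 0`, and `waveOp_oneSubSq_mul` shows
that `(∂_t² - L) G_i²` is `2 |∇G_i|²` plus a zero-order term which is nonnegative because `α, β ≥
-1/2`. Squares are used throughout because `G_i²` is smooth up to the boundary of the cube while
`G_i` is not.

`exists_bellman` supplies a function `H(|ζ|², |η|²)` with `0 ≤ H ≤ 18 (p* - 1) (|ζ|^p / p + |η|^q /
q)` whose Hessian dominates `(3/2)(τ |dζ|² + τ⁻¹ |dη|²)`, where `τ` depends on the point. Hence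
`(∂_t² - L) H(ε² + F², ε² + |G|²) ≥ -3 ∑ (1 - x_i²) ∂_i F ∂_t Q_i` (`bellman_pointwise`).
Integration over `x` removes `L`, and orthogonality of the `δ_i φ_k` evaluates the right side as the
second derivative of an explicit `θ(t)`. With `ψ(t) = ∫ H`, the difference `ψ - θ` is convex and
bounded above on `[0, ∞)`. As `ψ ≥ 0` and `θ → 0` at infinity, `θ(0) ≤ ψ(0)`, which reads `(3/4)
⟨Rf, g⟩ ≤ ∫ H` (`bilinear_embedding`).

By density, `g_i` may be `√(1 - x_i²)` times any continuous function. A regularized and scaled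
`|Rf|^{p-2} Rf` yields `‖Rf‖_p ≤ 24 (p* - 1) ‖f‖_p` with `24 = 18 · 4/3` (`integral_rieszSq_le`). On
`L²` the `δ_i φ_k` are orthogonal with squared norms at most `λ_k`, so Bessel's inequality gives
convergence. Since `R` annihilates constants, the polynomial estimate can be stated for `f` minus
its mean and extended by density of polynomials in `L^p`. -/

namespace JacobiRiesz

open Set Filter Topology

/-- The drift coefficient of the Jacobi operator. -/
noncomputable def drift (a b x : ℝ) : ℝ := b - a - (a + b + 2) * x

theorem continuous_drift (a b : ℝ) : Continuous (drift a b) := by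
  unfold drift; fun_prop

/-! ### The one-dimensional Jacobi measure. -/

theorem integrableOn_weight_base {a b : ℝ} (ha : -(1 / 2 : ℝ) ≤ a) (hb : -(1 / 2 : ℝ) ≤ b) :
    IntegrableOn (fun x : ℝ => (1 - x) ^ a * (1 + x) ^ b) (Ioo (-1) 1) := by
  -- Splitting at 0 leaves one endpoint singularity in each half, integrable since the exponents
  -- exceed -1.
  have h1 : IntervalIntegrable (fun x : ℝ => (1 - x) ^ a * (1 + x) ^ b) volume 0 1 := by
    refine IntervalIntegrable.mul_continuousOn ?_ ?_
    · have h := intervalIntegral.intervalIntegrable_rpow' (a := 1) (b := 0) (r := a) (by linarith)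
      simpa using h.comp_sub_left 1
    · rw [uIcc_of_le zero_le_one]
      exact ContinuousOn.rpow_const (by fun_prop) fun x hx => Or.inl (by linarith [hx.1])
  have h2 : IntervalIntegrable (fun x : ℝ => (1 - x) ^ a * (1 + x) ^ b) volume (-1) 0 := by
    refine IntervalIntegrable.continuousOn_mul ?_ ?_
    · have h := intervalIntegral.intervalIntegrable_rpow' (a := 0) (b := 1) (r := b) (by linarith)
      simpa using h.comp_add_left 1
    · rw [uIcc_of_le (by norm_num)]
      exact ContinuousOn.rpow_const (by fun_prop) fun x hx => Or.inl (by linarith [hx.2])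
  have h3 := h2.trans h1
  rw [intervalIntegrable_iff_integrableOn_Ioo_of_le (by norm_num)] at h3
  exact h3

theorem normConst_pos {a b : ℝ} (ha : -(1 / 2 : ℝ) ≤ a) (hb : -(1 / 2 : ℝ) ≤ b) :
    0 < normConst a b := by
  unfold normConst
  rw [setIntegral_pos_iff_support_of_nonneg_ae _ (integrableOn_weight_base ha hb)]
  · have : Function.support (fun x : ℝ => (1 - x) ^ a * (1 + x) ^ b) ∩ Ioo (-1) 1
        = Ioo (-1) 1 := by
      apply inter_eq_self_of_subset_right
      intro x hx
      have h1 : 0 < 1 - x := by linarith [hx.2]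
      have h2 : 0 < 1 + x := by linarith [hx.1]
      exact (mul_pos (Real.rpow_pos_of_pos h1 _) (Real.rpow_pos_of_pos h2 _)).ne'
    rw [this]
    simp
  · refine (ae_restrict_iff' measurableSet_Ioo).2 (Eventually.of_forall fun x hx => ?_)
    have h1 : 0 < 1 - x := by linarith [hx.2]
    have h2 : 0 < 1 + x := by linarith [hx.1]
    exact (mul_pos (Real.rpow_pos_of_pos h1 _) (Real.rpow_pos_of_pos h2 _)).le

theorem weight_pos {a b : ℝ} (ha : -(1 / 2 : ℝ) ≤ a) (hb : -(1 / 2 : ℝ) ≤ b) {x : ℝ}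
    (hx : x ∈ Ioo (-1 : ℝ) 1) : 0 < weight a b x := by
  have h1 : 0 < 1 - x := by linarith [hx.2]
  have h2 : 0 < 1 + x := by linarith [hx.1]
  have := normConst_pos ha hb
  unfold weight
  positivity

theorem measurable_weight (a b : ℝ) : Measurable (weight a b) := by
  unfold weight; fun_prop

theorem integrableOn_weight {a b : ℝ} (ha : -(1 / 2 : ℝ) ≤ a) (hb : -(1 / 2 : ℝ) ≤ b) :
    IntegrableOn (weight a b) (Ioo (-1) 1) :=
  (integrableOn_weight_base ha hb).const_mul _

theorem integral_measure1 {a b : ℝ} (ha : -(1 / 2 : ℝ) ≤ a) (hb : -(1 / 2 : ℝ) ≤ b)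
    (f : ℝ → ℝ) : ∫ x, f x ∂(measure1 a b) = ∫ x in Ioo (-1 : ℝ) 1, weight a b x * f x := by
  unfold measure1
  rw [integral_withDensity_eq_integral_toReal_smul (measurable_weight a b).ennreal_ofReal
    (Eventually.of_forall fun x => ENNReal.ofReal_lt_top)]
  refine setIntegral_congr_fun measurableSet_Ioo fun x hx => ?_
  simp [ENNReal.toReal_ofReal (weight_pos ha hb hx).le]

theorem isProbabilityMeasure_measure1 {a b : ℝ} (ha : -(1 / 2 : ℝ) ≤ a)
    (hb : -(1 / 2 : ℝ) ≤ b) : IsProbabilityMeasure (measure1 a b) := by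
  have h := integral_measure1 ha hb fun _ => 1
  have h2 : ∫ x in Ioo (-1 : ℝ) 1, weight a b x * 1 = 1 := by
    simp only [mul_one, weight]
    rw [integral_const_mul]
    change 1 / normConst a b * normConst a b = 1
    field_simp [(normConst_pos ha hb).ne']
  rw [h2, integral_const, smul_eq_mul, mul_one, measureReal_def] at h
  refine ⟨?_⟩
  rw [← ENNReal.toReal_eq_one_iff]
  exact h

theorem ae_mem_Ioo_measure1 (a b : ℝ) : ∀ᵐ t ∂(measure1 a b), t ∈ Ioo (-1 : ℝ) 1 :=
  (withDensity_absolutelyContinuous _ _).ae_le (ae_restrict_mem measurableSet_Ioo)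

/-- Integration by parts against the Jacobi measure. -/
theorem integral_measure1_ibp {a b : ℝ} (ha : -(1 / 2 : ℝ) ≤ a) (hb : -(1 / 2 : ℝ) ≤ b)
    {h h' : ℝ → ℝ} (hc : ContinuousOn h (Icc (-1) 1)) (hc' : ContinuousOn h' (Icc (-1) 1))
    (hd : ∀ x ∈ Ioo (-1 : ℝ) 1, HasDerivAt h (h' x) x) :
    ∫ x, ((1 - x ^ 2) * h' x + drift a b x * h x) ∂(measure1 a b) = 0 := by
  rw [integral_measure1 ha hb]
  -- `V` is `1 - x²` times the weight, and `V'` is the drift times the weight. The exponents `a + 1`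
  -- and `b + 1` are positive, so `V` vanishes at ±1 and no boundary term remains.
  set V : ℝ → ℝ := fun x => 1 / normConst a b * ((1 - x) ^ (a + 1) * (1 + x) ^ (b + 1)) with hV
  have hVc : Continuous V := by
    refine continuous_const.mul (Continuous.mul ?_ ?_)
    · exact Continuous.rpow_const (by fun_prop) fun x => Or.inr (by linarith)
    · exact Continuous.rpow_const (by fun_prop) fun x => Or.inr (by linarith)
  have hdV : ∀ x ∈ Ioo (-1 : ℝ) 1, HasDerivAt (fun x => V x * h x)
      (weight a b x * ((1 - x ^ 2) * h' x + drift a b x * h x)) x := by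
    intro x hx
    have h1 : 0 < 1 - x := by linarith [hx.2]
    have h2 : 0 < 1 + x := by linarith [hx.1]
    have e1 : HasDerivAt (fun x : ℝ => (1 - x) ^ (a + 1)) (-1 * (a + 1) * (1 - x) ^ (a + 1 - 1)) x :=
      ((hasDerivAt_id x).const_sub 1).rpow_const (Or.inl h1.ne')
    have e2 : HasDerivAt (fun x : ℝ => (1 + x) ^ (b + 1)) (1 * (b + 1) * (1 + x) ^ (b + 1 - 1)) x :=
      ((hasDerivAt_id x).const_add 1).rpow_const (Or.inl h2.ne')
    have e3 := ((e1.mul e2).const_mul (1 / normConst a b)).mul (hd x hx)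
    refine e3.congr_deriv ?_
    simp only [Pi.mul_apply, add_sub_cancel_right, weight, drift]
    rw [Real.rpow_add_one h1.ne', Real.rpow_add_one h2.ne']
    ring
  rw [← integral_Ioc_eq_integral_Ioo, ← intervalIntegral.integral_of_le (by norm_num),
    intervalIntegral.integral_eq_sub_of_hasDerivAt_of_le (by norm_num)
      (hVc.continuousOn.mul hc) hdV]
  · have : (1 : ℝ) + -1 = 0 := by norm_num
    simp [hV, this, Real.zero_rpow (show a + 1 ≠ 0 by linarith),
      Real.zero_rpow (show b + 1 ≠ 0 by linarith)]
  · have hw : IntervalIntegrable (weight a b) volume (-1) 1 := by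
      rw [intervalIntegrable_iff_integrableOn_Ioo_of_le (by norm_num)]
      exact integrableOn_weight ha hb
    refine hw.mul_continuousOn ?_
    rw [uIcc_of_le (by norm_num)]
    exact ((by fun_prop : Continuous fun x : ℝ => 1 - x ^ 2).continuousOn.mul hc').add
      ((continuous_drift a b).continuousOn.mul hc)

theorem integrable_measure1_of_continuous (a b : ℝ) {f : ℝ → ℝ} (hf : Continuous f) :
    Integrable f (measure1 a b) := by
  obtain ⟨C, hC⟩ := (isCompact_Icc (a := (-1 : ℝ)) (b := 1)).exists_bound_of_continuousOn
    hf.continuousOn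
  refine Integrable.of_bound hf.aestronglyMeasurable C ?_
  filter_upwards [ae_mem_Ioo_measure1 a b] with x hx using hC x ⟨hx.1.le, hx.2.le⟩

/-! ### The Jacobi equation, degrees and orthogonality in one variable. -/

open Polynomial in
/-- The Jacobi differential equation. -/
theorem jacobi_ode {a b : ℝ} (n : ℕ) :
    (1 - X ^ 2) * derivative (derivative (jacobi a b n)) +
      (C (b - a) - C (a + b + 2) * X) * derivative (jacobi a b n) +
      C (n * (n + a + b + 1)) * jacobi a b n = 0 := by
  set c : ℕ → ℝ := fun s => (1 / (n.factorial : ℝ)) * (n.choose s : ℝ) *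
        (∏ j ∈ Finset.Icc 1 s, ((n : ℝ) + a + b + (j : ℝ))) *
        (∏ j ∈ Finset.Icc (s + 1) n, (a + (j : ℝ))) with hc
  set q : ℝ[X] := ∑ s ∈ Finset.range (n + 1), C (c s) * X ^ s with hq
  -- The binomial coefficient kills `c s` beyond `n`, so the recurrence below holds for every `s`
  -- without truncation.
  have hcz : ∀ s, n < s → c s = 0 := by
    intro s hs
    simp [hc, Nat.choose_eq_zero_of_lt hs]
  have hcoeff : ∀ s, q.coeff s = c s := by
    intro s
    rw [hq, finsetSum_coeff]
    simp only [coeff_C_mul, coeff_X_pow]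
    by_cases hs : s < n + 1
    · simp [Finset.sum_ite_eq, Finset.mem_range, hs]
    · simp [Finset.sum_ite_eq, Finset.mem_range, hs, hcz s (by omega)]
  have hJ : jacobi a b n = q.comp (C (1 / 2) * (X - 1)) := by
    rw [hq, Polynomial.sum_comp]
    simp only [mul_comp, C_comp, pow_comp, X_comp, jacobi, hc]
  have hrec : ∀ s : ℕ, ((s : ℝ) + 1) * (s + a + 1) * c (s + 1) =
      ((n : ℝ) - s) * (n + s + a + b + 1) * c s := by
    intro s
    rcases lt_trichotomy s n with h | h | h
    · have h1 : (n.choose (s + 1) : ℝ) * (s + 1) = n.choose s * (n - s) := by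
        have := Nat.choose_succ_right_eq n s
        have h3 : ((n - s : ℕ) : ℝ) = n - s := by push_cast [h.le]; ring
        rw [← h3]
        exact_mod_cast this
      have h2 : ∏ j ∈ Finset.Icc 1 (s + 1), ((n : ℝ) + a + b + (j : ℝ)) =
          (∏ j ∈ Finset.Icc 1 s, ((n : ℝ) + a + b + (j : ℝ))) * (n + a + b + (s + 1)) := by
        rw [Finset.prod_Icc_succ_top (by omega)]; push_cast; ring
      have h3 : ∏ j ∈ Finset.Icc (s + 1) n, (a + (j : ℝ)) =
          (a + (s + 1)) * ∏ j ∈ Finset.Icc (s + 1 + 1) n, (a + (j : ℝ)) := by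
        have : Finset.Icc (s + 1) n = insert (s + 1) (Finset.Icc (s + 1 + 1) n) := by
          ext j; simp; omega
        rw [this, Finset.prod_insert (by simp)]; push_cast; ring
      simp only [hc]
      rw [h2, h3]
      linear_combination (1 / (n.factorial : ℝ)) * (∏ j ∈ Finset.Icc 1 s, ((n : ℝ) + a + b + (j : ℝ)))
        * (n + a + b + (s + 1)) * (a + (s + 1)) *
          (∏ j ∈ Finset.Icc (s + 1 + 1) n, (a + (j : ℝ))) * h1
    · subst h; simp [hcz (s + 1) (by omega)]
    · simp [hcz s h, hcz (s + 1) (by omega)]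
  -- With `x = 1 + 2y` one has `1 - x² = -4 y (1 + y)`, and the Jacobi equation becomes the
  -- hypergeometric one; `hrec` is its coefficient form.
  have hqode : (X + X ^ 2) * derivative (derivative q) +
      (C (a + 1) + C (a + b + 2) * X) * derivative q = C (n * (n + a + b + 1)) * q := by
    ext s
    rcases s with _ | _ | s
    · have := hrec 0
      simp [add_mul, mul_assoc, coeff_derivative, hcoeff, pow_two] at this ⊢
      linear_combination this
    · have := hrec 1
      simp [add_mul, mul_assoc, coeff_derivative, hcoeff, pow_two, coeff_X_mul] at this ⊢
      linear_combination this
    · have := hrec (s + 2)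
      simp [add_mul, mul_assoc, coeff_derivative, hcoeff, pow_two, coeff_X_mul] at this ⊢
      linear_combination this
  have hd1 : derivative (jacobi a b n) = C (1 / 2) * (derivative q).comp (C (1 / 2) * (X - 1)) := by
    rw [hJ, derivative_comp]; simp
  have hd2 : derivative (derivative (jacobi a b n)) =
      C (1 / 2) * (C (1 / 2) * (derivative (derivative q)).comp (C (1 / 2) * (X - 1))) := by
    rw [hd1, derivative_mul, derivative_comp]; simp
  have hcomp := congrArg (fun r : ℝ[X] => r.comp (C (1 / 2) * (X - 1))) hqode
  simp only [add_comp, mul_comp, X_comp, C_comp, pow_comp] at hcomp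
  rw [hd2, hd1, hJ]
  refine Polynomial.funext fun x => ?_
  have := congrArg (Polynomial.eval x) hcomp
  simp only [eval_add, eval_mul, eval_C, eval_X, eval_sub, eval_one, eval_pow, eval_zero] at this ⊢
  linear_combination -this


-- The top coefficient is built from factors `n + a + b + j` with `n, j ≥ 1`, positive because `a +
-- b ≥ -1`. Having exact degrees is what makes these polynomials span.
open Polynomial in
theorem degree_jacobi {a b : ℝ} (ha : -(1 / 2 : ℝ) ≤ a) (hb : -(1 / 2 : ℝ) ≤ b) (n : ℕ) :
    (jacobi a b n).degree = n := by
  have key : ∀ s ∈ Finset.range (n + 1), ∀ r : ℝ,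
      (C r * (C (1 / 2 : ℝ) * (X - 1)) ^ s : ℝ[X]).degree = if r = 0 then ⊥ else (s : WithBot ℕ) := by
    intro s _ r
    split_ifs with h
    · simp [h]
    · rw [degree_C_mul h, degree_pow, degree_C_mul (by norm_num)]
      have : (X - 1 : ℝ[X]).degree = 1 := by simpa using degree_X_sub_C (1 : ℝ)
      rw [this]; simp
  unfold jacobi
  rw [Finset.sum_range_succ, degree_add_eq_right_of_degree_lt]
  · rw [key n (by simp), if_neg]
    have h1 : ∏ j ∈ Finset.Icc 1 n, ((n : ℝ) + a + b + (j : ℝ)) ≠ 0 := by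
      refine Finset.prod_ne_zero_iff.2 fun j hj => ?_
      have h2 : (1 : ℝ) ≤ j := by exact_mod_cast (Finset.mem_Icc.1 hj).1
      have h3 : (1 : ℝ) ≤ n := by
        exact_mod_cast (Finset.mem_Icc.1 hj).1.trans (Finset.mem_Icc.1 hj).2
      linarith
    have h2 : (n.factorial : ℝ) ≠ 0 := by exact_mod_cast n.factorial_ne_zero
    simp [h1, h2]
  · rw [key n (by simp), if_neg]
    · refine (degree_sum_le _ _).trans_lt ?_
      refine (Finset.sup_lt_iff (by exact WithBot.bot_lt_coe n)).2 fun s hs => ?_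
      rw [key s (by simp at hs ⊢; omega)]
      split_ifs
      · exact WithBot.bot_lt_coe n
      · exact_mod_cast Finset.mem_range.1 hs
    have h1 : ∏ j ∈ Finset.Icc 1 n, ((n : ℝ) + a + b + (j : ℝ)) ≠ 0 := by
      refine Finset.prod_ne_zero_iff.2 fun j hj => ?_
      have h2 : (1 : ℝ) ≤ j := by exact_mod_cast (Finset.mem_Icc.1 hj).1
      have h3 : (1 : ℝ) ≤ n := by
        exact_mod_cast (Finset.mem_Icc.1 hj).1.trans (Finset.mem_Icc.1 hj).2
      linarith
    have h2 : (n.factorial : ℝ) ≠ 0 := by exact_mod_cast n.factorial_ne_zero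
    simp [h1, h2]

/-- The eigenvalue of the one-dimensional Jacobi operator. -/
noncomputable def eigenvalue1 (a b : ℝ) (n : ℕ) : ℝ := n * (n + a + b + 1)

theorem eigenvalue1_nonneg {a b : ℝ} (ha : -(1 / 2 : ℝ) ≤ a) (hb : -(1 / 2 : ℝ) ≤ b) (n : ℕ) :
    0 ≤ eigenvalue1 a b n :=
  mul_nonneg n.cast_nonneg (by linarith [(n.cast_nonneg : (0 : ℝ) ≤ n)])

/-- Consecutive gaps equal `2n + a + b + 2 ≥ 1`. Distinctness gives orthogonality, and comparison
with index 0 gives `λ_k > 0` for `k ≠ 0`. -/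
theorem eigenvalue1_strictMono {a b : ℝ} (ha : -(1 / 2 : ℝ) ≤ a) (hb : -(1 / 2 : ℝ) ≤ b) :
    StrictMono (eigenvalue1 a b) := by
  refine strictMono_nat_of_lt_succ fun n => ?_
  have : (0 : ℝ) ≤ n := n.cast_nonneg
  simp only [eigenvalue1]
  push_cast
  nlinarith

theorem integral_jacobi_sq_pos {a b : ℝ} (ha : -(1 / 2 : ℝ) ≤ a) (hb : -(1 / 2 : ℝ) ≤ b) (n : ℕ) :
    0 < ∫ x, ((jacobi a b n).eval x) ^ 2 ∂(measure1 a b) := by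
  have hne : jacobi a b n ≠ 0 := by
    intro h
    have := degree_jacobi ha hb n
    rw [h, Polynomial.degree_zero] at this
    exact absurd this (WithBot.bot_ne_coe (a := n))
  rw [integral_pos_iff_support_of_nonneg (fun x => sq_nonneg _)
    (integrable_measure1_of_continuous a b ((jacobi a b n).continuous.pow 2))]
  have := isProbabilityMeasure_measure1 ha hb
  have hfin : measure1 a b {x | (jacobi a b n).IsRoot x} = 0 := by
    refine (withDensity_absolutelyContinuous _ _) ?_
    exact (Polynomial.finite_setOfPred_isRoot hne).measure_zero _
  have hsupp : Function.support (fun x => ((jacobi a b n).eval x) ^ 2) =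
      {x | (jacobi a b n).IsRoot x}ᶜ := by
    ext x; simp [Polynomial.IsRoot]
  rw [hsupp, prob_compl_eq_one_sub₀, hfin]
  · simp
  · exact (Polynomial.finite_setOfPred_isRoot hne).measurableSet.nullMeasurableSet

theorem degree_jacobiN {a b : ℝ} (ha : -(1 / 2 : ℝ) ≤ a) (hb : -(1 / 2 : ℝ) ≤ b) (n : ℕ) :
    (jacobiN a b n).degree = n := by
  rw [jacobiN, Polynomial.degree_C_mul, degree_jacobi ha hb]
  exact inv_ne_zero (Real.sqrt_pos.2 (integral_jacobi_sq_pos ha hb n)).ne'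

open Polynomial in
theorem jacobiN_ode (a b : ℝ) (n : ℕ) (x : ℝ) :
    (1 - x ^ 2) * (derivative (derivative (jacobiN a b n))).eval x +
      drift a b x * (derivative (jacobiN a b n)).eval x =
      -(eigenvalue1 a b n * (jacobiN a b n).eval x) := by
  have h := congrArg (Polynomial.eval x) (jacobi_ode (a := a) (b := b) n)
  simp only [eval_add, eval_mul, eval_C, eval_X, eval_sub, eval_one, eval_pow, eval_zero] at h
  simp only [jacobiN, derivative_C_mul, eval_mul, eval_C, drift, eigenvalue1]
  linear_combination (√(∫ x, ((jacobi a b n).eval x) ^ 2 ∂(measure1 a b)))⁻¹ * h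

open Polynomial in
/-- The equation satisfied by derivatives of Jacobi polynomials. -/
theorem jacobiN_derivative_ode (a b : ℝ) (n : ℕ) (x : ℝ) :
    (1 - x ^ 2) * (derivative (derivative (derivative (jacobiN a b n)))).eval x +
      drift a b x * (derivative (derivative (jacobiN a b n))).eval x =
      2 * x * (derivative (derivative (jacobiN a b n))).eval x +
      (a + b + 2) * (derivative (jacobiN a b n)).eval x
      -eigenvalue1 a b n * (derivative (jacobiN a b n)).eval x := by
  have h : (1 - X ^ 2) * derivative (derivative (jacobiN a b n)) +
      (C (b - a) - C (a + b + 2) * X) * derivative (jacobiN a b n) +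
      C (eigenvalue1 a b n) * jacobiN a b n = 0 := by
    refine Polynomial.funext fun x => ?_
    have := jacobiN_ode a b n x
    simp only [eval_add, eval_mul, eval_C, eval_X, eval_sub, eval_one, eval_pow, eval_zero, drift]
      at this ⊢
    linear_combination this
  have h2 := congrArg (fun r : ℝ[X] => (derivative r).eval x) h
  simp at h2
  simp only [drift]
  linear_combination h2

-- Integration by parts applied to `P_n' P_m`, with the Jacobi equation replacing the second-order
-- part by the eigenvalue.
open Polynomial in
theorem integral_derivative_jacobiN_mul {a b : ℝ} (ha : -(1 / 2 : ℝ) ≤ a)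
    (hb : -(1 / 2 : ℝ) ≤ b) (n m : ℕ) :
    ∫ x, (1 - x ^ 2) * ((derivative (jacobiN a b n)).eval x *
      (derivative (jacobiN a b m)).eval x) ∂(measure1 a b) =
    eigenvalue1 a b n * ∫ x, (jacobiN a b n).eval x * (jacobiN a b m).eval x ∂(measure1 a b) := by
  have h := integral_measure1_ibp ha hb
    (h := fun x => (derivative (jacobiN a b n)).eval x * (jacobiN a b m).eval x)
    (h' := fun x => (derivative (derivative (jacobiN a b n))).eval x * (jacobiN a b m).eval x +
      (derivative (jacobiN a b n)).eval x * (derivative (jacobiN a b m)).eval x)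
    (by fun_prop) (by fun_prop) (fun x _ => (Polynomial.hasDerivAt _ x).mul (Polynomial.hasDerivAt _ x))
  have h2 : ∀ x, (1 - x ^ 2) * ((derivative (derivative (jacobiN a b n))).eval x *
        (jacobiN a b m).eval x +
      (derivative (jacobiN a b n)).eval x * (derivative (jacobiN a b m)).eval x) +
      drift a b x * ((derivative (jacobiN a b n)).eval x * (jacobiN a b m).eval x) =
      (1 - x ^ 2) * ((derivative (jacobiN a b n)).eval x * (derivative (jacobiN a b m)).eval x) -
      eigenvalue1 a b n * ((jacobiN a b n).eval x * (jacobiN a b m).eval x) := by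
    intro x
    linear_combination (jacobiN a b m).eval x * jacobiN_ode a b n x
  simp only [h2] at h
  rw [integral_sub (integrable_measure1_of_continuous a b (by fun_prop))
    (integrable_measure1_of_continuous a b (by fun_prop)), integral_const_mul] at h
  linarith

/-- The weighted product of derivatives is symmetric in `n` and `m`, so two different eigenvalues
multiply the same inner product, which must vanish. -/
theorem integral_jacobiN_mul {a b : ℝ} (ha : -(1 / 2 : ℝ) ≤ a)
    (hb : -(1 / 2 : ℝ) ≤ b) (n m : ℕ) :
    ∫ x, (jacobiN a b n).eval x * (jacobiN a b m).eval x ∂(measure1 a b) =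
      if n = m then 1 else 0 := by
  split_ifs with h
  · subst h
    have hpos := integral_jacobi_sq_pos ha hb n
    have h1 : ∀ x, (jacobiN a b n).eval x * (jacobiN a b n).eval x =
        (∫ x, ((jacobi a b n).eval x) ^ 2 ∂(measure1 a b))⁻¹ * ((jacobi a b n).eval x) ^ 2 := by
      intro x
      simp only [jacobiN, Polynomial.eval_mul, Polynomial.eval_C]
      rw [mul_mul_mul_comm, ← mul_inv, Real.mul_self_sqrt hpos.le, pow_two]
    simp only [h1]
    rw [integral_const_mul, inv_mul_cancel₀ hpos.ne']
  · have h1 := integral_derivative_jacobiN_mul ha hb n m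
    have h2 := integral_derivative_jacobiN_mul ha hb m n
    simp only [mul_comm (Polynomial.eval _ (Polynomial.derivative (jacobiN a b m))),
      mul_comm (Polynomial.eval _ (jacobiN a b m))] at h2
    rw [h1] at h2
    have h3 : eigenvalue1 a b n - eigenvalue1 a b m ≠ 0 :=
      sub_ne_zero.2 fun h' => h ((eigenvalue1_strictMono ha hb).injective h')
    have h4 : (eigenvalue1 a b n - eigenvalue1 a b m) *
      ∫ x, (jacobiN a b n).eval x * (jacobiN a b m).eval x ∂(measure1 a b) = 0 := by linarith
    exact (mul_eq_zero.1 h4).resolve_left h3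

/-- The measure has mass one, so the constant needs no normalization. The zeroth coefficient of an
expansion is therefore its mean. -/
theorem jacobiN_zero {a b : ℝ} (ha : -(1 / 2 : ℝ) ≤ a) (hb : -(1 / 2 : ℝ) ≤ b) :
    jacobiN a b 0 = 1 := by
  have := isProbabilityMeasure_measure1 ha hb
  simp [jacobiN, jacobi]

end JacobiRiesz

/-! ### A smooth Bellman function -/

namespace JacobiRiesz

open Set Filter Topology

/-- `H1` and `H2` are the partial derivatives of `H` on the positive quadrant, in the form of
the chain rule along curves. -/
def HasPartials (H H1 H2 : ℝ → ℝ → ℝ) : Prop :=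
  ∀ (X Y : ℝ → ℝ) (X' Y' t : ℝ), HasDerivAt X X' t → HasDerivAt Y Y' t → 0 < X t → 0 < Y t →
    HasDerivAt (fun s => H (X s) (Y s)) (H1 (X t) (Y t) * X' + H2 (X t) (Y t) * Y') t

theorem HasPartials.add {H H1 H2 K K1 K2 : ℝ → ℝ → ℝ} (h : HasPartials H H1 H2)
    (k : HasPartials K K1 K2) :
    HasPartials (fun X Y => H X Y + K X Y) (fun X Y => H1 X Y + K1 X Y)
      (fun X Y => H2 X Y + K2 X Y) := by
  intro X Y X' Y' t hX hY h0 h0'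
  refine ((h X Y X' Y' t hX hY h0 h0').add (k X Y X' Y' t hX hY h0 h0')).congr_deriv ?_
  ring

theorem HasPartials.swap {H H1 H2 : ℝ → ℝ → ℝ} (h : HasPartials H H1 H2) :
    HasPartials (fun X Y => H Y X) (fun X Y => H2 Y X) (fun X Y => H1 Y X) := by
  intro X Y X' Y' t hX hY h0 h0'
  refine (h Y X Y' X' t hY hX h0' h0).congr_deriv ?_
  ring

theorem hasPartials_rpow_left (c r : ℝ) :
    HasPartials (fun X _ => c * X ^ r) (fun X _ => c * r * X ^ (r - 1)) (fun _ _ => 0) := by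
  intro X Y X' Y' t hX hY h0 h0'
  refine ((hX.rpow_const (p := r) (Or.inl h0.ne')).const_mul c).congr_deriv ?_
  ring

theorem hasPartials_rpow_right (c r : ℝ) :
    HasPartials (fun _ Y => c * Y ^ r) (fun _ _ => 0) (fun _ Y => c * r * Y ^ (r - 1)) :=
  (hasPartials_rpow_left c r).swap

/-- A smooth function on the positive quadrant such that `H (|ζ|²) (|η|²)` has the convexity
property needed in the bilinear embedding with exponents `p` and `q`. -/
structure Bellman (p q K : ℝ) where
  (H H1 H2 H11 H12 H22 : ℝ → ℝ → ℝ)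
  partials : HasPartials H H1 H2
  partials1 : HasPartials H1 H11 H12
  partials2 : HasPartials H2 H12 H22
  cont : ContinuousOn (Function.uncurry H) (Ici 0 ×ˢ Ici 0)
  cont1 : ContinuousOn (Function.uncurry H1) (Ioi 0 ×ˢ Ioi 0)
  cont2 : ContinuousOn (Function.uncurry H2) (Ioi 0 ×ˢ Ioi 0)
  cont11 : ContinuousOn (Function.uncurry H11) (Ioi 0 ×ˢ Ioi 0)
  cont12 : ContinuousOn (Function.uncurry H12) (Ioi 0 ×ˢ Ioi 0)
  cont22 : ContinuousOn (Function.uncurry H22) (Ioi 0 ×ˢ Ioi 0)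
  nonneg : ∀ X Y, 0 ≤ X → 0 ≤ Y → 0 ≤ H X Y
  nonneg1 : ∀ X Y, 0 < X → 0 < Y → 0 ≤ H1 X Y
  nonneg2 : ∀ X Y, 0 < X → 0 < Y → 0 ≤ H2 X Y
  le : ∀ X Y, 0 ≤ X → 0 ≤ Y → H X Y ≤ K * (X ^ (p / 2) / p + Y ^ (q / 2) / q)
  -- Intended use: up to `ε²`, `X = |ζ|²` and `Y = |η|²`; the numbers `ξ`, `η` are their derivatives
  -- in one direction, and `A`, `B` are the squared lengths of the derivatives of the two vectors.
  -- The constraints are Cauchy-Schwarz, and the terms in `H1`, `H2` come from differentiating the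
  -- squares twice. Since `τ` depends only on the point, the bounds for different directions can be
  -- added.
  hess : ∀ X Y, 0 < X → 0 < Y → ∃ τ, 0 < τ ∧ ∀ ξ η A B, ξ ^ 2 ≤ 4 * X * A → η ^ 2 ≤ 4 * Y * B →
    3 / 2 * (τ * A + τ⁻¹ * B) ≤
      H11 X Y * ξ ^ 2 + 2 * H12 X Y * (ξ * η) + H22 X Y * η ^ 2 + 2 * H1 X Y * A + 2 * H2 X Y * B

theorem continuousOn_swap_quadrant {f : ℝ → ℝ → ℝ} {s : Set ℝ}
    (h : ContinuousOn (Function.uncurry f) (s ×ˢ s)) :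
    ContinuousOn (Function.uncurry fun X Y => f Y X) (s ×ˢ s) :=
  h.comp (f := Prod.swap) continuous_swap.continuousOn fun _ hx => ⟨hx.2, hx.1⟩

/-- Exchanging the two variables. -/
def Bellman.swap {p q K : ℝ} (b : Bellman p q K) : Bellman q p K where
  H X Y := b.H Y X
  H1 X Y := b.H2 Y X
  H2 X Y := b.H1 Y X
  H11 X Y := b.H22 Y X
  H12 X Y := b.H12 Y X
  H22 X Y := b.H11 Y X
  partials := b.partials.swap
  partials1 := b.partials2.swap
  partials2 := b.partials1.swap
  cont := continuousOn_swap_quadrant b.cont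
  cont1 := continuousOn_swap_quadrant b.cont2
  cont2 := continuousOn_swap_quadrant b.cont1
  cont11 := continuousOn_swap_quadrant b.cont22
  cont12 := continuousOn_swap_quadrant b.cont12
  cont22 := continuousOn_swap_quadrant b.cont11
  nonneg X Y hX hY := b.nonneg Y X hY hX
  nonneg1 X Y hX hY := b.nonneg2 Y X hY hX
  nonneg2 X Y hX hY := b.nonneg1 Y X hY hX
  le X Y hX hY := (b.le Y X hY hX).trans_eq (by ring)
  hess X Y hX hY := by
    obtain ⟨τ, hτ, h⟩ := b.hess Y X hY hX
    refine ⟨τ⁻¹, inv_pos.2 hτ, fun ξ η A B h1 h2 => ?_⟩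
    have := h η ξ B A h2 h1
    rw [inv_inv]
    linarith

/-! ### The coupling term: derivatives and Hessian estimate. -/

/-- The coupling term of the Bellman function. -/
noncomputable def coupling (q X Y : ℝ) : ℝ := √(Y ^ q + X * Y)

theorem coupling_sq {q X Y : ℝ} (hX : 0 ≤ X) (hY : 0 ≤ Y) :
    coupling q X Y ^ 2 = Y ^ q + X * Y :=
  Real.sq_sqrt (by positivity)

theorem coupling_pos {q X Y : ℝ} (hX : 0 < X) (hY : 0 < Y) : 0 < coupling q X Y :=
  Real.sqrt_pos.2 (by positivity)

theorem hasPartials_coupling (q : ℝ) :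
    HasPartials (coupling q) (fun X Y => Y / (2 * coupling q X Y))
      (fun X Y => (q * Y ^ (q - 1) + X) / (2 * coupling q X Y)) := by
  intro X Y X' Y' t hX hY h0 h0'
  have h := (((hY.rpow_const (p := q) (Or.inl h0'.ne'))).add (hX.mul hY)).sqrt
    (by simp only [Pi.add_apply, Pi.mul_apply]; positivity)
  refine h.congr_deriv ?_
  simp only [Pi.add_apply, Pi.mul_apply, coupling]
  ring

/-- Once denominators are cleared, everything reduces through `S² = Y^q + XY`. The mixed partial has
the same form as in `hasPartials_coupling2`, so a single function serves as `H12`. -/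
theorem hasPartials_coupling1 (q : ℝ) :
    HasPartials (fun X Y => Y / (2 * coupling q X Y))
      (fun X Y => -(Y ^ 2 / (4 * coupling q X Y ^ 3)))
      (fun X Y => ((2 - q) * Y ^ q + X * Y) / (4 * coupling q X Y ^ 3)) := by
  intro X Y X' Y' t hX hY h0 h0'
  have hS := hasPartials_coupling q X Y X' Y' t hX hY h0 h0'
  have hpos := coupling_pos (q := q) h0 h0'
  have hsq := coupling_sq (q := q) h0.le h0'.le
  refine (hY.div (hS.const_mul 2) (by positivity)).congr_deriv ?_
  have hZ : Y t ^ q = Y t ^ (q - 1) * Y t := by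
    rw [← Real.rpow_add_one h0'.ne']; congr 1; ring
  dsimp only
  rw [hZ] at hsq ⊢
  field_simp
  rw [hsq]
  ring

theorem hasPartials_coupling2 (q : ℝ) :
    HasPartials (fun X Y => (q * Y ^ (q - 1) + X) / (2 * coupling q X Y))
      (fun X Y => ((2 - q) * Y ^ q + X * Y) / (4 * coupling q X Y ^ 3))
      (fun X Y => q * (q - 1) * Y ^ (q - 2) / (2 * coupling q X Y) -
        (q * Y ^ (q - 1) + X) ^ 2 / (4 * coupling q X Y ^ 3)) := by
  intro X Y X' Y' t hX hY h0 h0'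
  have hS := hasPartials_coupling q X Y X' Y' t hX hY h0 h0'
  have hpos := coupling_pos (q := q) h0 h0'
  have hsq := coupling_sq (q := q) h0.le h0'.le
  have hN := ((hY.rpow_const (p := q - 1) (Or.inl h0'.ne')).const_mul q).add hX
  refine (hN.div (hS.const_mul 2) (by positivity)).congr_deriv ?_
  have hZ : Y t ^ q = Y t ^ (q - 1) * Y t := by
    rw [← Real.rpow_add_one h0'.ne']; congr 1; ring
  rw [show q - 1 - 1 = q - 2 by ring]
  simp only [Pi.add_apply]
  rw [hZ] at hsq ⊢
  field_simp
  rw [hsq]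
  ring

theorem continuousOn_coupling {q : ℝ} (hq : 0 ≤ q) :
    Continuous (Function.uncurry (coupling q)) := by
  unfold coupling Function.uncurry
  refine Real.continuous_sqrt.comp (Continuous.add ?_ (by fun_prop))
  exact continuous_snd.rpow_const fun _ => Or.inr hq

theorem continuousOn_rpow_fst (r : ℝ) :
    ContinuousOn (fun x : ℝ × ℝ => x.1 ^ r) (Ioi 0 ×ˢ Ioi 0) :=
  continuous_fst.continuousOn.rpow_const fun _ hx => Or.inl (ne_of_gt hx.1)

theorem continuousOn_rpow_snd (r : ℝ) :
    ContinuousOn (fun x : ℝ × ℝ => x.2 ^ r) (Ioi 0 ×ˢ Ioi 0) :=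
  continuous_snd.continuousOn.rpow_const fun _ hx => Or.inl (ne_of_gt hx.2)

/-- Elementary form of the Hessian estimate. -/
theorem quadratic_bound {P R m A B x : ℝ} (hm : 0 < m) (hA : 0 ≤ A) (hB : 0 ≤ B)
    (hx : x ^ 2 ≤ A * B) (h : R ^ 2 ≤ 5 * (P / m - 225 / 1000)) :
    3 / 2 * (15 / 100 * m * A + (15 / 100 * m)⁻¹ * B) ≤ P * A + 15 / m * B + 2 * R * x := by
  have h0 : 0 ≤ P / m - 225 / 1000 := by nlinarith [sq_nonneg R]
  -- With `τ = 0.15 m` the target is `0.225 m A + (10/m) B`. Subtracting it leaves `m k A + (5/m) B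
  -- + 2 R x`, which is nonnegative as soon as `R² ≤ 5k`.
  obtain ⟨k, hk⟩ : ∃ k, k = P / m - 225 / 1000 := ⟨_, rfl⟩
  have hP : P = m * (k + 225 / 1000) := by rw [hk]; field_simp; ring
  rw [← hk] at h0 h
  have key : 0 ≤ m * k * A + 5 / m * B + 2 * R * x := by
    have e1 : (R * x) ^ 2 ≤ (m * k * A) * (5 / m * B) := by
      calc (R * x) ^ 2 = R ^ 2 * x ^ 2 := by ring
        _ ≤ (5 * k) * (A * B) := mul_le_mul h hx (sq_nonneg _) (by linarith)
        _ = _ := by field_simp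
    have h1 : 0 ≤ m * k * A := by positivity
    have h2 : 0 ≤ 5 / m * B := by positivity
    have h3 : |2 * R * x| ≤ m * k * A + 5 / m * B := by
      refine abs_le_of_sq_le_sq ?_ (by linarith)
      nlinarith [sq_nonneg (m * k * A - 5 / m * B)]
    linarith [neg_abs_le (2 * R * x)]
  have e : (15 / 100 * m)⁻¹ * B = 20 / 3 * (1 / m * B) := by field_simp; ring
  have e2 : 15 / m * B = 15 * (1 / m * B) := by ring
  have e3 : 5 / m * B = 5 * (1 / m * B) := by ring
  rw [e, e2, hP]
  rw [e3] at key
  nlinarith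

/-- Two sources of positivity complement each other. For `Z ≤ X` the power of `X` gives `E/m ≥ 1`,
while `R² ≤ 1`. For `X ≤ Z` the coupling term itself contributes `Y² Z / (S³ m) ≥ 2^(-3/2) > 0.35`,
while `R² ≤ 1/2 < 5 (0.35 - 0.225)`. -/
theorem coupling_discriminant {X Y Z S m E R : ℝ} (hX : 0 < X) (hY : 0 < Y) (hZ : 0 < Z)
    (hS : 0 < S) (hm : 0 < m) (hE : 0 ≤ E) (hsq : S ^ 2 = Y * (Z + X)) (hmZ : m ^ 2 * Z = Y)
    (hc : Z ≤ X → m ≤ E) (hR : R ^ 2 ≤ X / (Z + X)) :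
    R ^ 2 ≤ 5 * ((E + Y ^ 2 * Z / S ^ 3) / m - 225 / 1000) := by
  have h0 : 0 ≤ Y ^ 2 * Z / S ^ 3 := by positivity
  rcases le_total Z X with h | h
  · have e2 : 1 ≤ (E + Y ^ 2 * Z / S ^ 3) / m := by
      rw [le_div_iff₀ hm]
      linarith [hc h]
    have e3 : X / (Z + X) ≤ 1 := by rw [div_le_one (by positivity)]; linarith
    linarith
  · have e1 : X / (Z + X) ≤ 1 / 2 := by
      rw [div_le_div_iff₀ (by positivity) (by positivity)]; linarith
    have e2 : 35 / 100 ≤ Y ^ 2 * Z / S ^ 3 / m := by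
      rw [div_div, le_div_iff₀ (by positivity)]
      have e3 : S ^ 2 ≤ 2 * (Y * Z) := by rw [hsq]; nlinarith
      have e4 : (35 / 100 * (S ^ 3 * m)) ^ 2 ≤ (Y ^ 2 * Z) ^ 2 := by
        calc (35 / 100 * (S ^ 3 * m)) ^ 2 = (35 / 100) ^ 2 * (S ^ 2) ^ 3 * m ^ 2 := by ring
          _ ≤ (35 / 100) ^ 2 * (2 * (Y * Z)) ^ 3 * m ^ 2 := by gcongr
          _ = (35 / 100) ^ 2 * 8 * Y ^ 3 * Z ^ 2 * (m ^ 2 * Z) := by ring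
          _ = 98 / 100 * (Y ^ 2 * Z) ^ 2 := by rw [hmZ]; ring
          _ ≤ _ := by nlinarith [sq_nonneg (Y ^ 2 * Z)]
      exact le_of_sq_le_sq e4 (by positivity)
    have e5 : 0 ≤ E / m := by positivity
    rw [add_div]
    linarith

/-- The coefficient `X^(p/2 - 1)` of `A` degenerates when `X` is small compared with `Y^(q-1)`, and
the coupling term repairs this: it adds `Y² Z / S³` to that coefficient and does no harm to that of
`B`. The price is a mixed term, controlled by the discriminant condition. -/
theorem coupling_hess {p q : ℝ} (hp : 2 ≤ p) (hpq : (p - 1) * (q - 1) = 1) {X Y : ℝ} (hX : 0 < X)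
    (hY : 0 < Y) {ξ η A B : ℝ} (h1 : ξ ^ 2 ≤ 4 * X * A) (h2 : η ^ 2 ≤ 4 * Y * B) :
    3 / 2 * (15 / 100 * Y ^ (1 - q / 2) * A + (15 / 100 * Y ^ (1 - q / 2))⁻¹ * B) ≤
      (p - 1) * X ^ (p / 2 - 1) * A + 15 * Y ^ (q / 2 - 1) * B +
      (-(Y ^ 2 / (4 * coupling q X Y ^ 3)) * ξ ^ 2 +
      2 * (((2 - q) * Y ^ q + X * Y) / (4 * coupling q X Y ^ 3)) * (ξ * η) +
      (q * (q - 1) * Y ^ (q - 2) / (2 * coupling q X Y) -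
        (q * Y ^ (q - 1) + X) ^ 2 / (4 * coupling q X Y ^ 3)) * η ^ 2 +
      2 * (Y / (2 * coupling q X Y)) * A +
      2 * ((q * Y ^ (q - 1) + X) / (2 * coupling q X Y)) * B) := by
  have hA : 0 ≤ A := by
    by_contra h; nlinarith [sq_nonneg ξ, mul_pos hX (neg_pos.2 (not_le.1 h))]
  have hB : 0 ≤ B := by
    by_contra h; nlinarith [sq_nonneg η, mul_pos hY (neg_pos.2 (not_le.1 h))]
  have hq1 : 1 < q := by nlinarith
  have hq2 : q ≤ 2 := by nlinarith
  set S := coupling q X Y with hSdef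
  have hS : 0 < S := coupling_pos hX hY
  set Z := Y ^ (q - 1) with hZdef
  have hZ : 0 < Z := Real.rpow_pos_of_pos hY _
  have hYq : Y ^ q = Z * Y := by
    rw [hZdef, ← Real.rpow_add_one hY.ne']; congr 1; ring
  have hYq2 : Y ^ (q - 2) = Z / Y := by
    rw [hZdef, ← Real.rpow_sub_one hY.ne']; congr 1; ring
  have hsq : S ^ 2 = Y * (Z + X) := by
    rw [hSdef, coupling_sq hX.le hY.le, hYq]; ring
  set m := Y ^ (1 - q / 2) with hmdef
  have hm : 0 < m := Real.rpow_pos_of_pos hY _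
  have hm' : Y ^ (q / 2 - 1) = 1 / m := by
    rw [one_div, hmdef, ← Real.rpow_neg hY.le]; congr 1; ring
  have hmZ : m ^ 2 * Z = Y := by
    rw [hmdef, hZdef, ← Real.rpow_natCast, ← Real.rpow_mul hY.le, ← Real.rpow_add hY]
    nth_rewrite 2 [← Real.rpow_one Y]
    congr 1; push_cast; ring
  rw [hm', hYq, hYq2]
  -- the pure second derivatives of the coupling term
  have hξ : Y ^ 2 * Z / S ^ 3 * A ≤ -(Y ^ 2 / (4 * S ^ 3)) * ξ ^ 2 + 2 * (Y / (2 * S)) * A := by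
    have e1 : Y ^ 2 / (4 * S ^ 3) * ξ ^ 2 ≤ Y ^ 2 / (4 * S ^ 3) * (4 * X * A) :=
      mul_le_mul_of_nonneg_left h1 (by positivity)
    have e2 : 2 * (Y / (2 * S)) * A = Y ^ 2 / (4 * S ^ 3) * (4 * X * A) + Y ^ 2 * Z / S ^ 3 * A := by
      field_simp
      rw [hsq]; ring
    linarith
  have hη : 0 ≤ (q * (q - 1) * (Z / Y) / (2 * S) - (q * Z + X) ^ 2 / (4 * S ^ 3)) * η ^ 2 +
      2 * ((q * Z + X) / (2 * S)) * B := by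
    have e1 : (q * Z + X) / (4 * Y * S) * η ^ 2 ≤ (q * Z + X) / (4 * Y * S) * (4 * Y * B) :=
      mul_le_mul_of_nonneg_left h2 (by positivity)
    have e2 : (q * Z + X) / (4 * Y * S) * (4 * Y * B) = 2 * ((q * Z + X) / (2 * S)) * B := by
      field_simp
    have e3 : (q * (q - 1) * (Z / Y) / (2 * S) - (q * Z + X) ^ 2 / (4 * S ^ 3)) * η ^ 2 +
        (q * Z + X) / (4 * Y * S) * η ^ 2 =
        (q - 1) * Z * (q * Z + (2 * q - 1) * X) / (4 * S ^ 3) * η ^ 2 := by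
      field_simp
      rw [hsq]; ring
    have e4 : 0 ≤ (q - 1) * Z * (q * Z + (2 * q - 1) * X) / (4 * S ^ 3) * η ^ 2 := by
      have : 0 ≤ q - 1 := by linarith
      have : 0 ≤ 2 * q - 1 := by linarith
      positivity
    linarith
  -- the mixed term
  set R := 4 * √(X * Y) * (((2 - q) * (Z * Y) + X * Y) / (4 * S ^ 3)) with hRdef
  have hq2' : 0 ≤ 2 - q := by linarith
  have hXY : √(X * Y) ^ 2 = X * Y := Real.sq_sqrt (by positivity)
  have hXY0 : 0 < √(X * Y) := Real.sqrt_pos.2 (by positivity)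
  have hR0 : 0 ≤ R := by positivity
  have hR : R ^ 2 ≤ X / (Z + X) := by
    have e1 : R ≤ √(X * Y) / S := by
      have : ((2 - q) * (Z * Y) + X * Y) / (4 * S ^ 3) ≤ S ^ 2 / (4 * S ^ 3) := by
        gcongr
        rw [hsq]
        nlinarith [mul_pos hZ hY]
      calc R ≤ 4 * √(X * Y) * (S ^ 2 / (4 * S ^ 3)) := by rw [hRdef]; gcongr
        _ = _ := by field_simp
    calc R ^ 2 ≤ (√(X * Y) / S) ^ 2 := by gcongr
      _ = X / (Z + X) := by rw [div_pow, hXY, hsq]; field_simp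
  have hmix : 2 * (((2 - q) * (Z * Y) + X * Y) / (4 * S ^ 3)) * (ξ * η) =
      2 * R * (ξ * η / (4 * √(X * Y))) := by
    rw [hRdef]; field_simp
  have hx : (ξ * η / (4 * √(X * Y))) ^ 2 ≤ A * B := by
    rw [div_pow, mul_pow 4, hXY, div_le_iff₀ (by positivity)]
    calc (ξ * η) ^ 2 = ξ ^ 2 * η ^ 2 := by ring
      _ ≤ (4 * X * A) * (4 * Y * B) := mul_le_mul h1 h2 (sq_nonneg _) (by positivity)
      _ = _ := by ring
  have hXp : 0 < X ^ (p / 2 - 1) := Real.rpow_pos_of_pos hX _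
  have hmain := coupling_discriminant hX hY hZ hS hm (E := (p - 1) * X ^ (p / 2 - 1))
    (mul_nonneg (by linarith) hXp.le) hsq hmZ (fun hc => ?_) hR
  swap
  -- Conjugacy gives `(q - 1)(p/2 - 1) = 1 - q/2`, so `m` is a power of `Z`; this is why the two
  -- regions are separated by comparing `X` with `Z`.
  · have e1 : m ≤ X ^ (p / 2 - 1) := by
      calc m = Z ^ (p / 2 - 1) := by
            rw [hmdef, hZdef, ← Real.rpow_mul hY.le]; congr 1; linear_combination -hpq / 2
        _ ≤ _ := Real.rpow_le_rpow hZ.le hc (by linarith)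
    nlinarith [mul_le_mul_of_nonneg_right (show 1 ≤ p - 1 by linarith) hXp.le]
  have := quadratic_bound hm hA hB hx hmain
  rw [hmix]
  rw [show (15 : ℝ) * (1 / m) = 15 / m by ring]
  linarith

/-! ### Assembly of the Bellman function. -/

/-- The explicit Bellman function for `p ≥ 2`. -/
noncomputable def bellman {p q : ℝ} (hp : 2 ≤ p) (hpq : (p - 1) * (q - 1) = 1) :
    Bellman p q (18 * (p - 1)) where
  H X Y := (p - 1) / p * X ^ (p / 2) + 15 * (p - 1) / q * Y ^ (q / 2) + coupling q X Y
  H1 X Y := (p - 1) / p * (p / 2) * X ^ (p / 2 - 1) + 0 + Y / (2 * coupling q X Y)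
  H2 X Y := 0 + 15 * (p - 1) / q * (q / 2) * Y ^ (q / 2 - 1) +
    (q * Y ^ (q - 1) + X) / (2 * coupling q X Y)
  H11 X Y := (p - 1) / p * (p / 2) * (p / 2 - 1) * X ^ (p / 2 - 1 - 1) + 0 +
    -(Y ^ 2 / (4 * coupling q X Y ^ 3))
  H12 X Y := 0 + 0 + ((2 - q) * Y ^ q + X * Y) / (4 * coupling q X Y ^ 3)
  H22 X Y := 0 + 15 * (p - 1) / q * (q / 2) * (q / 2 - 1) * Y ^ (q / 2 - 1 - 1) +
    (q * (q - 1) * Y ^ (q - 2) / (2 * coupling q X Y) -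
        (q * Y ^ (q - 1) + X) ^ 2 / (4 * coupling q X Y ^ 3))
  partials := ((hasPartials_rpow_left _ _).add (hasPartials_rpow_right _ _)).add
    (hasPartials_coupling q)
  -- Identically vanishing partials are seen as `0 · Y^0` and `0 · X^0` to fit the power rule.
  partials1 := ((hasPartials_rpow_left _ _).add
    (by simpa using hasPartials_rpow_right 0 0)).add (hasPartials_coupling1 q)
  partials2 := (HasPartials.add (by simpa using hasPartials_rpow_left 0 0)
    (hasPartials_rpow_right _ _)).add (hasPartials_coupling2 q)
  cont := by
    have hq1 : 1 < q := by nlinarith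
    refine Continuous.continuousOn (Continuous.add ?_ (continuousOn_coupling (by linarith)))
    refine (continuous_const.mul (continuous_fst.rpow_const fun _ => Or.inr ?_)).add
      (continuous_const.mul (continuous_snd.rpow_const fun _ => Or.inr ?_)) <;> linarith
  cont1 := by
    have hq1 : 1 < q := by nlinarith
    have hc := (continuousOn_coupling (q := q) (by linarith)).continuousOn
      (s := Ioi 0 ×ˢ Ioi 0)
    refine (((continuousOn_rpow_fst _).const_mul _).add continuousOn_const).add
      (continuousOn_snd.div (hc.const_mul 2) fun x hx => ?_)
    exact (mul_pos two_pos (coupling_pos hx.1 hx.2)).ne'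
  cont2 := by
    have hq1 : 1 < q := by nlinarith
    have hc := (continuousOn_coupling (q := q) (by linarith)).continuousOn
      (s := Ioi 0 ×ˢ Ioi 0)
    refine (continuousOn_const.add ((continuousOn_rpow_snd _).const_mul _)).add
      ((((continuousOn_rpow_snd _).const_mul _).add continuousOn_fst).div (hc.const_mul 2)
        fun x hx => ?_)
    exact (mul_pos two_pos (coupling_pos hx.1 hx.2)).ne'
  cont11 := by
    have hq1 : 1 < q := by nlinarith
    have hc := (continuousOn_coupling (q := q) (by linarith)).continuousOn
      (s := Ioi 0 ×ˢ Ioi 0)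
    refine (((continuousOn_rpow_fst _).const_mul _).add continuousOn_const).add
      ((continuousOn_snd.pow 2).div ((hc.pow 3).const_mul 4) fun x hx => ?_).neg
    exact (mul_pos four_pos (pow_pos (coupling_pos hx.1 hx.2) 3)).ne'
  cont12 := by
    have hq1 : 1 < q := by nlinarith
    have hc := (continuousOn_coupling (q := q) (by linarith)).continuousOn
      (s := Ioi 0 ×ˢ Ioi 0)
    refine continuousOn_const.add
      ((((continuousOn_rpow_snd _).const_mul _).add (continuousOn_fst.mul continuousOn_snd)).div
        ((hc.pow 3).const_mul 4) fun x hx => ?_)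
    exact (mul_pos four_pos (pow_pos (coupling_pos hx.1 hx.2) 3)).ne'
  cont22 := by
    have hq1 : 1 < q := by nlinarith
    have hc := (continuousOn_coupling (q := q) (by linarith)).continuousOn
      (s := Ioi 0 ×ˢ Ioi 0)
    refine (continuousOn_const.add ((continuousOn_rpow_snd _).const_mul _)).add
      ((((continuousOn_rpow_snd _).const_mul _).div (hc.const_mul 2) fun x hx => ?_).sub
      (((((continuousOn_rpow_snd _).const_mul _).add continuousOn_fst).pow 2).div
        ((hc.pow 3).const_mul 4) fun x hx => ?_))
    · exact (mul_pos two_pos (coupling_pos hx.1 hx.2)).ne'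
    · exact (mul_pos four_pos (pow_pos (coupling_pos hx.1 hx.2) 3)).ne'
  nonneg X Y hX hY := by
    have hq1 : 1 < q := by nlinarith
    have hp1 : 0 ≤ p - 1 := by linarith
    have : 0 ≤ coupling q X Y := Real.sqrt_nonneg _
    positivity
  nonneg1 X Y hX hY := by
    have hq1 : 1 < q := by nlinarith
    have hp1 : 0 ≤ p - 1 := by linarith
    have : 0 < coupling q X Y := coupling_pos hX hY
    positivity
  nonneg2 X Y hX hY := by
    have hq1 : 1 < q := by nlinarith
    have hp1 : 0 ≤ p - 1 := by linarith
    have : 0 < coupling q X Y := coupling_pos hX hY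
    positivity
  -- The coupling term is at most `Y^(q/2) + √X √Y`, and Young's inequality splits the product. In
  -- units of `X^(p/2)/p` and `Y^(q/2)/q` the totals are `p` and `15(p - 1) + q + 1`, both at most
  -- `18(p - 1)` since `q ≤ 2 ≤ p`.
  le X Y hX hY := by
    have hq1 : 1 < q := by nlinarith
    have hq2 : q ≤ 2 := by nlinarith
    have hU : 0 ≤ X ^ (p / 2) := Real.rpow_nonneg hX _
    have hV : 0 ≤ Y ^ (q / 2) := Real.rpow_nonneg hY _
    have hcoup : coupling q X Y ≤ Y ^ (q / 2) + (X ^ (p / 2) / p + Y ^ (q / 2) / q) := by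
      have e1 : √X * √Y ≤ √X ^ p / p + √Y ^ q / q := by
        refine Real.young_inequality_of_nonneg (Real.sqrt_nonneg _) (Real.sqrt_nonneg _) ?_
        rw [Real.holderConjugate_iff]
        refine ⟨by linarith, ?_⟩
        field_simp
        nlinarith
      have e2 : √X ^ p = X ^ (p / 2) := by
        rw [Real.sqrt_eq_rpow, ← Real.rpow_mul hX]; congr 1; ring
      have e3 : √Y ^ q = Y ^ (q / 2) := by
        rw [Real.sqrt_eq_rpow, ← Real.rpow_mul hY]; congr 1; ring
      have e4 : √(Y ^ q) = Y ^ (q / 2) := by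
        rw [Real.sqrt_eq_rpow, ← Real.rpow_mul hY]; congr 1; ring
      calc coupling q X Y ≤ √(Y ^ q) + √(X * Y) := by
              refine Real.sqrt_le_iff.2 ⟨by positivity, ?_⟩
              have r1 := Real.sq_sqrt (show 0 ≤ Y ^ q by positivity)
              have r2 := Real.sq_sqrt (show 0 ≤ X * Y by positivity)
              have r3 : 0 ≤ √(Y ^ q) * √(X * Y) := by positivity
              linarith [add_sq (√(Y ^ q)) (√(X * Y))]
        _ ≤ _ := by
          rw [e4, Real.sqrt_mul hX]
          rw [e2, e3] at e1
          linarith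
    have f1 : (p - 1) / p * X ^ (p / 2) + X ^ (p / 2) / p ≤ 18 * (p - 1) * (X ^ (p / 2) / p) := by
      have : (p - 1) / p * X ^ (p / 2) + X ^ (p / 2) / p = p * (X ^ (p / 2) / p) := by
        field_simp; ring
      rw [this]
      refine mul_le_mul_of_nonneg_right (by linarith) (by positivity)
    have f2 : 15 * (p - 1) / q * Y ^ (q / 2) + (Y ^ (q / 2) + Y ^ (q / 2) / q) ≤
        18 * (p - 1) * (Y ^ (q / 2) / q) := by
      have : 15 * (p - 1) / q * Y ^ (q / 2) + (Y ^ (q / 2) + Y ^ (q / 2) / q) =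
        (15 * (p - 1) + q + 1) * (Y ^ (q / 2) / q) := by
        field_simp; ring
      rw [this]
      refine mul_le_mul_of_nonneg_right (by linarith) (by positivity)
    linarith
  hess X Y hX hY := by
    have hq1 : 1 < q := by nlinarith
    have hq2 : q ≤ 2 := by nlinarith
    refine ⟨15 / 100 * Y ^ (1 - q / 2), by positivity, fun ξ η A B h1 h2 => ?_⟩
    refine (coupling_hess hp hpq hX hY h1 h2).trans ?_
    have e1 : (p - 1) * X ^ (p / 2 - 1) * A ≤
        (p - 1) / p * (p / 2) * (p / 2 - 1) * X ^ (p / 2 - 1 - 1) * ξ ^ 2 +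
        2 * ((p - 1) / p * (p / 2) * X ^ (p / 2 - 1)) * A := by
      have : 0 ≤ (p - 1) / p * (p / 2) * (p / 2 - 1) * X ^ (p / 2 - 1 - 1) * ξ ^ 2 := by
        have : 0 ≤ p - 1 := by linarith
        have : 0 ≤ p / 2 - 1 := by linarith
        positivity
      have e : 2 * ((p - 1) / p * (p / 2) * X ^ (p / 2 - 1)) * A = (p - 1) * X ^ (p / 2 - 1) * A := by
        field_simp
      linarith
    -- For `q ≤ 2` the second derivative of `Y^(q/2)` is nonpositive. The constraint on `η²` bounds
    -- the loss and leaves the factor `(p - 1)(q - 1) = 1`, which is why this power carries the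
    -- weight `p - 1`.
    have e2 : 15 * Y ^ (q / 2 - 1) * B ≤
        15 * (p - 1) / q * (q / 2) * (q / 2 - 1) * Y ^ (q / 2 - 1 - 1) * η ^ 2 +
        2 * (15 * (p - 1) / q * (q / 2) * Y ^ (q / 2 - 1)) * B := by
      rw [show Y ^ (q / 2 - 1 - 1) = Y ^ (q / 2 - 1) / Y from Real.rpow_sub_one hY.ne' _]
      have hZ : 0 < Y ^ (q / 2 - 1) := by positivity
      set Z := Y ^ (q / 2 - 1)
      have e : 15 * (p - 1) / q * (q / 2) * (1 - q / 2) * (Z / Y) * η ^ 2 ≤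
        15 * (p - 1) / q * (q / 2) * (1 - q / 2) * (Z / Y) * (4 * Y * B) := by
        refine mul_le_mul_of_nonneg_left h2 ?_
        have : 0 ≤ p - 1 := by linarith
        have : 0 ≤ 1 - q / 2 := by linarith
        positivity
      have e' : 15 * (p - 1) / q * (q / 2) * (1 - q / 2) * (Z / Y) * (4 * Y * B) =
          2 * (15 * (p - 1) / q * (q / 2) * Z) * B - 15 * ((p - 1) * (q - 1)) * (Z * B) := by
        field_simp; ring
      rw [e', hpq] at e
      linarith
    linarith

/-- The larger of two conjugate exponents is at least 2, so the explicit function applies either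
directly or with its variables exchanged. -/
theorem exists_bellman {p q : ℝ} (hpq : p.HolderConjugate q) :
    Nonempty (Bellman p q (18 * (max p q - 1))) := by
  have h := hpq.mul_eq_add
  have h1 : (p - 1) * (q - 1) = 1 := by linarith
  have hp := hpq.lt
  have hq := hpq.symm.lt
  rcases le_total q p with hle | hle
  · rw [max_eq_left hle]
    exact ⟨bellman (by nlinarith) h1⟩
  · rw [max_eq_right hle]
    exact ⟨(bellman (by nlinarith) (by linarith)).swap⟩

end JacobiRiesz

/-! ### Products of Jacobi polynomials -/

namespace JacobiRiesz

open Set Filter Topology Polynomial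

variable {d : ℕ}

/-- The closed cube `[-1,1]^d`. -/
def cube (d : ℕ) : Set (Fin d → ℝ) := Set.univ.pi fun _ => Icc (-1) 1

theorem isCompact_cube : IsCompact (cube d) := isCompact_univ_pi fun _ => isCompact_Icc

theorem mem_cube {x : Fin d → ℝ} : x ∈ cube d ↔ ∀ i, x i ∈ Icc (-1 : ℝ) 1 :=
  Set.mem_univ_pi

theorem ae_mem_Ioo (α β : Fin d → ℝ) : ∀ᵐ x ∂(measure α β), ∀ i, x i ∈ Ioo (-1 : ℝ) 1 :=
  ae_all_iff.2 fun i => (Measure.tendsto_eval_ae_ae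
    (μ := fun i => measure1 (α i) (β i)) (i := i)).eventually (ae_mem_Ioo_measure1 _ _)

theorem ae_mem_cube (α β : Fin d → ℝ) : ∀ᵐ x ∂(measure α β), x ∈ cube d := by
  filter_upwards [ae_mem_Ioo α β] with x hx
  exact mem_cube.2 fun i => Ioo_subset_Icc_self (hx i)

theorem isProbabilityMeasure_measure {α β : Fin d → ℝ}
    (hα : ∀ i, -(1 / 2 : ℝ) ≤ α i) (hβ : ∀ i, -(1 / 2 : ℝ) ≤ β i) :
    IsProbabilityMeasure (measure α β) := by
  have := fun i => isProbabilityMeasure_measure1 (hα i) (hβ i)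
  unfold measure
  infer_instance

theorem aestronglyMeasurable_of_continuousOn (α β : Fin d → ℝ) {f : (Fin d → ℝ) → ℝ}
    (hf : ContinuousOn f (cube d)) : AEStronglyMeasurable f (measure α β) := by
  rw [← Measure.restrict_eq_self_of_ae_mem (ae_mem_cube α β)]
  exact hf.aestronglyMeasurable isCompact_cube.isClosed.measurableSet

theorem integrable_of_continuousOn (α β : Fin d → ℝ) {f : (Fin d → ℝ) → ℝ}
    (hf : ContinuousOn f (cube d)) : Integrable f (measure α β) := by
  obtain ⟨C, hC⟩ := isCompact_cube.exists_bound_of_continuousOn hf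
  refine Integrable.of_bound (aestronglyMeasurable_of_continuousOn α β hf) C ?_
  filter_upwards [ae_mem_cube α β] with x hx using hC x hx

theorem integrable_of_continuous (α β : Fin d → ℝ) {f : (Fin d → ℝ) → ℝ}
    (hf : Continuous f) : Integrable f (measure α β) :=
  integrable_of_continuousOn α β hf.continuousOn

/-- Fubini's theorem in one coordinate. -/
theorem integral_eq_zero_of_slices (α β : Fin d → ℝ) {f : (Fin d → ℝ) → ℝ}
    (hf : Integrable f (measure α β)) (j : Fin d)
    (h : ∀ x, (∀ i, i ≠ j → x i ∈ Icc (-1 : ℝ) 1) →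
      ∫ s, f (Function.update x j s) ∂(measure1 (α j) (β j)) = 0) :
    ∫ x, f x ∂(measure α β) = 0 := by
  obtain _ | n := d
  · exact j.elim0
  have hmp := (measurePreserving_piFinSuccAbove (fun i => measure1 (α i) (β i)) j).symm
  have hint := (hmp.integrable_comp_emb (MeasurableEquiv.measurableEmbedding _)).2 hf
  have heq := hmp.integral_comp (MeasurableEquiv.measurableEmbedding _) f
  unfold measure
  rw [← heq]
  refine (integral_prod_symm _ hint).trans ?_
  refine integral_eq_zero_of_ae ?_
  filter_upwards [ae_mem_cube (fun i => α (j.succAbove i)) (fun i => β (j.succAbove i))] with y hy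
  have := h (j.insertNth 0 y) fun i hi => by
    obtain ⟨l, rfl⟩ := Fin.exists_succAbove_eq hi
    simpa using mem_cube.1 hy l
  simp only [Fin.update_insertNth] at this
  exact this

/-- The tensor product of one-variable polynomials. -/
noncomputable def tens (P : Fin d → ℝ[X]) (x : Fin d → ℝ) : ℝ := ∏ j, (P j).eval (x j)

theorem continuous_tens (P : Fin d → ℝ[X]) : Continuous (tens P) := by
  unfold tens; fun_prop

/-- The polynomial factors of `∂_i φ_k`. -/
noncomputable def gradPoly (α β : Fin d → ℝ) (i : Fin d) (k : Fin d → ℕ) (j : Fin d) : ℝ[X] :=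
  if j = i then derivative (jacobiN (α j) (β j) (k j)) else jacobiN (α j) (β j) (k j)

/-- The partial derivative `∂_i φ_k`. -/
noncomputable def grad (α β : Fin d → ℝ) (i : Fin d) (k : Fin d → ℕ) : (Fin d → ℝ) → ℝ :=
  tens (gradPoly α β i k)

theorem phi_eq_tens (α β : Fin d → ℝ) (k : Fin d → ℕ) :
    phi α β k = tens fun j => jacobiN (α j) (β j) (k j) := rfl

theorem continuous_phi (α β : Fin d → ℝ) (k : Fin d → ℕ) : Continuous (phi α β k) :=
  continuous_tens _

theorem continuous_grad (α β : Fin d → ℝ) (i : Fin d) (k : Fin d → ℕ) :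
    Continuous (grad α β i k) :=
  continuous_tens _

theorem delta_phi_eq (α β : Fin d → ℝ) (i : Fin d) (k : Fin d → ℕ) (x : Fin d → ℝ) :
    delta i (phi α β k) x = √(1 - x i ^ 2) * grad α β i k x := by
  rw [delta_phi, grad, tens, ← Finset.mul_prod_erase _ _ (Finset.mem_univ i)]
  congr 2
  · simp [gradPoly]
  · refine Finset.prod_congr rfl fun j hj => ?_
    simp [gradPoly, Finset.ne_of_mem_erase hj]

theorem integral_phi_mul_phi {α β : Fin d → ℝ} (hα : ∀ i, -(1 / 2 : ℝ) ≤ α i)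
    (hβ : ∀ i, -(1 / 2 : ℝ) ≤ β i) (k l : Fin d → ℕ) :
    ∫ x, phi α β k x * phi α β l x ∂(measure α β) = if k = l then 1 else 0 := by
  simp only [phi, ← Finset.prod_mul_distrib]
  unfold measure
  rw [integral_fintype_prod_eq_prod (f := fun j x => (jacobiN (α j) (β j) (k j)).eval x *
    (jacobiN (α j) (β j) (l j)).eval x)]
  simp only [fun j => integral_jacobiN_mul (hα j) (hβ j)]
  split_ifs with h
  · simp [h]
  · obtain ⟨j, hj⟩ := Function.ne_iff.1 h
    exact Finset.prod_eq_zero (Finset.mem_univ j) (if_neg hj)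

/-- The integral factors over coordinates: coordinate `i` gives the pairing of derivatives, the
others plain orthogonality. Thus `‖δ_i φ_k‖²` is the `i`-th summand of `λ_k`. -/
theorem integral_grad_mul_grad {α β : Fin d → ℝ} (hα : ∀ i, -(1 / 2 : ℝ) ≤ α i)
    (hβ : ∀ i, -(1 / 2 : ℝ) ≤ β i) (i : Fin d) (k l : Fin d → ℕ) :
    ∫ x, (1 - x i ^ 2) * (grad α β i k x * grad α β i l x) ∂(measure α β) =
      if k = l then eigenvalue1 (α i) (β i) (k i) else 0 := by
  have h1 : ∀ x : Fin d → ℝ, (1 - x i ^ 2) * (grad α β i k x * grad α β i l x) =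
      ∏ j, (if j = i then 1 - x j ^ 2 else 1) *
        ((gradPoly α β i k j).eval (x j) * (gradPoly α β i l j).eval (x j)) := by
    intro x
    rw [Finset.prod_mul_distrib, Finset.prod_mul_distrib, Finset.prod_ite_eq']
    simp [grad, tens]
  have h2 : ∀ j, ∫ x, (if j = i then 1 - x ^ 2 else 1) *
        ((gradPoly α β i k j).eval x * (gradPoly α β i l j).eval x) ∂(measure1 (α j) (β j)) =
      (if j = i then eigenvalue1 (α i) (β i) (k i) else 1) * (if k j = l j then 1 else 0) := by
    intro j
    by_cases hj : j = i
    · subst hj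
      simp only [if_true, gradPoly]
      rw [integral_derivative_jacobiN_mul (hα j) (hβ j), integral_jacobiN_mul (hα j) (hβ j)]
    · simp only [hj, if_false, gradPoly, one_mul]
      rw [integral_jacobiN_mul (hα j) (hβ j)]
  simp only [h1]
  unfold measure
  rw [integral_fintype_prod_eq_prod (f := fun j x => (if j = i then 1 - x ^ 2 else 1) *
        ((gradPoly α β i k j).eval x * (gradPoly α β i l j).eval x))]
  simp only [h2]
  rw [Finset.prod_mul_distrib, Finset.prod_ite_eq', if_pos (Finset.mem_univ i)]
  split_ifs with h
  · simp [h]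
  · obtain ⟨j, hj⟩ := Function.ne_iff.1 h
    rw [Finset.prod_eq_zero (Finset.mem_univ j) (if_neg hj), mul_zero]

theorem eigenvalue_eq (α β : Fin d → ℝ) (k : Fin d → ℕ) :
    eigenvalue α β k = ∑ i, eigenvalue1 (α i) (β i) (k i) := rfl

theorem eigenvalue1_le_eigenvalue {α β : Fin d → ℝ} (hα : ∀ i, -(1 / 2 : ℝ) ≤ α i)
    (hβ : ∀ i, -(1 / 2 : ℝ) ≤ β i) (i : Fin d) (k : Fin d → ℕ) :
    eigenvalue1 (α i) (β i) (k i) ≤ eigenvalue α β k :=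
  Finset.single_le_sum (f := fun i => eigenvalue1 (α i) (β i) (k i))
    (fun i _ => eigenvalue1_nonneg (hα i) (hβ i) _) (Finset.mem_univ i)

theorem eigenvalue_pos {α β : Fin d → ℝ} (hα : ∀ i, -(1 / 2 : ℝ) ≤ α i)
    (hβ : ∀ i, -(1 / 2 : ℝ) ≤ β i) {k : Fin d → ℕ} (hk : k ≠ 0) : 0 < eigenvalue α β k := by
  obtain ⟨i, hi⟩ := Function.ne_iff.1 hk
  refine lt_of_lt_of_le ?_ (eigenvalue1_le_eigenvalue hα hβ i k)
  have := eigenvalue1_strictMono (hα i) (hβ i) (Nat.pos_of_ne_zero hi)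
  simpa [eigenvalue1] using this

/-! ### Density of the tensor products -/

/-- If each sequence `q j` spans the polynomials, their tensor products span all tensor products. -/
theorem tens_mem_span (q : Fin d → ℕ → ℝ[X]) (hq : ∀ j, Submodule.span ℝ (range (q j)) = ⊤)
    (P : Fin d → ℝ[X]) :
    tens P ∈ Submodule.span ℝ (range fun k : Fin d → ℕ => tens fun j => q j (k j)) := by
  have h : ∀ j, ∃ c : ℕ →₀ ℝ, (c.sum fun n r => r • q j n) = P j := fun j =>
    Finsupp.mem_span_range_iff_exists_finsupp.1 (hq j ▸ Submodule.mem_top)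
  choose c hc using h
  have : tens P = ∑ k ∈ Fintype.piFinset fun j => (c j).support,
      (∏ j, c j (k j)) • tens fun j => q j (k j) := by
    funext x
    simp only [tens, Finset.sum_apply, Pi.smul_apply, smul_eq_mul, ← Finset.prod_mul_distrib]
    rw [← Finset.prod_univ_sum (fun j => (c j).support) fun j n => c j n * (q j n).eval (x j)]
    refine Finset.prod_congr rfl fun j _ => ?_
    rw [← hc j, Finsupp.sum, Polynomial.eval_finsetSum]
    simp
  rw [this]
  exact Submodule.sum_mem _ fun k _ => Submodule.smul_mem _ _ (Submodule.subset_span ⟨k, rfl⟩)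

/-- Tensor products of polynomials are uniformly dense in the continuous functions on the cube. -/
theorem exists_tens_approx (q : Fin d → ℕ → ℝ[X])
    (hq : ∀ j, Submodule.span ℝ (range (q j)) = ⊤) {f : (Fin d → ℝ) → ℝ}
    (hf : Continuous f) {ε : ℝ} (hε : 0 < ε) :
    ∃ g ∈ Submodule.span ℝ (range fun k : Fin d → ℕ => tens fun j => q j (k j)),
      ∀ x ∈ cube d, |g x - f x| < ε := by
  set V := Submodule.span ℝ (range fun k : Fin d → ℕ => tens fun j => q j (k j)) with hV
  have : CompactSpace (cube d) := isCompact_iff_compactSpace.1 isCompact_cube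
  let ev : MvPolynomial (Fin d) ℝ →ₐ[ℝ] C(cube d, ℝ) :=
    MvPolynomial.aeval fun i => ⟨fun x => x.1 i, (continuous_apply i).comp continuous_subtype_val⟩
  have hev : ∀ (p : MvPolynomial (Fin d) ℝ) (x : cube d), ev p x = MvPolynomial.eval x.1 p := by
    intro p x
    induction p using MvPolynomial.induction_on with
    | C a => simp [ev]
    | add p q hp hq => simp [hp, hq]
    | mul_X p i hp => simp [hp]; simp [ev]
  have hsep : ev.range.SeparatesPoints := by
    intro x y hxy
    obtain ⟨i, hi⟩ := Function.ne_iff.1 (fun h => hxy (Subtype.ext h) : x.1 ≠ y.1)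
    refine ⟨_, ⟨ev (MvPolynomial.X i), ⟨MvPolynomial.X i, rfl⟩, rfl⟩, ?_⟩
    simpa [hev] using hi
  -- Monomials are tensor products of powers, so `V` contains every polynomial that
  -- Stone-Weierstrass provides.
  have hpoly : ∀ p : MvPolynomial (Fin d) ℝ, (fun x => MvPolynomial.eval x p) ∈ V := by
    intro p
    induction p using MvPolynomial.induction_on' with
    | monomial m a =>
      have : (fun x => MvPolynomial.eval x (MvPolynomial.monomial m a)) =
          a • tens fun j => (X : ℝ[X]) ^ (m j) := by
        funext x
        simp [tens, MvPolynomial.eval_monomial, Finsupp.prod_fintype]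
      rw [this]
      exact V.smul_mem _ (tens_mem_span q hq _)
    | add p q hp hq =>
      simp only [map_add]
      exact V.add_mem hp hq
  obtain ⟨⟨g, p, rfl⟩, hp⟩ := ContinuousMap.exists_mem_subalgebra_near_continuous_of_separatesPoints
    ev.range hsep (fun x : cube d => f x.1) (by fun_prop) ε hε
  refine ⟨_, hpoly p, fun x hx => ?_⟩
  have := hp ⟨x, hx⟩
  rw [Real.norm_eq_abs] at this
  rw [← hev p ⟨x, hx⟩]
  exact this

theorem span_range_eq_top_of_degree {q : ℕ → ℝ[X]} (hq : ∀ n, (q n).degree = n) :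
    Submodule.span ℝ (range q) = ⊤ := by
  let S : Polynomial.Sequence ℝ := ⟨q, hq⟩
  refine S.span fun i => ?_
  exact isUnit_iff_ne_zero.2 (leadingCoeff_ne_zero.2 (S.ne_zero i))

theorem exists_phi_approx {α β : Fin d → ℝ} (hα : ∀ i, -(1 / 2 : ℝ) ≤ α i)
    (hβ : ∀ i, -(1 / 2 : ℝ) ≤ β i) {f : (Fin d → ℝ) → ℝ} (hf : Continuous f) {ε : ℝ}
    (hε : 0 < ε) : ∃ c : (Fin d → ℕ) →₀ ℝ,
      ∀ x ∈ cube d, |(c.sum fun k r => r * phi α β k x) - f x| < ε := by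
  obtain ⟨g, hg, h⟩ := exists_tens_approx (fun j n => jacobiN (α j) (β j) n)
    (fun j => span_range_eq_top_of_degree (degree_jacobiN (hα j) (hβ j))) hf hε
  obtain ⟨c, rfl⟩ := Finsupp.mem_span_range_iff_exists_finsupp.1 hg
  refine ⟨c, fun x hx => ?_⟩
  have := h x hx
  simpa [Finsupp.sum, Finset.sum_apply, phi_eq_tens] using this

/-- Differentiation lowers the degree in `x_i` by exactly one, so the indices `k + e_i` again
provide every degree in every variable. The shift also avoids the index 0, where `λ_k` vanishes. -/
theorem exists_grad_approx {α β : Fin d → ℝ} (hα : ∀ i, -(1 / 2 : ℝ) ≤ α i)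
    (hβ : ∀ i, -(1 / 2 : ℝ) ≤ β i) (i : Fin d) {f : (Fin d → ℝ) → ℝ} (hf : Continuous f) {ε : ℝ}
    (hε : 0 < ε) : ∃ c : (Fin d → ℕ) →₀ ℝ, c 0 = 0 ∧
      ∀ x ∈ cube d, |(c.sum fun k r => r * grad α β i k x) - f x| < ε := by
  let q : Fin d → ℕ → ℝ[X] := fun j n =>
    if j = i then derivative (jacobiN (α j) (β j) (n + 1)) else jacobiN (α j) (β j) n
  have hq : ∀ j n, (q j n).degree = n := by
    intro j n
    by_cases hj : j = i
    · simp only [q, hj, if_true]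
      have h1 := degree_jacobiN (hα i) (hβ i) (n + 1)
      rw [degree_derivative (by rw [natDegree_eq_of_degree_eq_some h1]; omega),
        natDegree_eq_of_degree_eq_some h1]
      simp
    · simp only [q, hj, if_false]
      exact degree_jacobiN (hα j) (hβ j) n
  obtain ⟨g, hg, h⟩ := exists_tens_approx q (fun j => span_range_eq_top_of_degree (hq j)) hf hε
  obtain ⟨c, rfl⟩ := Finsupp.mem_span_range_iff_exists_finsupp.1 hg
  let e : (Fin d → ℕ) ↪ (Fin d → ℕ) := ⟨fun k => k + Pi.single i 1, add_left_injective _⟩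
  refine ⟨c.embDomain e, ?_, fun x hx => ?_⟩
  · refine Finsupp.embDomain_of_notMem_range _ _ _ ?_
    rintro ⟨k, hk⟩
    have := congrFun hk i
    simp [e] at this
  · have h1 : ∀ k, (tens fun j => q j (k j)) = grad α β i (e k) := by
      intro k
      refine congrArg tens (funext fun j => ?_)
      by_cases hj : j = i
      · have : e k j = k j + 1 := by subst hj; simp [e]
        simp only [q, gradPoly, if_pos hj, this]
      · have : e k j = k j := by simp [e, hj]
        simp only [q, gradPoly, if_neg hj, this]
    have := h x hx
    simp only [h1, Finsupp.sum, Finset.sum_apply, Pi.smul_apply, smul_eq_mul] at this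
    rw [Finsupp.sum_embDomain]
    exact this

end JacobiRiesz

/-! ### Jets and the wave-type operator of the Jacobi semigroup -/

namespace JacobiRiesz

open Set Filter Topology Polynomial

/-- A function of several variables with its first and second pure partial derivatives. -/
structure Jet (ι : Type*) [DecidableEq ι] where
  val : (ι → ℝ) → ℝ
  d1 : ι → (ι → ℝ) → ℝ
  d2 : ι → (ι → ℝ) → ℝ
  cont : Continuous val
  cont1 : ∀ e, Continuous (d1 e)
  cont2 : ∀ e, Continuous (d2 e)
  deriv1 : ∀ z e, HasDerivAt (fun s => val (Function.update z e s)) (d1 e z) (z e)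
  deriv2 : ∀ z e, HasDerivAt (fun s => d1 e (Function.update z e s)) (d2 e z) (z e)

namespace Jet

variable {ι : Type*} [DecidableEq ι]

/-- The jet of a constant. -/
def const (ι : Type*) [DecidableEq ι] (c : ℝ) : Jet ι where
  val _ := c
  d1 _ _ := 0
  d2 _ _ := 0
  cont := continuous_const
  cont1 _ := continuous_const
  cont2 _ := continuous_const
  deriv1 _ _ := hasDerivAt_const _ _
  deriv2 _ _ := hasDerivAt_const _ _

/-- The sum of two jets. -/
def add (J K : Jet ι) : Jet ι where
  val z := J.val z + K.val z
  d1 e z := J.d1 e z + K.d1 e z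
  d2 e z := J.d2 e z + K.d2 e z
  cont := J.cont.add K.cont
  cont1 e := (J.cont1 e).add (K.cont1 e)
  cont2 e := (J.cont2 e).add (K.cont2 e)
  deriv1 z e := (J.deriv1 z e).add (K.deriv1 z e)
  deriv2 z e := (J.deriv2 z e).add (K.deriv2 z e)

/-- The product of two jets. -/
def mul (J K : Jet ι) : Jet ι where
  val z := J.val z * K.val z
  d1 e z := J.d1 e z * K.val z + J.val z * K.d1 e z
  d2 e z := J.d2 e z * K.val z + 2 * (J.d1 e z * K.d1 e z) + J.val z * K.d2 e z
  cont := J.cont.mul K.cont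
  cont1 e := ((J.cont1 e).mul K.cont).add (J.cont.mul (K.cont1 e))
  cont2 e := (((J.cont2 e).mul K.cont).add (((J.cont1 e).mul (K.cont1 e)).const_mul 2)).add
    (J.cont.mul (K.cont2 e))
  deriv1 z e := by
    have := (J.deriv1 z e).mul (K.deriv1 z e)
    simpa only [Function.update_eq_self] using! this
  deriv2 z e := by
    have := ((J.deriv2 z e).mul (K.deriv1 z e)).add ((J.deriv1 z e).mul (K.deriv2 z e))
    simp only [Function.update_eq_self] at this
    refine this.congr_deriv ?_
    ring

/-- A finite sum of jets. -/
def sum {κ : Type*} (s : Finset κ) (J : κ → Jet ι) : Jet ι where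
  val z := ∑ k ∈ s, (J k).val z
  d1 e z := ∑ k ∈ s, (J k).d1 e z
  d2 e z := ∑ k ∈ s, (J k).d2 e z
  cont := continuous_finsetSum _ fun k _ => (J k).cont
  cont1 e := continuous_finsetSum _ fun k _ => (J k).cont1 e
  cont2 e := continuous_finsetSum _ fun k _ => (J k).cont2 e
  deriv1 z e := HasDerivAt.fun_sum fun k _ => (J k).deriv1 z e
  deriv2 z e := HasDerivAt.fun_sum fun k _ => (J k).deriv2 z e

/-- A multiple of a jet. -/
def smul (c : ℝ) (J : Jet ι) : Jet ι where
  val z := c * J.val z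
  d1 e z := c * J.d1 e z
  d2 e z := c * J.d2 e z
  cont := J.cont.const_mul c
  cont1 e := (J.cont1 e).const_mul c
  cont2 e := (J.cont2 e).const_mul c
  deriv1 z e := (J.deriv1 z e).const_mul c
  deriv2 z e := (J.deriv2 z e).const_mul c

/-- The jet of `1 - z_i ^ 2`. -/
def oneSubSq (i : ι) : Jet ι where
  val z := 1 - z i ^ 2
  d1 e z := if e = i then -(2 * z i) else 0
  d2 e _ := if e = i then -2 else 0
  cont := by fun_prop
  cont1 e := by split_ifs <;> fun_prop
  cont2 e := continuous_const
  deriv1 z e := by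
    by_cases h : e = i
    · subst h
      simpa using ((hasDerivAt_id (z e)).pow 2).const_sub 1
    · simp only [if_neg h, Function.update_of_ne (Ne.symm h)]
      exact hasDerivAt_const _ _
  deriv2 z e := by
    by_cases h : e = i
    · subst h
      simp only [if_true, Function.update_self]
      simpa using ((hasDerivAt_id (z e)).const_mul (2 : ℝ)).fun_neg
    · simp only [if_neg h]
      exact hasDerivAt_const _ _

/-- The jet of a product of functions of one variable. -/
def prod [Fintype ι] (g g1 g2 : ι → ℝ → ℝ) (h : ∀ e s, HasDerivAt (g e) (g1 e s) s)
    (h1 : ∀ e s, HasDerivAt (g1 e) (g2 e s) s) (h2 : ∀ e, Continuous (g2 e)) : Jet ι where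
  val z := ∏ e, g e (z e)
  d1 e z := g1 e (z e) * ∏ e' ∈ Finset.univ.erase e, g e' (z e')
  d2 e z := g2 e (z e) * ∏ e' ∈ Finset.univ.erase e, g e' (z e')
  cont := continuous_finsetProd _ fun e _ =>
    (continuous_iff_continuousAt.2 fun s => (h e s).continuousAt).comp (continuous_apply e)
  cont1 e := ((continuous_iff_continuousAt.2 fun s => (h1 e s).continuousAt).comp
    (continuous_apply e)).mul (continuous_finsetProd _ fun e _ =>
      (continuous_iff_continuousAt.2 fun s => (h e s).continuousAt).comp (continuous_apply e))
  cont2 e := ((h2 e).comp (continuous_apply e)).mul (continuous_finsetProd _ fun e _ =>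
      (continuous_iff_continuousAt.2 fun s => (h e s).continuousAt).comp (continuous_apply e))
  deriv1 z e := by
    have hf : (fun s => ∏ e', g e' (Function.update z e s e')) =
        fun s => g e s * ∏ e' ∈ Finset.univ.erase e, g e' (z e') := by
      funext s
      rw [← Finset.mul_prod_erase _ _ (Finset.mem_univ e), Function.update_self]
      congr 1
      exact Finset.prod_congr rfl fun j hj => by
        rw [Function.update_of_ne (Finset.ne_of_mem_erase hj)]
    rw [hf]
    exact (h e _).mul_const _
  deriv2 z e := by
    have hf : (fun s => g1 e (Function.update z e s e) *
        ∏ e' ∈ Finset.univ.erase e, g e' (Function.update z e s e')) =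
        fun s => g1 e s * ∏ e' ∈ Finset.univ.erase e, g e' (z e') := by
      funext s
      rw [Function.update_self]
      congr 1
      exact Finset.prod_congr rfl fun j hj => by
        rw [Function.update_of_ne (Finset.ne_of_mem_erase hj)]
    rw [hf]
    exact (h1 e _).mul_const _

end Jet

/-! ### The operator `∂_t² - L` and the equations for the extensions. -/

variable {d : ℕ}

/-- The second-order coefficients of `∂_t² - L`; the coordinate `0` is the time. -/
def rho (z : Fin (d + 1) → ℝ) : Fin (d + 1) → ℝ := Fin.cons 1 fun j => 1 - z j.succ ^ 2

/-- The first-order coefficients of `∂_t² - L`. -/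
noncomputable def sig (α β : Fin d → ℝ) (z : Fin (d + 1) → ℝ) : Fin (d + 1) → ℝ :=
  Fin.cons 0 fun j => drift (α j) (β j) (z j.succ)

@[simp] theorem rho_zero (z : Fin (d + 1) → ℝ) : rho z 0 = 1 := rfl

@[simp] theorem rho_succ (z : Fin (d + 1) → ℝ) (j : Fin d) : rho z j.succ = 1 - z j.succ ^ 2 := rfl

@[simp] theorem sig_zero (α β : Fin d → ℝ) (z : Fin (d + 1) → ℝ) : sig α β z 0 = 0 := rfl

@[simp] theorem sig_succ (α β : Fin d → ℝ) (z : Fin (d + 1) → ℝ) (j : Fin d) :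
    sig α β z j.succ = drift (α j) (β j) (z j.succ) := rfl

/-- The operator `∂_t² - L` on jets. -/
noncomputable def waveOp (α β : Fin d → ℝ) (J : Jet (Fin (d + 1))) (z : Fin (d + 1) → ℝ) : ℝ :=
  ∑ e, (rho z e * J.d2 e z + sig α β z e * J.d1 e z)

/-- The jet of `exp (-μ t) ∏ P_j(x_j)`. -/
noncomputable def expTens (μ : ℝ) (P : Fin d → ℝ[X]) : Jet (Fin (d + 1)) :=
  Jet.prod (Fin.cons (fun t => Real.exp (-(μ * t))) fun j s => (P j).eval s)
    (Fin.cons (fun t => -μ * Real.exp (-(μ * t))) fun j s => (derivative (P j)).eval s)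
    (Fin.cons (fun t => -μ * (-μ * Real.exp (-(μ * t))))
      fun j s => (derivative (derivative (P j))).eval s)
    (fun e s => by
      refine Fin.cases ?_ (fun j => ?_) e
      · have := (((hasDerivAt_id s).const_mul μ).neg).exp
        refine this.congr_deriv ?_
        simp only [Pi.neg_apply, id, Fin.cons_zero]; ring
      · exact Polynomial.hasDerivAt _ _)
    (fun e s => by
      refine Fin.cases ?_ (fun j => ?_) e
      · have := ((((hasDerivAt_id s).const_mul μ).neg).exp).const_mul (-μ)
        refine this.congr_deriv ?_
        simp only [Pi.neg_apply, id, Fin.cons_zero]; ring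
      · exact Polynomial.hasDerivAt _ _)
    (fun e => by
      refine Fin.cases ?_ (fun j => ?_) e
      · simp only [Fin.cons_zero]; fun_prop
      · exact Polynomial.continuous _)

theorem expTens_val (μ : ℝ) (P : Fin d → ℝ[X]) (t : ℝ) (x : Fin d → ℝ) :
    (expTens μ P).val (Fin.cons t x) = Real.exp (-(μ * t)) * tens P x := by
  simp [expTens, Jet.prod, Fin.prod_univ_succ, tens]

theorem expTens_d1_zero (μ : ℝ) (P : Fin d → ℝ[X]) (z : Fin (d + 1) → ℝ) :
    (expTens μ P).d1 0 z = -μ * (expTens μ P).val z := by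
  simp only [expTens, Jet.prod]
  rw [← Finset.mul_prod_erase _ _ (Finset.mem_univ (0 : Fin (d + 1)))]
  simp only [Fin.cons_zero]
  ring

theorem expTens_d2_zero (μ : ℝ) (P : Fin d → ℝ[X]) (z : Fin (d + 1) → ℝ) :
    (expTens μ P).d2 0 z = μ ^ 2 * (expTens μ P).val z := by
  simp only [expTens, Jet.prod]
  rw [← Finset.mul_prod_erase _ _ (Finset.mem_univ (0 : Fin (d + 1)))]
  simp only [Fin.cons_zero]
  ring

/-- The remaining factors of `expTens` after removing the coordinate `j`. -/
theorem exists_expTens_factor (μ : ℝ) (P : Fin d → ℝ[X]) (z : Fin (d + 1) → ℝ) (j : Fin d) :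
    ∃ R : ℝ, (expTens μ P).val z = (P j).eval (z j.succ) * R ∧
      (expTens μ P).d1 j.succ z = (derivative (P j)).eval (z j.succ) * R ∧
      (expTens μ P).d2 j.succ z = (derivative (derivative (P j))).eval (z j.succ) * R := by
  refine ⟨∏ e' ∈ Finset.univ.erase j.succ, (Fin.cons (fun t => Real.exp (-(μ * t)))
    (fun j s => (P j).eval s) : Fin (d + 1) → ℝ → ℝ) e' (z e'), ?_, ?_, ?_⟩
  · simp only [expTens, Jet.prod]
    rw [← Finset.mul_prod_erase _ _ (Finset.mem_univ j.succ), Fin.cons_succ]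
  · simp only [expTens, Jet.prod, Fin.cons_succ]
  · simp only [expTens, Jet.prod, Fin.cons_succ]

theorem expTens_d1_succ (μ : ℝ) (α β : Fin d → ℝ) (k : Fin d → ℕ) (t : ℝ) (x : Fin d → ℝ)
    (i : Fin d) :
    (expTens μ fun j => jacobiN (α j) (β j) (k j)).d1 i.succ (Fin.cons t x) =
      Real.exp (-(μ * t)) * grad α β i k x := by
  have h : (expTens μ fun j => jacobiN (α j) (β j) (k j)).d1 i.succ (Fin.cons t x) =
      (expTens μ (gradPoly α β i k)).val (Fin.cons t x) := by
    simp only [expTens, Jet.prod]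
    rw [← Finset.mul_prod_erase _ _ (Finset.mem_univ i.succ)]
    congr 1
    · simp [gradPoly]
    · refine Finset.prod_congr rfl fun e he => ?_
      have hne := Finset.ne_of_mem_erase he
      revert hne
      refine Fin.cases (fun _ => rfl) (fun j hj => ?_) e
      have : j ≠ i := fun h => hj (h ▸ rfl)
      simp [gradPoly, this]
  rw [h, expTens_val, grad]

/-- The time factor contributes `μ² = λ_k`, which cancels the sum of the one-dimensional
eigenvalues. -/
theorem waveOp_expTens_phi (α β : Fin d → ℝ) (k : Fin d → ℕ) {μ : ℝ}
    (hμ : μ ^ 2 = eigenvalue α β k) (z : Fin (d + 1) → ℝ) :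
    waveOp α β (expTens μ fun j => jacobiN (α j) (β j) (k j)) z = 0 := by
  set J := expTens μ fun j => jacobiN (α j) (β j) (k j) with hJ
  have h : ∀ j : Fin d, (rho z j.succ * J.d2 j.succ z + sig α β z j.succ * J.d1 j.succ z) =
      -eigenvalue1 (α j) (β j) (k j) * J.val z := by
    intro j
    obtain ⟨R, h0, h1, h2⟩ := exists_expTens_factor μ (fun j => jacobiN (α j) (β j) (k j)) z j
    rw [hJ, h0, h1, h2, rho_succ, sig_succ]
    linear_combination R * jacobiN_ode (α j) (β j) (k j) (z j.succ)
  rw [waveOp, Fin.sum_univ_succ]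
  simp only [h]
  rw [← Finset.sum_mul, hJ, expTens_d2_zero, hμ, eigenvalue_eq, Finset.sum_neg_distrib]
  simp

/-- Only the `i`-th factor obeys a different equation, the differentiated Jacobi equation. Its extra
terms are the cost of moving `∂_i` past `L`. -/
theorem waveOp_expTens_grad (α β : Fin d → ℝ) (i : Fin d) (k : Fin d → ℕ) {μ : ℝ}
    (hμ : μ ^ 2 = eigenvalue α β k) (z : Fin (d + 1) → ℝ) :
    waveOp α β (expTens μ (gradPoly α β i k)) z =
      2 * z i.succ * (expTens μ (gradPoly α β i k)).d1 i.succ z +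
        (α i + β i + 2) * (expTens μ (gradPoly α β i k)).val z := by
  set J := expTens μ (gradPoly α β i k) with hJ
  have h : ∀ j : Fin d, (rho z j.succ * J.d2 j.succ z + sig α β z j.succ * J.d1 j.succ z) =
      -eigenvalue1 (α j) (β j) (k j) * J.val z + if j = i then 2 * z j.succ * J.d1 j.succ z +
        (α j + β j + 2) * J.val z else 0 := by
    intro j
    obtain ⟨R, h0, h1, h2⟩ := exists_expTens_factor μ (gradPoly α β i k) z j
    rw [hJ, h0, h1, h2, rho_succ, sig_succ]
    split_ifs with hj
    · simp only [gradPoly, hj, if_true]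
      linear_combination R * jacobiN_derivative_ode (α i) (β i) (k i) (z i.succ)
    · simp only [gradPoly, hj, if_false]
      linear_combination R * jacobiN_ode (α j) (β j) (k j) (z j.succ)
  rw [waveOp, Fin.sum_univ_succ]
  simp only [h]
  rw [Finset.sum_add_distrib, Finset.sum_ite_eq', if_pos (Finset.mem_univ i), ← Finset.sum_mul]
  rw [hJ, expTens_d2_zero, hμ, eigenvalue_eq, Finset.sum_neg_distrib]
  simp

/-- `∂_e G_i`, where `G_i = √(1 - x_i²) Q`. -/
noncomputable def gradG (i : Fin d) (Q : Jet (Fin (d + 1))) (e : Fin (d + 1))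
    (z : Fin (d + 1) → ℝ) : ℝ :=
  √(1 - z i.succ ^ 2) * Q.d1 e z -
    if e = i.succ then z i.succ / √(1 - z i.succ ^ 2) * Q.val z else 0

theorem oneSubSq_mul_d1 (i : Fin d) (Q : Jet (Fin (d + 1))) (e : Fin (d + 1))
    {z : Fin (d + 1) → ℝ} (hz : z i.succ ∈ Ioo (-1 : ℝ) 1) :
    ((Jet.oneSubSq i.succ).mul (Q.mul Q)).d1 e z =
      2 * (√(1 - z i.succ ^ 2) * Q.val z * gradG i Q e z) := by
  have hpos : 0 < 1 - z i.succ ^ 2 := by nlinarith [hz.1, hz.2]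
  have hr : 0 < √(1 - z i.succ ^ 2) := Real.sqrt_pos.2 hpos
  have hsq := Real.sq_sqrt hpos.le
  simp only [Jet.mul, Jet.oneSubSq, gradG]
  split_ifs with h
  · field_simp
    rw [hsq]; ring
  · linear_combination -2 * Q.val z * Q.d1 e z * hsq

/-- A Bochner-type identity. The first-order terms supplied by `hQ` combine with those of the
product rule to match the cross term in `|∇G_i|²`, and all zero-order terms collect into the last
summand, nonnegative for `α_i, β_i ≥ -1/2`. -/
theorem waveOp_oneSubSq_mul (α β : Fin d → ℝ) (i : Fin d) (Q : Jet (Fin (d + 1)))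
    {z : Fin (d + 1) → ℝ} (hz : z i.succ ∈ Ioo (-1 : ℝ) 1)
    (hQ : waveOp α β Q z = 2 * z i.succ * Q.d1 i.succ z + (α i + β i + 2) * Q.val z) :
    waveOp α β ((Jet.oneSubSq i.succ).mul (Q.mul Q)) z = 2 * ∑ e, rho z e * gradG i Q e z ^ 2 +
      2 * Q.val z ^ 2 * ((α i + 1 / 2) * (1 + z i.succ) + (β i + 1 / 2) * (1 - z i.succ)) := by
  have hpos : 0 < 1 - z i.succ ^ 2 := by nlinarith [hz.1, hz.2]
  have hr : 0 < √(1 - z i.succ ^ 2) := Real.sqrt_pos.2 hpos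
  have hsq := Real.sq_sqrt hpos.le
  set x := z i.succ with hx
  set r := √(1 - x ^ 2) with hrdef
  have h1 : waveOp α β ((Jet.oneSubSq i.succ).mul (Q.mul Q)) z =
      2 * (1 - x ^ 2) * Q.val z * waveOp α β Q z +
      2 * (1 - x ^ 2) * (∑ e, rho z e * Q.d1 e z ^ 2) +
      (Q.val z ^ 2 * (-2 * (1 - x ^ 2) - 2 * x * drift (α i) (β i) x) -
        8 * (1 - x ^ 2) * x * Q.val z * Q.d1 i.succ z) := by
    -- The extra terms occur only in direction `i`; as indicator sums they reduce the identity to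
    -- one check per direction.
    have : (Q.val z ^ 2 * (-2 * (1 - x ^ 2) - 2 * x * drift (α i) (β i) x) -
        8 * (1 - x ^ 2) * x * Q.val z * Q.d1 i.succ z) = ∑ e, if e = i.succ then
          (Q.val z ^ 2 * (-2 * rho z e - 2 * x * sig α β z e) -
        8 * rho z e * x * Q.val z * Q.d1 e z) else 0 := by
      rw [Finset.sum_ite_eq', if_pos (Finset.mem_univ _), rho_succ, sig_succ]
    rw [this, waveOp, waveOp, Finset.mul_sum, Finset.mul_sum, ← Finset.sum_add_distrib,
      ← Finset.sum_add_distrib]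
    refine Finset.sum_congr rfl fun e _ => ?_
    simp only [Jet.mul, Jet.oneSubSq, ← hx]
    split_ifs with h
    · ring
    · ring
  have h2 : ∑ e, rho z e * gradG i Q e z ^ 2 = (1 - x ^ 2) * (∑ e, rho z e * Q.d1 e z ^ 2) +
      (-2 * (1 - x ^ 2) * x * Q.val z * Q.d1 i.succ z + x ^ 2 * Q.val z ^ 2) := by
    have : (-2 * (1 - x ^ 2) * x * Q.val z * Q.d1 i.succ z + x ^ 2 * Q.val z ^ 2) =
        ∑ e, if e = i.succ then (-2 * rho z e * x * Q.val z * Q.d1 e z +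
          rho z e / (1 - x ^ 2) * x ^ 2 * Q.val z ^ 2) else 0 := by
      rw [Finset.sum_ite_eq', if_pos (Finset.mem_univ _), rho_succ, ← hx, div_self hpos.ne', one_mul]
    rw [this, Finset.mul_sum, ← Finset.sum_add_distrib]
    refine Finset.sum_congr rfl fun e _ => ?_
    simp only [gradG, ← hx, ← hrdef]
    split_ifs with h
    · rw [sub_sq, mul_pow, mul_pow, div_pow, hsq]
      field_simp
      ring
    · rw [sub_zero, mul_pow, hsq]; ring
  rw [h1, h2, hQ]
  simp only [drift]
  ring

end JacobiRiesz

/-! ### The differential inequality for the Bellman function -/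

namespace JacobiRiesz

open Set Filter Topology Polynomial

namespace Bellman

variable {ι : Type*} [DecidableEq ι] {p q K : ℝ} (B : Bellman p q K) (X Y : Jet ι)

/-- The first partial derivatives of `H (X, Y)`. -/
def comp1 (e : ι) (z : ι → ℝ) : ℝ :=
  B.H1 (X.val z) (Y.val z) * X.d1 e z + B.H2 (X.val z) (Y.val z) * Y.d1 e z

/-- The second partial derivatives of `H (X, Y)`. -/
def comp2 (e : ι) (z : ι → ℝ) : ℝ :=
  B.H11 (X.val z) (Y.val z) * X.d1 e z ^ 2 +
    2 * B.H12 (X.val z) (Y.val z) * (X.d1 e z * Y.d1 e z) +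
    B.H22 (X.val z) (Y.val z) * Y.d1 e z ^ 2 +
    B.H1 (X.val z) (Y.val z) * X.d2 e z + B.H2 (X.val z) (Y.val z) * Y.d2 e z

variable {X Y}

theorem hasDerivAt_comp {z : ι → ℝ} (hX : 0 < X.val z) (hY : 0 < Y.val z) (e : ι) :
    HasDerivAt (fun s => B.H (X.val (Function.update z e s)) (Y.val (Function.update z e s)))
      (B.comp1 X Y e z) (z e) := by
  have := B.partials _ _ _ _ _ (X.deriv1 z e) (Y.deriv1 z e)
    (by rwa [Function.update_eq_self]) (by rwa [Function.update_eq_self])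
  simpa only [Function.update_eq_self] using! this

theorem hasDerivAt_comp1 {z : ι → ℝ} (hX : 0 < X.val z) (hY : 0 < Y.val z) (e : ι) :
    HasDerivAt (fun s => B.comp1 X Y e (Function.update z e s)) (B.comp2 X Y e z) (z e) := by
  have h1 := B.partials1 _ _ _ _ _ (X.deriv1 z e) (Y.deriv1 z e)
    (by rwa [Function.update_eq_self]) (by rwa [Function.update_eq_self])
  have h2 := B.partials2 _ _ _ _ _ (X.deriv1 z e) (Y.deriv1 z e)
    (by rwa [Function.update_eq_self]) (by rwa [Function.update_eq_self])
  have h3 := (h1.mul (X.deriv2 z e)).add (h2.mul (Y.deriv2 z e))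
  simp only [Function.update_eq_self] at h3
  refine h3.congr_deriv ?_
  simp only [comp2]
  ring

theorem continuousOn_pair {f : ℝ → ℝ → ℝ} {s : Set (ι → ℝ)}
    (hf : ContinuousOn (Function.uncurry f) (Ioi 0 ×ˢ Ioi 0))
    (hs : ∀ z ∈ s, 0 < X.val z ∧ 0 < Y.val z) :
    ContinuousOn (fun z => f (X.val z) (Y.val z)) s :=
  hf.comp (f := fun z => (X.val z, Y.val z)) (X.cont.prodMk Y.cont).continuousOn hs

theorem continuousOn_comp {s : Set (ι → ℝ)} (hs : ∀ z ∈ s, 0 < X.val z ∧ 0 < Y.val z) :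
    ContinuousOn (fun z => B.H (X.val z) (Y.val z)) s :=
  continuousOn_pair (B.cont.mono (prod_mono Ioi_subset_Ici_self Ioi_subset_Ici_self)) hs

theorem continuousOn_comp1 {s : Set (ι → ℝ)} (hs : ∀ z ∈ s, 0 < X.val z ∧ 0 < Y.val z) (e : ι) :
    ContinuousOn (B.comp1 X Y e) s :=
  ((continuousOn_pair B.cont1 hs).mul (X.cont1 e).continuousOn).add
    ((continuousOn_pair B.cont2 hs).mul (Y.cont1 e).continuousOn)

theorem continuousOn_comp2 {s : Set (ι → ℝ)} (hs : ∀ z ∈ s, 0 < X.val z ∧ 0 < Y.val z) (e : ι) :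
    ContinuousOn (B.comp2 X Y e) s :=
  (((((continuousOn_pair B.cont11 hs).mul ((X.cont1 e).continuousOn.pow 2)).add
    (((continuousOn_pair B.cont12 hs).const_mul 2).mul
      ((X.cont1 e).continuousOn.mul (Y.cont1 e).continuousOn))).add
    ((continuousOn_pair B.cont22 hs).mul ((Y.cont1 e).continuousOn.pow 2))).add
    ((continuousOn_pair B.cont1 hs).mul (X.cont2 e).continuousOn)).add
    ((continuousOn_pair B.cont2 hs).mul (Y.cont2 e).continuousOn)

end Bellman

variable {d : ℕ} {p q K : ℝ}

/-- The jet of `ε² + F²`. -/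
def sqJet (ε : ℝ) (F : Jet (Fin (d + 1))) : Jet (Fin (d + 1)) :=
  (Jet.const _ (ε ^ 2)).add (F.mul F)

/-- The jet of `ε² + ∑ (1 - x_i²) Q_i²`. -/
def sqSumJet (ε : ℝ) (Q : Fin d → Jet (Fin (d + 1))) : Jet (Fin (d + 1)) :=
  (Jet.const _ (ε ^ 2)).add
    (Jet.sum Finset.univ fun i => (Jet.oneSubSq i.succ).mul ((Q i).mul (Q i)))

theorem sqSumJet_val (ε : ℝ) (Q : Fin d → Jet (Fin (d + 1))) (z : Fin (d + 1) → ℝ) :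
    (sqSumJet ε Q).val z = ε ^ 2 + ∑ i, (1 - z i.succ ^ 2) * (Q i).val z ^ 2 := by
  simp [sqSumJet, Jet.add, Jet.const, Jet.sum, Jet.mul, Jet.oneSubSq, pow_two]

theorem sqJet_val (ε : ℝ) (F : Jet (Fin (d + 1))) (z : Fin (d + 1) → ℝ) :
    (sqJet ε F).val z = ε ^ 2 + F.val z ^ 2 := by
  simp [sqJet, Jet.add, Jet.const, Jet.mul, pow_two]

/-- The points of space-time over the closed cube. -/
def slab (d : ℕ) : Set (Fin (d + 1) → ℝ) := {z | Fin.tail z ∈ cube d}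

theorem cons_mem_slab {t : ℝ} {x : Fin d → ℝ} (hx : x ∈ cube d) :
    (Fin.cons t x : Fin (d + 1) → ℝ) ∈ slab d := by
  simpa [slab] using hx

/-- The shift by `ε²` keeps both arguments of `H` inside the open quadrant, where its derivatives
are available, even on the boundary of the cube. -/
theorem slab_pos {ε : ℝ} (hε : 0 < ε) (F : Jet (Fin (d + 1))) (Q : Fin d → Jet (Fin (d + 1))) :
    ∀ z ∈ slab d, 0 < (sqJet ε F).val z ∧ 0 < (sqSumJet ε Q).val z := by
  intro z hz
  rw [sqJet_val, sqSumJet_val]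
  have h : ∀ i : Fin d, 0 ≤ 1 - z i.succ ^ 2 := by
    intro i
    have := mem_cube.1 hz i
    have h2 : Fin.tail z i = z i.succ := rfl
    rw [h2] at this
    nlinarith [this.1, this.2]
  have h2 : 0 ≤ ∑ i, (1 - z i.succ ^ 2) * (Q i).val z ^ 2 :=
    Finset.sum_nonneg fun i _ => mul_nonneg (h i) (sq_nonneg _)
  constructor <;> positivity

theorem waveOp_sqJet (α β : Fin d → ℝ) (ε : ℝ) (F : Jet (Fin (d + 1))) (z : Fin (d + 1) → ℝ) :
    waveOp α β (sqJet ε F) z =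
      2 * F.val z * waveOp α β F z + 2 * ∑ e, rho z e * F.d1 e z ^ 2 := by
  simp only [waveOp]
  rw [Finset.mul_sum, Finset.mul_sum, ← Finset.sum_add_distrib]
  refine Finset.sum_congr rfl fun e _ => ?_
  simp only [sqJet, Jet.add, Jet.const, Jet.mul]
  ring

theorem waveOp_sqSumJet (α β : Fin d → ℝ) (ε : ℝ) (Q : Fin d → Jet (Fin (d + 1)))
    (z : Fin (d + 1) → ℝ) :
    waveOp α β (sqSumJet ε Q) z =
      ∑ i, waveOp α β ((Jet.oneSubSq i.succ).mul ((Q i).mul (Q i))) z := by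
  simp only [waveOp]
  rw [Finset.sum_comm]
  refine Finset.sum_congr rfl fun e _ => ?_
  simp only [sqSumJet, Jet.add, Jet.const, Jet.sum, zero_add]
  rw [Finset.mul_sum, Finset.mul_sum, ← Finset.sum_add_distrib]

theorem sqSumJet_d1 (ε : ℝ) (Q : Fin d → Jet (Fin (d + 1))) (e : Fin (d + 1))
    {z : Fin (d + 1) → ℝ} (hz : ∀ i : Fin d, z i.succ ∈ Ioo (-1 : ℝ) 1) :
    (sqSumJet ε Q).d1 e z =
      2 * ∑ i, √(1 - z i.succ ^ 2) * (Q i).val z * gradG i (Q i) e z := by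
  simp only [sqSumJet, Jet.add, Jet.const, Jet.sum, zero_add]
  rw [Finset.mul_sum]
  exact Finset.sum_congr rfl fun i _ => oneSubSq_mul_d1 i (Q i) e (hz i)

/-- The pointwise convexity estimate for the Bellman function along solutions. -/
theorem bellman_pointwise (B : Bellman p q K) {α β : Fin d → ℝ} (hα : ∀ i, -(1 / 2 : ℝ) ≤ α i)
    (hβ : ∀ i, -(1 / 2 : ℝ) ≤ β i) {ε : ℝ} (hε : 0 < ε) (F : Jet (Fin (d + 1)))
    (Q : Fin d → Jet (Fin (d + 1))) {z : Fin (d + 1) → ℝ}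
    (hz : ∀ i : Fin d, z i.succ ∈ Ioo (-1 : ℝ) 1) (hF : waveOp α β F z = 0)
    (hQ : ∀ i, waveOp α β (Q i) z =
      2 * z i.succ * (Q i).d1 i.succ z + (α i + β i + 2) * (Q i).val z) :
    3 * ∑ i : Fin d, (1 - z i.succ ^ 2) * -(F.d1 i.succ z * (Q i).d1 0 z) ≤
      ∑ e, (rho z e * B.comp2 (sqJet ε F) (sqSumJet ε Q) e z +
        sig α β z e * B.comp1 (sqJet ε F) (sqSumJet ε Q) e z) := by
  have hpos : ∀ i : Fin d, 0 < 1 - z i.succ ^ 2 := fun i => by nlinarith [(hz i).1, (hz i).2]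
  have hslab : z ∈ slab d := mem_cube.2 fun i => Ioo_subset_Icc_self (hz i)
  obtain ⟨hX, hY⟩ := slab_pos hε F Q z hslab
  set X := sqJet ε F with hXdef
  set Y := sqSumJet ε Q with hYdef
  have hrho : ∀ e, 0 ≤ rho z e := fun e =>
    Fin.cases (by simp) (fun j => by rw [rho_succ]; exact (hpos j).le) e
  obtain ⟨τ, hτ, hhess⟩ := B.hess _ _ hX hY
  have n1 := B.nonneg1 _ _ hX hY
  have n2 := B.nonneg2 _ _ hX hY
  -- The Hessian condition in each direction, always with the same `τ`. The second constraint is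
  -- Cauchy-Schwarz for `∂_e Y = 2 ∑ G_i ∂_e G_i`; the `ε²` only helps.
  have hE : ∀ e, 3 / 2 * (τ * F.d1 e z ^ 2 + τ⁻¹ * ∑ i, gradG i (Q i) e z ^ 2) ≤
      B.H11 (X.val z) (Y.val z) * X.d1 e z ^ 2 +
      2 * B.H12 (X.val z) (Y.val z) * (X.d1 e z * Y.d1 e z) +
      B.H22 (X.val z) (Y.val z) * Y.d1 e z ^ 2 +
      2 * B.H1 (X.val z) (Y.val z) * F.d1 e z ^ 2 +
      2 * B.H2 (X.val z) (Y.val z) * ∑ i, gradG i (Q i) e z ^ 2 := by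
    intro e
    refine hhess _ _ _ _ ?_ ?_
    · have e1 : X.d1 e z = 2 * (F.val z * F.d1 e z) := by
        simp only [hXdef, sqJet, Jet.add, Jet.const, Jet.mul]; ring
      rw [e1, hXdef, sqJet_val]
      nlinarith [mul_nonneg (sq_nonneg ε) (sq_nonneg (F.d1 e z))]
    · rw [hYdef, sqSumJet_d1 ε Q e hz, sqSumJet_val, mul_pow]
      have cs := Finset.sum_mul_sq_le_sq_mul_sq Finset.univ
        (fun i => √(1 - z i.succ ^ 2) * (Q i).val z) fun i => gradG i (Q i) e z
      have e2 : ∀ i : Fin d, (√(1 - z i.succ ^ 2) * (Q i).val z) ^ 2 =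
          (1 - z i.succ ^ 2) * (Q i).val z ^ 2 := fun i => by
        rw [mul_pow, Real.sq_sqrt (hpos i).le]
      simp only [e2] at cs
      have e3 : 0 ≤ ∑ i, gradG i (Q i) e z ^ 2 := Finset.sum_nonneg fun i _ => sq_nonneg _
      nlinarith [mul_nonneg (sq_nonneg ε) e3]
  -- the drift terms
  have hsum : ∑ e, (rho z e * B.comp2 X Y e z + sig α β z e * B.comp1 X Y e z) =
      (∑ e, rho z e * (B.H11 (X.val z) (Y.val z) * X.d1 e z ^ 2 +
      2 * B.H12 (X.val z) (Y.val z) * (X.d1 e z * Y.d1 e z) +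
      B.H22 (X.val z) (Y.val z) * Y.d1 e z ^ 2 +
      2 * B.H1 (X.val z) (Y.val z) * F.d1 e z ^ 2 +
      2 * B.H2 (X.val z) (Y.val z) * ∑ i, gradG i (Q i) e z ^ 2)) +
      B.H1 (X.val z) (Y.val z) * (waveOp α β X z - 2 * ∑ e, rho z e * F.d1 e z ^ 2) +
      B.H2 (X.val z) (Y.val z) *
        (waveOp α β Y z - 2 * ∑ e, rho z e * ∑ i, gradG i (Q i) e z ^ 2) := by
    simp only [waveOp, Finset.mul_sum (a := (2 : ℝ)), ← Finset.sum_sub_distrib]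
    rw [Finset.mul_sum, Finset.mul_sum, ← Finset.sum_add_distrib, ← Finset.sum_add_distrib]
    refine Finset.sum_congr rfl fun e _ => ?_
    simp only [Bellman.comp1, Bellman.comp2]
    ring
  have hXw : waveOp α β X z - 2 * ∑ e, rho z e * F.d1 e z ^ 2 = 0 := by
    rw [hXdef, waveOp_sqJet, hF]; ring
  -- The bounds `α, β ≥ -1/2` make the zero-order remainder nonnegative; it enters the sum
  -- multiplied by `H2 ≥ 0`.
  have hYw : 0 ≤ waveOp α β Y z - 2 * ∑ e, rho z e * ∑ i, gradG i (Q i) e z ^ 2 := by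
    rw [hYdef, waveOp_sqSumJet]
    have e1 : ∑ e, rho z e * ∑ i, gradG i (Q i) e z ^ 2 =
        ∑ i, ∑ e, rho z e * gradG i (Q i) e z ^ 2 := by
      simp only [Finset.mul_sum]; rw [Finset.sum_comm]
    rw [e1, Finset.mul_sum, ← Finset.sum_sub_distrib]
    refine Finset.sum_nonneg fun i _ => ?_
    rw [waveOp_oneSubSq_mul α β i (Q i) (hz i) (hQ i), add_sub_cancel_left]
    have a1 : 0 ≤ α i + 1 / 2 := by linarith [hα i]
    have a2 : 0 ≤ β i + 1 / 2 := by linarith [hβ i]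
    have a3 : 0 ≤ 1 + z i.succ := by linarith [(hz i).1]
    have a4 : 0 ≤ 1 - z i.succ := by linarith [(hz i).2]
    positivity
  -- Only `τ⁻¹ |∂_t G|²` from the time direction and `τ (1 - x_j²) |∂_j F|²` from the space
  -- directions are kept. The arithmetic-geometric inequality then removes `τ`.
  have hmain : 3 * ∑ i : Fin d, (1 - z i.succ ^ 2) * -(F.d1 i.succ z * (Q i).d1 0 z) ≤
      ∑ e, rho z e * (3 / 2 * (τ * F.d1 e z ^ 2 + τ⁻¹ * ∑ i, gradG i (Q i) e z ^ 2)) := by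
    rw [Fin.sum_univ_succ]
    have g0 : ∀ i : Fin d, gradG i (Q i) 0 z ^ 2 = (1 - z i.succ ^ 2) * (Q i).d1 0 z ^ 2 := by
      intro i
      simp [gradG, (Fin.succ_ne_zero i).symm, mul_pow, Real.sq_sqrt (hpos i).le]
    have s0 : 3 / 2 * (τ⁻¹ * ∑ i : Fin d, (1 - z i.succ ^ 2) * (Q i).d1 0 z ^ 2) ≤
        rho z 0 * (3 / 2 * (τ * F.d1 0 z ^ 2 + τ⁻¹ * ∑ i, gradG i (Q i) 0 z ^ 2)) := by
      simp only [g0, rho_zero, one_mul]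
      have : 0 ≤ τ * F.d1 0 z ^ 2 := by positivity
      linarith
    have s1 : ∑ j : Fin d, 3 / 2 * (τ * ((1 - z j.succ ^ 2) * F.d1 j.succ z ^ 2)) ≤
        ∑ j : Fin d, rho z j.succ *
          (3 / 2 * (τ * F.d1 j.succ z ^ 2 + τ⁻¹ * ∑ i, gradG i (Q i) j.succ z ^ 2)) := by
      refine Finset.sum_le_sum fun j _ => ?_
      have e3 : 0 ≤ (1 - z j.succ ^ 2) * (τ⁻¹ * ∑ i, gradG i (Q i) j.succ z ^ 2) :=
        mul_nonneg (hpos j).le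
          (mul_nonneg (inv_pos.2 hτ).le (Finset.sum_nonneg fun i _ => sq_nonneg _))
      rw [rho_succ]
      linarith
    refine le_trans ?_ (add_le_add s0 s1)
    rw [Finset.mul_sum, Finset.mul_sum, Finset.mul_sum, ← Finset.sum_add_distrib]
    refine Finset.sum_le_sum fun i _ => ?_
    have key : -(2 * (F.d1 i.succ z * (Q i).d1 0 z)) ≤
        τ⁻¹ * (Q i).d1 0 z ^ 2 + τ * F.d1 i.succ z ^ 2 := by
      have : 0 ≤ τ⁻¹ * (τ * F.d1 i.succ z + (Q i).d1 0 z) ^ 2 := by positivity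
      have e4 : τ⁻¹ * (τ * F.d1 i.succ z + (Q i).d1 0 z) ^ 2 = τ * F.d1 i.succ z ^ 2 +
          2 * (F.d1 i.succ z * (Q i).d1 0 z) + τ⁻¹ * (Q i).d1 0 z ^ 2 := by
        field_simp; ring
      linarith
    have := mul_le_mul_of_nonneg_left key (hpos i).le
    linarith
  rw [hsum, hXw, mul_zero, add_zero]
  refine hmain.trans (le_add_of_le_of_nonneg ?_ (mul_nonneg n2 hYw))
  exact Finset.sum_le_sum fun e _ => mul_le_mul_of_nonneg_left (hE e) (hrho e)

/-! ### Tools for integrating in space and arguing by convexity in time. -/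

/-- Differentiation under the integral sign in the time variable. -/
theorem hasDerivAt_integral_cons (α β : Fin d → ℝ) {b b' : (Fin (d + 1) → ℝ) → ℝ}
    (hb : ContinuousOn b (slab d)) (hb' : ContinuousOn b' (slab d))
    (hd : ∀ z ∈ slab d, HasDerivAt (fun s => b (Function.update z 0 s)) (b' z) (z 0)) (t : ℝ) :
    HasDerivAt (fun t => ∫ x, b (Fin.cons t x) ∂(measure α β))
      (∫ x, b' (Fin.cons t x) ∂(measure α β)) t := by
  have hcons : ∀ t : ℝ, Continuous fun x : Fin d → ℝ => (Fin.cons t x : Fin (d + 1) → ℝ) :=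
    fun t => continuous_const.finCons continuous_id
  have hcomp : ∀ {f : (Fin (d + 1) → ℝ) → ℝ}, ContinuousOn f (slab d) → ∀ t,
      ContinuousOn (fun x : Fin d → ℝ => f (Fin.cons t x)) (cube d) := fun hf t =>
    hf.comp (hcons t).continuousOn fun x hx => cons_mem_slab hx
  have hc2 : Continuous fun y : ℝ × (Fin d → ℝ) => (Fin.cons y.1 y.2 : Fin (d + 1) → ℝ) :=
    continuous_pi fun i => Fin.cases continuous_fst
      (fun j => (continuous_apply j).comp continuous_snd) i
  have hc3 : ContinuousOn (fun y : ℝ × (Fin d → ℝ) => b' (Fin.cons y.1 y.2))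
      (Icc (t - 1) (t + 1) ×ˢ cube d) :=
    hb'.comp hc2.continuousOn fun y hy => cons_mem_slab hy.2
  obtain ⟨C, hC⟩ := (isCompact_Icc.prod isCompact_cube).exists_bound_of_continuousOn hc3
  refine (hasDerivAt_integral_of_dominated_loc_of_deriv_le (s := Icc (t - 1) (t + 1))
    (F' := fun t x => b' (Fin.cons t x)) (bound := fun _ => C)
    (Icc_mem_nhds (by linarith) (by linarith)) ?_ ?_ ?_ ?_ (integrable_const C) ?_).2
  · exact Eventually.of_forall fun s => aestronglyMeasurable_of_continuousOn α β (hcomp hb s)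
  · exact integrable_of_continuousOn α β (hcomp hb t)
  · exact aestronglyMeasurable_of_continuousOn α β (hcomp hb' t)
  · filter_upwards [ae_mem_cube α β] with x hx s hs
    exact hC (s, x) ⟨hs, hx⟩
  · filter_upwards [ae_mem_cube α β] with x hx s hs
    have := hd (Fin.cons s x) (cons_mem_slab hx)
    simpa only [Fin.update_cons_zero, Fin.cons_zero] using! this

/-- The Jacobi operator has mean zero. -/
theorem integral_space_eq_zero {α β : Fin d → ℝ} (hα : ∀ i, -(1 / 2 : ℝ) ≤ α i)
    (hβ : ∀ i, -(1 / 2 : ℝ) ≤ β i) {b b' : (Fin (d + 1) → ℝ) → ℝ}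
    (hb : ContinuousOn b (slab d)) (hb' : ContinuousOn b' (slab d)) (j : Fin d)
    (hd : ∀ z ∈ slab d, HasDerivAt (fun s => b (Function.update z j.succ s)) (b' z) (z j.succ))
    (t : ℝ) :
    ∫ x, ((1 - x j ^ 2) * b' (Fin.cons t x) + drift (α j) (β j) (x j) * b (Fin.cons t x))
      ∂(measure α β) = 0 := by
  have hcons : Continuous fun x : Fin d → ℝ => (Fin.cons t x : Fin (d + 1) → ℝ) :=
    continuous_const.finCons continuous_id
  have hcomp : ∀ {f : (Fin (d + 1) → ℝ) → ℝ}, ContinuousOn f (slab d) →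
      ContinuousOn (fun x : Fin d → ℝ => f (Fin.cons t x)) (cube d) := fun hf =>
    hf.comp hcons.continuousOn fun x hx => cons_mem_slab hx
  have hdr := continuous_drift (α j) (β j)
  refine integral_eq_zero_of_slices α β (integrable_of_continuousOn α β ?_) j fun x hx => ?_
  · refine ContinuousOn.add (ContinuousOn.mul (by fun_prop) (hcomp hb')) (ContinuousOn.mul ?_
      (hcomp hb))
    exact (hdr.comp (continuous_apply j)).continuousOn
  · have hmem : ∀ s ∈ Icc (-1 : ℝ) 1, Function.update x j s ∈ cube d := by
      intro s hs
      refine mem_cube.2 fun i => ?_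
      by_cases hi : i = j
      · subst hi; simpa using hs
      · rw [Function.update_of_ne hi]; exact hx i hi
    have hup : Continuous fun s : ℝ => Function.update x j s := continuous_const.update j continuous_id
    simp only [Function.update_self]
    refine integral_measure1_ibp (hα j) (hβ j)
      (h := fun s => b (Fin.cons t (Function.update x j s)))
      (h' := fun s => b' (Fin.cons t (Function.update x j s)))
      ((hcomp hb).comp hup.continuousOn hmem) ((hcomp hb').comp hup.continuousOn hmem) ?_
    intro s hs
    have := hd (Fin.cons t (Function.update x j s)) (cons_mem_slab (hmem s (Ioo_subset_Icc_self hs)))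
    simpa only [← Fin.cons_update, Function.update_idem, Fin.cons_succ, Function.update_self] using! this

/-- A function on `[0,∞)` that is convex and bounded above is maximal at `0`. -/
theorem ConvexOn.le_zero_of_bounded {f : ℝ → ℝ} (hf : ConvexOn ℝ (Ici 0) f) {C : ℝ}
    (hC : ∀ t, 0 ≤ t → f t ≤ C) {t : ℝ} (ht : 0 ≤ t) : f t ≤ f 0 := by
  -- Convexity on `[0, T]` combined with the bound at `T`; as `T → ∞` the weight of `C` disappears.
  have hev : ∀ᶠ T : ℝ in atTop, f t ≤ (1 - t / T) * f 0 + t / T * C := by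
    filter_upwards [eventually_gt_atTop t, eventually_gt_atTop 0] with T hT hT0
    have h1 : t / T ≤ 1 := (div_le_one hT0).2 hT.le
    have h0 : 0 ≤ t / T := by positivity
    have := hf.2 (mem_Ici.2 le_rfl) (mem_Ici.2 hT0.le) (sub_nonneg.2 h1) h0 (by ring)
    simp only [smul_eq_mul, mul_zero, zero_add] at this
    rw [div_mul_cancel₀ t hT0.ne'] at this
    exact this.trans (by gcongr; exact hC T hT0.le)
  have hlim : Tendsto (fun T : ℝ => (1 - t / T) * f 0 + t / T * C) atTop (𝓝 ((1 - 0) * f 0 + 0 * C)) := by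
    have h0 : Tendsto (fun T : ℝ => t / T) atTop (𝓝 0) := tendsto_const_nhds.div_atTop tendsto_id
    exact ((tendsto_const_nhds.sub h0).mul_const _).add (h0.mul_const _)
  have := ge_of_tendsto hlim hev
  linarith

end JacobiRiesz

/-! ### The bilinear embedding -/

namespace JacobiRiesz

open Set Filter Topology Polynomial

variable {d : ℕ} {p q K : ℝ}

/-- The Poisson extension of `∑ c_k φ_k`. -/
noncomputable def extF (α β : Fin d → ℝ) (s : Finset (Fin d → ℕ)) (c : (Fin d → ℕ) → ℝ) :
    Jet (Fin (d + 1)) :=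
  Jet.sum s fun k => Jet.smul (c k)
    (expTens (√(eigenvalue α β k)) fun j => jacobiN (α j) (β j) (k j))

/-- The Poisson extension of `∑ c_k ∂_i φ_k`. -/
noncomputable def extQ (α β : Fin d → ℝ) (i : Fin d) (s : Finset (Fin d → ℕ))
    (c : (Fin d → ℕ) → ℝ) : Jet (Fin (d + 1)) :=
  Jet.sum s fun k => Jet.smul (c k) (expTens (√(eigenvalue α β k)) (gradPoly α β i k))

theorem waveOp_sum {κ : Type*} (α β : Fin d → ℝ) (s : Finset κ) (c : κ → ℝ)
    (J : κ → Jet (Fin (d + 1))) (z : Fin (d + 1) → ℝ) :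
    waveOp α β (Jet.sum s fun k => Jet.smul (c k) (J k)) z = ∑ k ∈ s, c k * waveOp α β (J k) z := by
  simp only [waveOp, Jet.sum, Jet.smul, Finset.mul_sum]
  rw [Finset.sum_comm]
  refine Finset.sum_congr rfl fun e _ => ?_
  rw [← Finset.sum_add_distrib]
  exact Finset.sum_congr rfl fun k _ => by ring

section

variable {α β : Fin d → ℝ} (s : Finset (Fin d → ℕ)) (c : (Fin d → ℕ) → ℝ)

theorem extF_val (t : ℝ) (x : Fin d → ℝ) : (extF α β s c).val (Fin.cons t x) =
    ∑ k ∈ s, c k * (Real.exp (-(√(eigenvalue α β k) * t)) * phi α β k x) := by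
  simp only [extF, Jet.sum, Jet.smul, expTens_val, phi_eq_tens]

theorem extQ_val (i : Fin d) (t : ℝ) (x : Fin d → ℝ) : (extQ α β i s c).val (Fin.cons t x) =
    ∑ k ∈ s, c k * (Real.exp (-(√(eigenvalue α β k) * t)) * grad α β i k x) := by
  simp only [extQ, Jet.sum, Jet.smul, expTens_val, grad]

theorem extF_d1_succ (i : Fin d) (t : ℝ) (x : Fin d → ℝ) :
    (extF α β s c).d1 i.succ (Fin.cons t x) =
    ∑ k ∈ s, c k * (Real.exp (-(√(eigenvalue α β k) * t)) * grad α β i k x) := by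
  simp only [extF, Jet.sum, Jet.smul, expTens_d1_succ]

theorem extQ_d1_zero (i : Fin d) (t : ℝ) (x : Fin d → ℝ) :
    (extQ α β i s c).d1 0 (Fin.cons t x) =
    ∑ k ∈ s, c k * (-√(eigenvalue α β k) *
      (Real.exp (-(√(eigenvalue α β k) * t)) * grad α β i k x)) := by
  simp only [extQ, Jet.sum, Jet.smul, expTens_d1_zero, expTens_val, grad]

variable (hα : ∀ i, -(1 / 2 : ℝ) ≤ α i) (hβ : ∀ i, -(1 / 2 : ℝ) ≤ β i)
include hα hβ

theorem eigenvalue_nonneg (k : Fin d → ℕ) : 0 ≤ eigenvalue α β k :=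
  Finset.sum_nonneg fun i _ => eigenvalue1_nonneg (hα i) (hβ i) _

theorem waveOp_extF (z : Fin (d + 1) → ℝ) : waveOp α β (extF α β s c) z = 0 := by
  rw [extF, waveOp_sum]
  refine Finset.sum_eq_zero fun k _ => ?_
  rw [waveOp_expTens_phi α β k (Real.sq_sqrt (eigenvalue_nonneg hα hβ k)), mul_zero]

theorem waveOp_extQ (i : Fin d) (z : Fin (d + 1) → ℝ) : waveOp α β (extQ α β i s c) z =
    2 * z i.succ * (extQ α β i s c).d1 i.succ z +
      (α i + β i + 2) * (extQ α β i s c).val z := by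
  rw [extQ, waveOp_sum]
  simp only [waveOp_expTens_grad α β i _ (Real.sq_sqrt (eigenvalue_nonneg hα hβ _)), Jet.sum,
    Jet.smul, Finset.mul_sum, ← Finset.sum_add_distrib]
  exact Finset.sum_congr rfl fun k _ => by ring

/-- Pairing of two combinations of gradients. -/
theorem integral_sum_grad_mul_sum_grad (i : Fin d) (D : (Fin d → ℕ) → ℝ) :
    ∫ x, (1 - x i ^ 2) * ((∑ k ∈ s, c k * grad α β i k x) * ∑ k ∈ s, D k * grad α β i k x)
      ∂(measure α β) = ∑ k ∈ s, c k * D k * eigenvalue1 (α i) (β i) (k i) := by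
  have h : ∀ x : Fin d → ℝ, (1 - x i ^ 2) * ((∑ k ∈ s, c k * grad α β i k x) *
      ∑ k ∈ s, D k * grad α β i k x) = ∑ k ∈ s, ∑ l ∈ s, c k * D l *
        ((1 - x i ^ 2) * (grad α β i k x * grad α β i l x)) := by
    intro x
    rw [Finset.sum_mul_sum, Finset.mul_sum]
    refine Finset.sum_congr rfl fun k _ => ?_
    rw [Finset.mul_sum]
    exact Finset.sum_congr rfl fun l _ => by ring
  have hi : ∀ k l, Integrable (fun x : Fin d → ℝ => c k * D l *
        ((1 - x i ^ 2) * (grad α β i k x * grad α β i l x))) (measure α β) := fun k l =>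
    integrable_of_continuous α β (continuous_const.mul
      (Continuous.mul (by fun_prop) ((continuous_grad α β i k).mul (continuous_grad α β i l))))
  simp only [h]
  rw [integral_finsetSum _ fun k _ => integrable_finsetSum _ fun l _ => hi k l]
  refine Finset.sum_congr rfl fun k hk => ?_
  rw [integral_finsetSum _ fun l _ => hi k l]
  simp only [integral_const_mul, integral_grad_mul_grad hα hβ]
  simp [hk]

/-- The bilinear embedding for finite combinations of Jacobi polynomials. -/
theorem bilinear_embedding (B : Bellman p q K) (hK : 0 ≤ K) (hp : 0 < p) (hq : 0 < q)
    (h0 : (0 : Fin d → ℕ) ∉ s) (D : Fin d → (Fin d → ℕ) → ℝ) {ε : ℝ} (hε : 0 < ε) :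
    3 / 4 * ∑ i, ∑ k ∈ s, c k * D i k * eigenvalue1 (α i) (β i) (k i) / √(eigenvalue α β k) ≤
      ∫ x, B.H (ε ^ 2 + (∑ k ∈ s, c k * phi α β k x) ^ 2)
        (ε ^ 2 + ∑ i, (1 - x i ^ 2) * (∑ k ∈ s, D i k * grad α β i k x) ^ 2) ∂(measure α β) := by
  set F := extF α β s c with hF
  set Q : Fin d → Jet (Fin (d + 1)) := fun i => extQ α β i s (D i) with hQ
  set X := sqJet ε F with hX
  set Y := sqSumJet ε Q with hY
  have hpos := slab_pos hε F Q
  set ψ : ℝ → ℝ := fun t => ∫ x, B.H (X.val (Fin.cons t x)) (Y.val (Fin.cons t x)) ∂(measure α β)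
    with hψ
  set ψ1 : ℝ → ℝ := fun t => ∫ x, B.comp1 X Y 0 (Fin.cons t x) ∂(measure α β) with hψ1
  set ψ2 : ℝ → ℝ := fun t => ∫ x, B.comp2 X Y 0 (Fin.cons t x) ∂(measure α β) with hψ2
  have hd1 : ∀ t, HasDerivAt ψ (ψ1 t) t := hasDerivAt_integral_cons α β
    (B.continuousOn_comp hpos) (B.continuousOn_comp1 hpos 0)
    fun z hz => B.hasDerivAt_comp (hpos z hz).1 (hpos z hz).2 0
  have hd2 : ∀ t, HasDerivAt ψ1 (ψ2 t) t := hasDerivAt_integral_cons α β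
    (B.continuousOn_comp1 hpos 0) (B.continuousOn_comp2 hpos 0)
    fun z hz => B.hasDerivAt_comp1 (hpos z hz).1 (hpos z hz).2 0
  set m : (Fin d → ℕ) → ℝ := fun k => √(eigenvalue α β k) with hm
  have hm0 : ∀ k ∈ s, 0 < m k := fun k hk =>
    Real.sqrt_pos.2 (eigenvalue_pos hα hβ fun h => h0 (h ▸ hk))
  set A : (Fin d → ℕ) → ℝ := fun k => ∑ i, c k * D i k * eigenvalue1 (α i) (β i) (k i) with hA
  -- `θ''` is to be three times the pairing of `∂_i F` with `-∂_t Q_i`. Integrating `e^{-2mt}` twice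
  -- divides `3m` by `4m²`, whence the factor 3/4.
  set θ : ℝ → ℝ := fun t => ∑ k ∈ s, 3 / 4 * A k / m k * Real.exp (-2 * m k * t) with hθ
  set θ1 : ℝ → ℝ := fun t => ∑ k ∈ s, -(3 / 2) * A k * Real.exp (-2 * m k * t) with hθ1
  set θ2 : ℝ → ℝ := fun t => ∑ k ∈ s, 3 * A k * m k * Real.exp (-2 * m k * t) with hθ2
  have hexp : ∀ k t, HasDerivAt (fun t => Real.exp (-2 * m k * t))
      (-2 * m k * Real.exp (-2 * m k * t)) t := by
    intro k t
    refine (((hasDerivAt_id t).const_mul (-2 * m k)).exp).congr_deriv ?_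
    simp only [id]; ring
  have hθd1 : ∀ t, HasDerivAt θ (θ1 t) t := fun t =>
    HasDerivAt.fun_sum fun k hk => ((hexp k t).const_mul _).congr_deriv (by
      have := (hm0 k hk).ne'
      field_simp; ring)
  have hθd2 : ∀ t, HasDerivAt θ1 (θ2 t) t := fun t =>
    HasDerivAt.fun_sum fun k hk => ((hexp k t).const_mul _).congr_deriv (by ring)
  -- the differential inequality
  have hineq : ∀ t, θ2 t ≤ ψ2 t := by
    intro t
    have hcons : Continuous fun x : Fin d → ℝ => (Fin.cons t x : Fin (d + 1) → ℝ) :=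
      continuous_const.finCons continuous_id
    have hcomp : ∀ {f : (Fin (d + 1) → ℝ) → ℝ}, ContinuousOn f (slab d) →
        ContinuousOn (fun x : Fin d → ℝ => f (Fin.cons t x)) (cube d) := fun hf =>
      hf.comp hcons.continuousOn fun x hx => cons_mem_slab hx
    have hci : ∀ j : Fin d, Integrable (fun x : Fin d → ℝ =>
        (1 - x j ^ 2) * B.comp2 X Y j.succ (Fin.cons t x) +
          drift (α j) (β j) (x j) * B.comp1 X Y j.succ (Fin.cons t x)) (measure α β) := by
      intro j
      have hdr := (continuous_drift (α j) (β j)).comp (continuous_apply (A := fun _ : Fin d => ℝ) j)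
      exact integrable_of_continuousOn α β (ContinuousOn.add
        (ContinuousOn.mul (by fun_prop) (hcomp (B.continuousOn_comp2 hpos _)))
        (hdr.continuousOn.mul (hcomp (B.continuousOn_comp1 hpos _))))
    -- The spatial part has mean zero, so under the integral `∂_t²` may be replaced by `∂_t² - L`.
    have hspace : ∑ j : Fin d, ∫ x, ((1 - x j ^ 2) * B.comp2 X Y j.succ (Fin.cons t x) +
        drift (α j) (β j) (x j) * B.comp1 X Y j.succ (Fin.cons t x)) ∂(measure α β) = 0 :=
      Finset.sum_eq_zero fun j _ => integral_space_eq_zero hα hβ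
        (B.continuousOn_comp1 hpos _) (B.continuousOn_comp2 hpos _) j
        (fun z hz => B.hasDerivAt_comp1 (hpos z hz).1 (hpos z hz).2 _) t
    have hc0 : Integrable (fun x : Fin d → ℝ => B.comp2 X Y 0 (Fin.cons t x)) (measure α β) :=
      integrable_of_continuousOn α β (hcomp (B.continuousOn_comp2 hpos 0))
    have hlhs : ∀ i : Fin d, Integrable (fun x : Fin d → ℝ => (1 - x i ^ 2) *
        -(F.d1 i.succ (Fin.cons t x) * (Q i).d1 0 (Fin.cons t x))) (measure α β) := fun i =>
      integrable_of_continuous α β (Continuous.mul (by fun_prop)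
        ((((F.cont1 i.succ).comp hcons).mul (((Q i).cont1 0).comp hcons)).neg))
    have hpair : ∀ i : Fin d, ∫ x, (1 - x i ^ 2) *
        -(F.d1 i.succ (Fin.cons t x) * (Q i).d1 0 (Fin.cons t x)) ∂(measure α β) =
        ∑ k ∈ s, c k * D i k * eigenvalue1 (α i) (β i) (k i) * m k * Real.exp (-2 * m k * t) := by
      intro i
      have := integral_sum_grad_mul_sum_grad s (fun k => c k * Real.exp (-(m k * t))) hα hβ i
        (fun k => D i k * m k * Real.exp (-(m k * t)))
      refine Eq.trans ?_ (this.trans ?_)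
      · refine integral_congr_ae (Eventually.of_forall fun x => ?_)
        simp only [hF, hQ, extF_d1_succ, extQ_d1_zero]
        congr 1
        rw [← mul_neg, ← Finset.sum_neg_distrib]
        congr 1
        · exact Finset.sum_congr rfl fun k _ => by ring
        · exact Finset.sum_congr rfl fun k _ => by ring
      · refine Finset.sum_congr rfl fun k _ => ?_
        have : Real.exp (-2 * m k * t) = Real.exp (-(m k * t)) * Real.exp (-(m k * t)) := by
          rw [← Real.exp_add]; congr 1; ring
        rw [this]; ring
    have hθ2' : θ2 t = 3 * ∑ i, ∫ x, (1 - x i ^ 2) *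
        -(F.d1 i.succ (Fin.cons t x) * (Q i).d1 0 (Fin.cons t x)) ∂(measure α β) := by
      simp only [hpair, hθ2, hA]
      rw [Finset.sum_comm, Finset.mul_sum]
      refine Finset.sum_congr rfl fun k _ => ?_
      simp only [← Finset.sum_mul]
      ring
    have hψ2' : ψ2 t = ∫ x, (B.comp2 X Y 0 (Fin.cons t x) + ∑ j : Fin d,
        ((1 - x j ^ 2) * B.comp2 X Y j.succ (Fin.cons t x) +
        drift (α j) (β j) (x j) * B.comp1 X Y j.succ (Fin.cons t x))) ∂(measure α β) := by
      rw [integral_add hc0 (integrable_finsetSum _ fun j _ => hci j),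
        integral_finsetSum _ fun j _ => hci j, hspace, add_zero]
    rw [hθ2', hψ2', ← integral_finsetSum _ fun i _ => hlhs i, ← integral_const_mul]
    refine integral_mono_ae ((integrable_finsetSum _ fun i _ => hlhs i).const_mul 3)
      (hc0.add (integrable_finsetSum _ fun j _ => hci j)) ?_
    filter_upwards [ae_mem_Ioo α β] with x hx
    have := bellman_pointwise B hα hβ hε F Q (z := Fin.cons t x) (by simpa using hx)
      (waveOp_extF s c hα hβ _) (fun i => waveOp_extQ s (D i) hα hβ i _)
    rw [Fin.sum_univ_succ] at this
    simpa using this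
  -- boundedness
  have hbound : ∃ C, ∀ t, 0 ≤ t → ψ t - θ t ≤ C := by
    set MF : (Fin d → ℝ) → ℝ := fun x => ∑ k ∈ s, |c k * phi α β k x| with hMF
    set MQ : Fin d → (Fin d → ℝ) → ℝ := fun i x => ∑ k ∈ s, |D i k * grad α β i k x| with hMQ
    have cMF : Continuous MF := continuous_finsetSum _ fun k _ =>
      ((continuous_phi α β k).const_mul _).abs
    have cMQ : ∀ i, Continuous (MQ i) := fun i => continuous_finsetSum _ fun k _ =>
      ((continuous_grad α β i k).const_mul _).abs
    set U : (Fin d → ℝ) → ℝ := fun x => K * ((ε ^ 2 + MF x ^ 2) ^ (p / 2) / p +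
      (ε ^ 2 + ∑ i, MQ i x ^ 2) ^ (q / 2) / q) with hU
    have cU : Continuous U := by
      refine continuous_const.mul (Continuous.add ?_ ?_)
      · exact (Continuous.rpow_const (by fun_prop) fun x => Or.inr (by positivity)).div_const _
      · exact (Continuous.rpow_const (by fun_prop) fun x => Or.inr (by positivity)).div_const _
    have hterm : ∀ (g a : ℝ) (k : Fin d → ℕ) (t : ℝ), 0 ≤ t →
        |g * (Real.exp (-(√(eigenvalue α β k) * t)) * a)| ≤ |g * a| := by
      intro g a k t ht
      have h1 : Real.exp (-(√(eigenvalue α β k) * t)) ≤ 1 := by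
        rw [Real.exp_le_one_iff]
        have : 0 ≤ √(eigenvalue α β k) * t := by positivity
        linarith
      have h2 := Real.exp_pos (-(√(eigenvalue α β k) * t))
      rw [show g * (Real.exp (-(√(eigenvalue α β k) * t)) * a) =
        Real.exp (-(√(eigenvalue α β k) * t)) * (g * a) by ring, abs_mul, abs_of_pos h2]
      exact mul_le_of_le_one_left (abs_nonneg _) h1
    have hψle : ∀ t, 0 ≤ t → ψ t ≤ ∫ x, U x ∂(measure α β) := by
      intro t ht
      have hcons : Continuous fun x : Fin d → ℝ => (Fin.cons t x : Fin (d + 1) → ℝ) :=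
        continuous_const.finCons continuous_id
      refine integral_mono_ae (integrable_of_continuousOn α β
        ((B.continuousOn_comp hpos).comp hcons.continuousOn fun x hx => cons_mem_slab hx))
        (integrable_of_continuous α β cU) ?_
      filter_upwards [ae_mem_cube α β] with x hx
      have hp' := hpos _ (cons_mem_slab (t := t) hx)
      refine (B.le _ _ hp'.1.le hp'.2.le).trans ?_
      have e1 : X.val (Fin.cons t x) ≤ ε ^ 2 + MF x ^ 2 := by
        rw [hX, sqJet_val]
        refine add_le_add_right (sq_le_sq' ?_ ?_) _
        all_goals
          have : |F.val (Fin.cons t x)| ≤ MF x := by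
            rw [hF, extF_val]
            exact (Finset.abs_sum_le_sum_abs _ _).trans
              (Finset.sum_le_sum fun k _ => hterm _ _ _ _ ht)
          have := abs_le.1 this
          linarith
      have e2 : Y.val (Fin.cons t x) ≤ ε ^ 2 + ∑ i, MQ i x ^ 2 := by
        rw [hY, sqSumJet_val]
        refine add_le_add_right (Finset.sum_le_sum fun i _ => ?_) _
        have h1 : |(Q i).val (Fin.cons t x)| ≤ MQ i x := by
          simp only [hQ]
          rw [extQ_val]
          exact (Finset.abs_sum_le_sum_abs _ _).trans
            (Finset.sum_le_sum fun k _ => hterm _ _ _ _ ht)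
        have h2 : (Q i).val (Fin.cons t x) ^ 2 ≤ MQ i x ^ 2 := by
          rw [← sq_abs]
          exact pow_le_pow_left₀ (abs_nonneg _) h1 2
        rw [Fin.cons_succ]
        nlinarith [sq_nonneg (x i), sq_nonneg ((Q i).val (Fin.cons t x)),
          mul_nonneg (sq_nonneg (x i)) (sq_nonneg ((Q i).val (Fin.cons t x)))]
      simp only [hU]
      gcongr
      · exact hp'.1.le
      · exact hp'.2.le
    refine ⟨(∫ x, U x ∂(measure α β)) + ∑ k ∈ s, |3 / 4 * A k / m k|, fun t ht => ?_⟩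
    have hθle : -θ t ≤ ∑ k ∈ s, |3 / 4 * A k / m k| := by
      simp only [hθ]
      rw [← Finset.sum_neg_distrib]
      refine Finset.sum_le_sum fun k hk => ?_
      have h1 : Real.exp (-2 * m k * t) ≤ 1 := by
        rw [Real.exp_le_one_iff]
        have : 0 ≤ m k * t := mul_nonneg (hm0 k hk).le ht
        linarith
      refine (neg_le_abs _).trans ?_
      rw [abs_mul, abs_of_pos (Real.exp_pos _)]
      exact mul_le_of_le_one_right (abs_nonneg _) h1
    linarith [hψle t ht]
  obtain ⟨C, hC⟩ := hbound
  -- Being convex and bounded above, `ψ - θ` never exceeds its value at 0. With `ψ ≥ 0` and `θ → 0`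
  -- this forces `θ 0 ≤ ψ 0`.
  have hconv : ConvexOn ℝ (Ici 0) fun t => ψ t - θ t := by
    refine convexOn_of_hasDerivWithinAt2_nonneg (convex_Ici 0)
      (f' := fun t => ψ1 t - θ1 t) (f'' := fun t => ψ2 t - θ2 t) ?_ ?_ ?_ ?_
    · exact fun t _ => ((hd1 t).sub (hθd1 t)).continuousAt.continuousWithinAt
    · exact fun t _ => ((hd1 t).sub (hθd1 t)).hasDerivWithinAt
    · exact fun t _ => ((hd2 t).sub (hθd2 t)).hasDerivWithinAt
    · exact fun t _ => sub_nonneg.2 (hineq t)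
  have hψ0 : ∀ t, 0 ≤ ψ t := by
    intro t
    refine integral_nonneg_of_ae ?_
    filter_upwards [ae_mem_cube α β] with x hx
    have hp' := hpos _ (cons_mem_slab (t := t) hx)
    exact B.nonneg _ _ hp'.1.le hp'.2.le
  have hlim : Tendsto θ atTop (𝓝 0) := by
    have : Tendsto θ atTop (𝓝 (∑ k ∈ s, 3 / 4 * A k / m k * 0)) := by
      refine tendsto_finsetSum _ fun k hk => Tendsto.const_mul _ ?_
      refine Real.tendsto_exp_atBot.comp ?_
      exact tendsto_id.const_mul_atTop_of_neg (by linarith [hm0 k hk])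
    simpa using this
  have hle : θ 0 ≤ ψ 0 := by
    have h1 : ∀ᶠ t in atTop, -θ t ≤ ψ 0 - θ 0 := by
      filter_upwards [eventually_ge_atTop 0] with t ht
      have := ConvexOn.le_zero_of_bounded hconv hC ht
      linarith [hψ0 t]
    have := le_of_tendsto hlim.neg h1
    linarith
  have hθ0 : θ 0 = 3 / 4 * ∑ i, ∑ k ∈ s,
      c k * D i k * eigenvalue1 (α i) (β i) (k i) / √(eigenvalue α β k) := by
    simp only [hθ, hA, mul_zero, Real.exp_zero, mul_one]
    rw [Finset.sum_comm, Finset.mul_sum]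
    refine Finset.sum_congr rfl fun k _ => ?_
    rw [← Finset.sum_div]
    ring
  rw [← hθ0]
  refine hle.trans_eq ?_
  simp only [hψ, hX, hY, hF, hQ, sqJet_val, sqSumJet_val, extF_val, extQ_val, mul_zero, neg_zero,
    Real.exp_zero, one_mul, Fin.cons_succ]

end

end JacobiRiesz

/-! ### Riesz transforms of polynomials -/

namespace JacobiRiesz

open Set Filter Topology Polynomial

variable {d : ℕ} {p q K : ℝ}

/-- The combination `∑ c_k φ_k`. -/
noncomputable def polyFun (α β : Fin d → ℝ) (c : (Fin d → ℕ) →₀ ℝ) (x : Fin d → ℝ) : ℝ :=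
  c.sum fun k r => r * phi α β k x

/-- The combination `∑ c_k λ_k^{-1/2} ∂_i φ_k`. -/
noncomputable def rieszPoly (α β : Fin d → ℝ) (i : Fin d) (c : (Fin d → ℕ) →₀ ℝ)
    (x : Fin d → ℝ) : ℝ :=
  c.sum fun k r => r * ((√(eigenvalue α β k))⁻¹ * grad α β i k x)

theorem continuous_polyFun (α β : Fin d → ℝ) (c : (Fin d → ℕ) →₀ ℝ) :
    Continuous (polyFun α β c) :=
  continuous_finsetSum _ fun k _ => (continuous_phi α β k).const_mul _

theorem continuous_rieszPoly (α β : Fin d → ℝ) (i : Fin d) (c : (Fin d → ℕ) →₀ ℝ) :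
    Continuous (rieszPoly α β i c) :=
  continuous_finsetSum _ fun k _ => ((continuous_grad α β i k).const_mul _).const_mul _

theorem one_sub_sq_nonneg {x : Fin d → ℝ} (hx : x ∈ cube d) (i : Fin d) : 0 ≤ 1 - x i ^ 2 := by
  have := mem_cube.1 hx i
  nlinarith [this.1, this.2]

section

variable {α β : Fin d → ℝ} (hα : ∀ i, -(1 / 2 : ℝ) ≤ α i) (hβ : ∀ i, -(1 / 2 : ℝ) ≤ β i)
include hα hβ

/-- All supports are enlarged to one finite set avoiding 0. Orthogonality identifies the pairing
with the sum in `bilinear_embedding`, the factor `λ_k^{-1/2}` being part of the coefficients of the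
Riesz transform. -/
theorem bilinear_poly (B : Bellman p q K) (hK : 0 ≤ K) (hp : 0 < p) (hq : 0 < q)
    {c : (Fin d → ℕ) →₀ ℝ} (hc : c 0 = 0) {D : Fin d → (Fin d → ℕ) →₀ ℝ}
    (hD : ∀ i, D i 0 = 0) {ε : ℝ} (hε : 0 < ε) :
    3 / 4 * ∑ i, ∫ x, (1 - x i ^ 2) * (rieszPoly α β i c x *
      (D i).sum fun k r => r * grad α β i k x) ∂(measure α β) ≤
      ∫ x, B.H (ε ^ 2 + polyFun α β c x ^ 2)
        (ε ^ 2 + ∑ i, (1 - x i ^ 2) * ((D i).sum fun k r => r * grad α β i k x) ^ 2)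
          ∂(measure α β) := by
  set s : Finset (Fin d → ℕ) := c.support ∪ Finset.univ.biUnion fun i => (D i).support with hs
  have hs0 : (0 : Fin d → ℕ) ∉ s := by
    simp [hs, hc, hD]
  have hcs : c.support ⊆ s := Finset.subset_union_left
  have hDs : ∀ i, (D i).support ⊆ s := fun i =>
    (Finset.subset_biUnion_of_mem (fun i => (D i).support) (Finset.mem_univ i)).trans
      Finset.subset_union_right
  have h1 : ∀ x, polyFun α β c x = ∑ k ∈ s, c k * phi α β k x := fun x =>
    Finsupp.sum_of_support_subset _ hcs _ (by simp)
  have h2 : ∀ i x, rieszPoly α β i c x =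
      ∑ k ∈ s, c k * (√(eigenvalue α β k))⁻¹ * grad α β i k x := fun i x =>
    (Finsupp.sum_of_support_subset _ hcs _ (by simp)).trans
      (Finset.sum_congr rfl fun k _ => by ring)
  have h3 : ∀ i x, ((D i).sum fun k r => r * grad α β i k x) =
      ∑ k ∈ s, D i k * grad α β i k x := fun i x =>
    Finsupp.sum_of_support_subset _ (hDs i) _ (by simp)
  have := bilinear_embedding s c hα hβ B hK hp hq hs0 (fun i k => D i k) hε
  simp only [h1, h2, h3, integral_sum_grad_mul_sum_grad s _ hα hβ]
  refine le_trans (le_of_eq ?_) this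
  congr 1
  refine Finset.sum_congr rfl fun i _ => Finset.sum_congr rfl fun k _ => ?_
  ring

/-- The bilinear embedding, tested against continuous functions. -/
theorem bilinear_continuous (B : Bellman p q K) (hK : 0 ≤ K) (hp : 0 < p) (hq : 0 < q)
    {c : (Fin d → ℕ) →₀ ℝ} (hc : c 0 = 0) {κ : Fin d → (Fin d → ℝ) → ℝ}
    (hκ : ∀ i, Continuous (κ i)) :
    3 / 4 * ∑ i, ∫ x, (1 - x i ^ 2) * (rieszPoly α β i c x * κ i x) ∂(measure α β) ≤
      K * ((∫ x, (polyFun α β c x ^ 2) ^ (p / 2) ∂(measure α β)) / p +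
        (∫ x, (∑ i, (1 - x i ^ 2) * κ i x ^ 2) ^ (q / 2) ∂(measure α β)) / q) := by
  -- One sequence `1/(n + 1)` serves both as approximation error and as the regularization `ε`, so a
  -- single limit removes both.
  have happ : ∀ (n : ℕ) (i : Fin d), ∃ D : (Fin d → ℕ) →₀ ℝ, D 0 = 0 ∧
      ∀ x ∈ cube d, |(D.sum fun k r => r * grad α β i k x) - κ i x| < 1 / ((n : ℝ) + 1) :=
    fun n i => exists_grad_approx hα hβ i (hκ i) Nat.one_div_pos_of_nat
  choose D hD0 hD using happ
  set g : ℕ → Fin d → (Fin d → ℝ) → ℝ := fun n i x => (D n i).sum fun k r => r * grad α β i k x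
    with hg
  have hgc : ∀ n i, Continuous (g n i) := fun n i =>
    continuous_finsetSum _ fun k _ => (continuous_grad α β i k).const_mul _
  have hε0 : Tendsto (fun n : ℕ => 1 / ((n : ℝ) + 1)) atTop (𝓝 0) :=
    tendsto_one_div_add_atTop_nhds_zero_nat
  have hε1 : ∀ n : ℕ, 1 / ((n : ℝ) + 1) ≤ 1 := fun n => by
    rw [div_le_one (by positivity)]; linarith [(n.cast_nonneg : (0 : ℝ) ≤ n)]
  have hglim : ∀ x ∈ cube d, ∀ i, Tendsto (fun n => g n i x) atTop (𝓝 (κ i x)) := by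
    intro x hx i
    rw [tendsto_iff_norm_sub_tendsto_zero]
    exact squeeze_zero (fun n => norm_nonneg _) (fun n => (hD n i x hx).le) hε0
  have hgb : ∀ x ∈ cube d, ∀ n i, |g n i x| ≤ |κ i x| + 1 := by
    intro x hx n i
    have h1 := (hD n i x hx).le.trans (hε1 n)
    have h2 : |g n i x| ≤ |g n i x - κ i x| + |κ i x| := by
      simpa using abs_add_le (g n i x - κ i x) (κ i x)
    linarith
  have hineq := fun n => bilinear_poly hα hβ B hK hp hq hc (hD0 n)
    (Nat.one_div_pos_of_nat (α := ℝ) (n := n))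
  have hR := continuous_rieszPoly α β
  have hP := continuous_polyFun α β c
  have hlhs : Tendsto (fun n => 3 / 4 * ∑ i, ∫ x, (1 - x i ^ 2) *
      (rieszPoly α β i c x * g n i x) ∂(measure α β)) atTop
      (𝓝 (3 / 4 * ∑ i, ∫ x, (1 - x i ^ 2) * (rieszPoly α β i c x * κ i x) ∂(measure α β))) := by
    refine Tendsto.const_mul _ (tendsto_finsetSum _ fun i _ => ?_)
    refine tendsto_integral_of_dominated_convergence
      (fun x => |(1 - x i ^ 2) * rieszPoly α β i c x| * (|κ i x| + 1)) ?_ ?_ ?_ ?_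
    · intro n
      have := hR i c
      have := hgc n i
      exact Continuous.aestronglyMeasurable (by fun_prop)
    · have := hR i c
      have := hκ i
      exact integrable_of_continuous α β (by fun_prop)
    · intro n
      filter_upwards [ae_mem_cube α β] with x hx
      rw [← mul_assoc, norm_mul]
      exact mul_le_mul_of_nonneg_left (hgb x hx n i) (abs_nonneg _)
    · filter_upwards [ae_mem_cube α β] with x hx
      exact ((hglim x hx i).const_mul _).const_mul _
  have hY0 : ∀ x ∈ cube d, ∀ w : Fin d → ℝ, 0 ≤ ∑ i, (1 - x i ^ 2) * w i ^ 2 := fun x hx w =>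
    Finset.sum_nonneg fun i _ => mul_nonneg (one_sub_sq_nonneg hx i) (sq_nonneg _)
  have hrhs : Tendsto (fun n : ℕ => ∫ x, B.H ((1 / ((n : ℝ) + 1)) ^ 2 + polyFun α β c x ^ 2)
        ((1 / ((n : ℝ) + 1)) ^ 2 + ∑ i, (1 - x i ^ 2) * g n i x ^ 2) ∂(measure α β)) atTop
      (𝓝 (∫ x, B.H (polyFun α β c x ^ 2) (∑ i, (1 - x i ^ 2) * κ i x ^ 2) ∂(measure α β))) := by
    refine tendsto_integral_of_dominated_convergence
      (fun x => K * ((1 + polyFun α β c x ^ 2) ^ (p / 2) / p +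
        (1 + ∑ i, (|κ i x| + 1) ^ 2) ^ (q / 2) / q)) ?_ ?_ ?_ ?_
    · intro n
      refine aestronglyMeasurable_of_continuousOn α β ?_
      refine B.cont.comp (f := fun x => ((1 / ((n : ℝ) + 1)) ^ 2 + polyFun α β c x ^ 2,
        (1 / ((n : ℝ) + 1)) ^ 2 + ∑ i, (1 - x i ^ 2) * g n i x ^ 2)) ?_ ?_
      · have := hgc n
        exact Continuous.continuousOn (by fun_prop)
      · intro x hx
        have := hY0 x hx fun i => g n i x
        exact ⟨mem_Ici.2 (by positivity), mem_Ici.2 (by positivity)⟩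
    · refine integrable_of_continuous α β (continuous_const.mul (Continuous.add ?_ ?_))
      · exact (Continuous.rpow_const (by fun_prop) fun x => Or.inr (by positivity)).div_const _
      · exact (Continuous.rpow_const (by fun_prop) fun x => Or.inr (by positivity)).div_const _
    · intro n
      filter_upwards [ae_mem_cube α β] with x hx
      have e0 : (1 / ((n : ℝ) + 1)) ^ 2 ≤ 1 := pow_le_one₀ (by positivity) (hε1 n)
      have h0 := hY0 x hx fun i => g n i x
      have h1 : 0 ≤ (1 / ((n : ℝ) + 1)) ^ 2 + polyFun α β c x ^ 2 := by positivity
      have h2 : 0 ≤ (1 / ((n : ℝ) + 1)) ^ 2 + ∑ i, (1 - x i ^ 2) * g n i x ^ 2 := by positivity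
      rw [Real.norm_of_nonneg (B.nonneg _ _ h1 h2)]
      refine (B.le _ _ h1 h2).trans ?_
      have h3 : ∑ i, (1 - x i ^ 2) * g n i x ^ 2 ≤ ∑ i, (|κ i x| + 1) ^ 2 := by
        refine Finset.sum_le_sum fun i _ => ?_
        have h4 : g n i x ^ 2 ≤ (|κ i x| + 1) ^ 2 := by
          rw [← sq_abs]
          exact pow_le_pow_left₀ (abs_nonneg _) (hgb x hx n i) 2
        nlinarith [mul_nonneg (sq_nonneg (x i)) (sq_nonneg (g n i x))]
      gcongr
    · filter_upwards [ae_mem_cube α β] with x hx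
      have hmem : ((polyFun α β c x ^ 2), ∑ i, (1 - x i ^ 2) * κ i x ^ 2) ∈
          (Ici 0 ×ˢ Ici 0 : Set (ℝ × ℝ)) :=
        ⟨mem_Ici.2 (sq_nonneg _), mem_Ici.2 (hY0 x hx fun i => κ i x)⟩
      have hcw := B.cont _ hmem
      refine hcw.tendsto.comp (tendsto_nhdsWithin_iff.2 ⟨?_, Eventually.of_forall fun n => ?_⟩)
        (x := atTop) (f := fun n : ℕ => ((1 / ((n : ℝ) + 1)) ^ 2 + polyFun α β c x ^ 2,
        (1 / ((n : ℝ) + 1)) ^ 2 + ∑ i, (1 - x i ^ 2) * g n i x ^ 2))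
      · have e1 : Tendsto (fun n : ℕ => (1 / ((n : ℝ) + 1)) ^ 2) atTop (𝓝 0) := by
          simpa using hε0.pow 2
        refine Tendsto.prodMk_nhds ?_ ?_
        · simpa using e1.add_const (polyFun α β c x ^ 2)
        · have := e1.add (tendsto_finsetSum Finset.univ fun i _ =>
            ((hglim x hx i).pow 2).const_mul (1 - x i ^ 2))
          simpa using this
      · have := hY0 x hx fun i => g n i x
        exact ⟨mem_Ici.2 (by positivity), mem_Ici.2 (by positivity)⟩
  -- In the limit the arguments of `H` may vanish, which is why its continuity and upper bound are
  -- required on the closed quadrant.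
  refine (le_of_tendsto_of_tendsto' hlhs hrhs hineq).trans ?_
  have i1 : Integrable (fun x => (polyFun α β c x ^ 2) ^ (p / 2)) (measure α β) :=
    integrable_of_continuous α β
      (Continuous.rpow_const (by fun_prop) fun x => Or.inr (by positivity))
  have i2 : Integrable (fun x => (∑ i, (1 - x i ^ 2) * κ i x ^ 2) ^ (q / 2)) (measure α β) :=
    integrable_of_continuous α β
      (Continuous.rpow_const (by fun_prop) fun x => Or.inr (by positivity))
  rw [← integral_div, ← integral_div, ← integral_add (i1.div_const _) (i2.div_const _),
    ← integral_const_mul]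
  refine integral_mono_ae ?_ (((i1.div_const _).add (i2.div_const _)).const_mul K) ?_
  · refine integrable_of_continuousOn α β ?_
    refine B.cont.comp (f := fun x => (polyFun α β c x ^ 2,
      ∑ i, (1 - x i ^ 2) * κ i x ^ 2)) ?_ ?_
    · exact Continuous.continuousOn (by fun_prop)
    · intro x hx
      exact ⟨mem_Ici.2 (sq_nonneg _), mem_Ici.2 (hY0 x hx fun i => κ i x)⟩
  · filter_upwards [ae_mem_cube α β] with x hx
    exact B.le _ _ (sq_nonneg _) (hY0 x hx fun i => κ i x)

/-- The square of the length of the vector of Riesz transforms of a polynomial. -/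
noncomputable def rieszSq (α β : Fin d → ℝ) (c : (Fin d → ℕ) →₀ ℝ) (x : Fin d → ℝ) : ℝ :=
  ∑ i, (√(1 - x i ^ 2) * rieszPoly α β i c x) ^ 2

omit hα hβ in
theorem continuous_rieszSq (c : (Fin d → ℕ) →₀ ℝ) : Continuous (rieszSq α β c) := by
  have := fun i => continuous_rieszPoly α β i c
  unfold rieszSq
  fun_prop

omit hα hβ in
theorem rieszSq_nonneg (c : (Fin d → ℕ) →₀ ℝ) (x : Fin d → ℝ) : 0 ≤ rieszSq α β c x :=
  Finset.sum_nonneg fun _ _ => sq_nonneg _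

omit hα hβ in
theorem rieszSq_eq (c : (Fin d → ℕ) →₀ ℝ) {x : Fin d → ℝ} (hx : x ∈ cube d) :
    rieszSq α β c x = ∑ i, (1 - x i ^ 2) * rieszPoly α β i c x ^ 2 :=
  Finset.sum_congr rfl fun i _ => by
    rw [mul_pow, Real.sq_sqrt (one_sub_sq_nonneg hx i)]

omit hα hβ in
/-- Regularized powers converge. -/
theorem tendsto_integral_regularized (c : (Fin d → ℕ) →₀ ℝ) (hp : 0 < p) {r s : ℝ} (hs : 0 < s)
    (hrs : r + s = p / 2) :
    Tendsto (fun n : ℕ => ∫ x, (rieszSq α β c x + 1 / ((n : ℝ) + 1)) ^ r * rieszSq α β c x ^ s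
      ∂(measure α β)) atTop (𝓝 (∫ x, rieszSq α β c x ^ (p / 2) ∂(measure α β))) := by
  have hε0 : Tendsto (fun n : ℕ => 1 / ((n : ℝ) + 1)) atTop (𝓝 0) :=
    tendsto_one_div_add_atTop_nhds_zero_nat
  have hε1 : ∀ n : ℕ, 1 / ((n : ℝ) + 1) ≤ 1 := fun n => by
    rw [div_le_one (by positivity)]; linarith [(n.cast_nonneg : (0 : ℝ) ≤ n)]
  have hS := continuous_rieszSq (α := α) (β := β) c
  have hS0 := rieszSq_nonneg (α := α) (β := β) c
  refine tendsto_integral_of_dominated_convergence (fun x => (rieszSq α β c x + 1) ^ (p / 2))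
    ?_ ?_ ?_ ?_
  · intro n
    refine Continuous.aestronglyMeasurable (Continuous.mul ?_ ?_)
    · exact Continuous.rpow_const (by fun_prop) fun x => Or.inl
        (add_pos_of_nonneg_of_pos (hS0 x) (by positivity)).ne'
    · exact Continuous.rpow_const hS fun x => Or.inr hs.le
  · exact integrable_of_continuous α β
      (Continuous.rpow_const (by fun_prop) fun x => Or.inr (by positivity))
  · refine fun n => Eventually.of_forall fun x => ?_
    have h0 := hS0 x
    have h1 : 0 < rieszSq α β c x + 1 / ((n : ℝ) + 1) :=
      add_pos_of_nonneg_of_pos h0 (by positivity)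
    rw [Real.norm_of_nonneg (by positivity)]
    calc (rieszSq α β c x + 1 / ((n : ℝ) + 1)) ^ r * rieszSq α β c x ^ s
        ≤ (rieszSq α β c x + 1 / ((n : ℝ) + 1)) ^ r *
          (rieszSq α β c x + 1 / ((n : ℝ) + 1)) ^ s := by
          gcongr
          exact le_add_of_nonneg_right (by positivity)
      _ = (rieszSq α β c x + 1 / ((n : ℝ) + 1)) ^ (p / 2) := by rw [← Real.rpow_add h1, hrs]
      _ ≤ _ := by
          gcongr
          exact hε1 n
  · refine Eventually.of_forall fun x => ?_
    -- Where the Riesz vector vanishes the first factor may blow up if `r < 0`, but the second is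
    -- exactly zero because `s > 0`.
    rcases (hS0 x).eq_or_lt with h | h
    · simp only [← h, Real.zero_rpow hs.ne', mul_zero,
        Real.zero_rpow (show p / 2 ≠ 0 by positivity)]
      exact tendsto_const_nhds
    · have e1 : Tendsto (fun n : ℕ => rieszSq α β c x + 1 / ((n : ℝ) + 1)) atTop
          (𝓝 (rieszSq α β c x)) := by simpa using hε0.const_add (rieszSq α β c x)
      have := (e1.rpow_const (p := r) (Or.inl h.ne')).mul_const (rieszSq α β c x ^ s)
      rwa [← Real.rpow_add h, hrs] at this

/-- The dimension-free bound for the Riesz transforms of polynomials with mean zero. -/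
theorem integral_rieszSq_le (hpq : p.HolderConjugate q) {c : (Fin d → ℕ) →₀ ℝ} (hc : c 0 = 0) :
    ∫ x, rieszSq α β c x ^ (p / 2) ∂(measure α β) ≤
      (24 * (max p q - 1)) ^ p * ∫ x, (polyFun α β c x ^ 2) ^ (p / 2) ∂(measure α β) := by
  obtain ⟨B⟩ := exists_bellman hpq
  have hp1 := hpq.lt
  have hp0 := hpq.pos
  have hq0 := hpq.symm.pos
  have hmul : (p - 1) * q = p := hpq.sub_one_mul_conj
  set M := max p q - 1 with hM
  have hM0 : 0 < M := by
    have := le_max_left p q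
    linarith
  set C := 24 * M with hC
  have hC0 : 0 < C := by positivity
  set Φ := ∫ x, (polyFun α β c x ^ 2) ^ (p / 2) ∂(measure α β) with hΦ
  set N := ∫ x, rieszSq α β c x ^ (p / 2) ∂(measure α β) with hN
  -- This scale satisfies `C y^q = y` and `C^p y = C`, so that `y N ≤ C (Φ/p + y^q N/q)` collapses
  -- to `N ≤ C^p Φ`.
  set y := C ^ (-(p - 1)) with hy
  have hy0 : 0 < y := Real.rpow_pos_of_pos hC0 _
  have hS := continuous_rieszSq (α := α) (β := β) c
  have hS0 := rieszSq_nonneg (α := α) (β := β) c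
  -- The test field is `y |Rf|^{p-2} Rf`, with `1/(n + 1)` added to `|Rf|²` to keep it continuous
  -- when `p < 2`. Dividing the Bellman constant `18 M` by `3/4` gives `C = 24 M`.
  have hn : ∀ n : ℕ, y * ∫ x, (rieszSq α β c x + 1 / ((n : ℝ) + 1)) ^ ((p - 2) / 2) *
      rieszSq α β c x ^ (1 : ℝ) ∂(measure α β) ≤ C * (Φ / p + y ^ q *
      (∫ x, (rieszSq α β c x + 1 / ((n : ℝ) + 1)) ^ ((p - 2) * q / 2) *
      rieszSq α β c x ^ (q / 2) ∂(measure α β)) / q) := by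
    intro n
    have hpos : ∀ x, 0 < rieszSq α β c x + 1 / ((n : ℝ) + 1) := fun x =>
      add_pos_of_nonneg_of_pos (hS0 x) (by positivity)
    have hW : Continuous fun x => (rieszSq α β c x + 1 / ((n : ℝ) + 1)) ^ ((p - 2) / 2) :=
      Continuous.rpow_const (by fun_prop) fun x => Or.inl (hpos x).ne'
    have hRc := fun i => continuous_rieszPoly α β i c
    have hb := bilinear_continuous hα hβ B (by positivity) hp0 hq0 hc (κ := fun i x =>
      y * ((rieszSq α β c x + 1 / ((n : ℝ) + 1)) ^ ((p - 2) / 2) * rieszPoly α β i c x))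
      fun i => continuous_const.mul (hW.mul (hRc i))
    have e1 : ∑ i, ∫ x, (1 - x i ^ 2) * (rieszPoly α β i c x *
        (y * ((rieszSq α β c x + 1 / ((n : ℝ) + 1)) ^ ((p - 2) / 2) * rieszPoly α β i c x)))
        ∂(measure α β) = y * ∫ x, (rieszSq α β c x + 1 / ((n : ℝ) + 1)) ^ ((p - 2) / 2) *
        rieszSq α β c x ^ (1 : ℝ) ∂(measure α β) := by
      rw [← integral_finsetSum _ fun i _ => integrable_of_continuous α β (by fun_prop),
        ← integral_const_mul]
      refine integral_congr_ae ?_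
      filter_upwards [ae_mem_cube α β] with x hx
      rw [Real.rpow_one, rieszSq_eq c hx, Finset.mul_sum, Finset.mul_sum]
      exact Finset.sum_congr rfl fun i _ => by ring
    have e2 : ∫ x, (∑ i, (1 - x i ^ 2) * (y * ((rieszSq α β c x + 1 / ((n : ℝ) + 1)) ^
        ((p - 2) / 2) * rieszPoly α β i c x)) ^ 2) ^ (q / 2) ∂(measure α β) =
        y ^ q * ∫ x, (rieszSq α β c x + 1 / ((n : ℝ) + 1)) ^ ((p - 2) * q / 2) *
          rieszSq α β c x ^ (q / 2) ∂(measure α β) := by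
      rw [← integral_const_mul]
      refine integral_congr_ae ?_
      filter_upwards [ae_mem_cube α β] with x hx
      have h1 : ∑ i, (1 - x i ^ 2) * (y * ((rieszSq α β c x + 1 / ((n : ℝ) + 1)) ^
        ((p - 2) / 2) * rieszPoly α β i c x)) ^ 2 =
        (y * (rieszSq α β c x + 1 / ((n : ℝ) + 1)) ^ ((p - 2) / 2)) ^ (2 : ℝ) *
          rieszSq α β c x := by
        rw [rieszSq_eq c hx, Finset.mul_sum, Real.rpow_two]
        exact Finset.sum_congr rfl fun i _ => by ring
      have h2 := (Real.rpow_pos_of_pos (hpos x) ((p - 2) / 2)).le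
      rw [h1, Real.mul_rpow (by positivity) (hS0 x), ← Real.rpow_mul (by positivity),
        Real.mul_rpow hy0.le h2, ← Real.rpow_mul (hpos x).le, show 2 * (q / 2) = q by ring,
        show (p - 2) / 2 * q = (p - 2) * q / 2 by ring]
      ring
    rw [e1, e2] at hb
    rw [hC]
    linarith
  have hlim1 := tendsto_integral_regularized (α := α) (β := β) c hp0 (r := (p - 2) / 2) (s := 1)
    one_pos (by ring)
  have hlim2 := tendsto_integral_regularized (α := α) (β := β) c hp0 (r := (p - 2) * q / 2)
    (s := q / 2) (by positivity) (by linear_combination hmul / 2)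
  have hfin : y * N ≤ C * (Φ / p + y ^ q * N / q) :=
    le_of_tendsto_of_tendsto' (hlim1.const_mul y)
      ((((hlim2.const_mul (y ^ q)).div_const q).const_add _).const_mul C) hn
  have hyq : C * y ^ q = y := by
    rw [hy, ← Real.rpow_mul hC0.le]
    nth_rewrite 1 [← Real.rpow_one C]
    rw [← Real.rpow_add hC0]
    congr 1
    linear_combination -hmul
  have hCp : C ^ p * y = C := by
    rw [hy, ← Real.rpow_add hC0]
    simp
  have hinv : 1 / q = 1 - 1 / p := by
    have := hpq.inv_add_inv_eq_one
    simp only [one_div]; linarith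
  -- Since `1/q = 1 - 1/p`, the term `y N/q` is absorbed into the left side.
  have h1 : y * N * (1 / p) ≤ C * Φ * (1 / p) := by
    have e : C * (Φ / p + y ^ q * N / q) = C * Φ * (1 / p) + (C * y ^ q) * N * (1 / q) := by ring
    rw [e, hyq, hinv] at hfin
    linarith
  have h2 : y * N ≤ C * Φ := le_of_mul_le_mul_right h1 (by positivity)
  have h3 : y * N ≤ y * (C ^ p * Φ) := by
    calc y * N ≤ C * Φ := h2
      _ = (C ^ p * y) * Φ := by rw [hCp]
      _ = _ := by ring
  exact le_of_mul_le_mul_left h3 hy0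

end

end JacobiRiesz

/-! ### Polynomials in `L^p` and the Riesz transforms on `L²` -/

namespace JacobiRiesz

open Set Filter Topology

/-- Series along an orthonormal system with coefficients read off another one. -/
theorem summable_and_norm_tsum_le {E ι : Type*} [NormedAddCommGroup E] [InnerProductSpace ℝ E]
    [CompleteSpace E] {u v : ι → E} (hu : Orthonormal ℝ u)
    (hv : ∀ k l, k ≠ l → inner ℝ (v k) (v l) = 0) (hv1 : ∀ k, ‖v k‖ ≤ 1) (f : E) :
    (Summable fun k => inner ℝ (u k) f • v k) ∧ ‖∑' k, inner ℝ (u k) f • v k‖ ≤ ‖f‖ := by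
  -- Pythagoras for the orthogonal `v k` of norm at most one. Bessel's inequality for `u` then gives
  -- both the Cauchy criterion and the norm bound.
  have key : ∀ t : Finset ι, ‖∑ k ∈ t, inner ℝ (u k) f • v k‖ ^ 2 ≤
      ∑ k ∈ t, ‖inner ℝ (u k) f‖ ^ 2 := by
    intro t
    rw [← real_inner_self_eq_norm_sq, sum_inner]
    refine Finset.sum_le_sum fun k hk => ?_
    rw [inner_sum, Finset.sum_eq_single k]
    · rw [real_inner_self_eq_norm_sq, norm_smul, mul_pow]
      exact mul_le_of_le_one_right (sq_nonneg _) (pow_le_one₀ (norm_nonneg _) (hv1 k))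
    · intro l _ hl
      rw [inner_smul_left, inner_smul_right, hv k l hl.symm, mul_zero, mul_zero]
    · exact fun h => absurd hk h
  have hs : Summable fun k => inner ℝ (u k) f • v k := by
    rw [summable_iff_vanishing_norm]
    intro ε hε
    obtain ⟨s, hs⟩ := summable_iff_vanishing_norm.1 (hu.inner_products_summable f) (ε ^ 2)
      (by positivity)
    refine ⟨s, fun t ht => ?_⟩
    have h1 := (le_abs_self _).trans_lt (hs t ht)
    exact lt_of_pow_lt_pow_left₀ 2 hε.le ((key t).trans_lt h1)
  refine ⟨hs, le_of_tendsto hs.hasSum.norm (Eventually.of_forall fun t => ?_)⟩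
  have h1 : ‖∑ k ∈ t, inner ℝ (u k) f • v k‖ ^ 2 ≤ ‖f‖ ^ 2 :=
    (key t).trans (hu.sum_inner_products_le f)
  exact le_of_sq_le_sq h1 (norm_nonneg f)

/-- The mean of an `L^p` function is bounded by its norm. -/
theorem integral_norm_le_norm_Lp {Ω E : Type*} [MeasurableSpace Ω] [NormedAddCommGroup E]
    {μ : Measure Ω} [IsProbabilityMeasure μ] {p : ℝ≥0∞} (hp : 1 ≤ p) (f : Lp E p μ) :
    Integrable f μ ∧ ∫ x, ‖f x‖ ∂μ ≤ ‖f‖ := by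
  refine ⟨(Lp.memLp f).integrable hp, ?_⟩
  rw [integral_norm_eq_lintegral_enorm (Lp.aestronglyMeasurable f),
    ← eLpNorm_one_eq_lintegral_enorm, Lp.norm_def]
  exact ENNReal.toReal_mono (Lp.eLpNorm_ne_top f)
    (eLpNorm_le_eLpNorm_of_exponent_le hp (Lp.aestronglyMeasurable f))

variable {d : ℕ}

theorem memLp_of_continuous_of_exponent (α β : Fin d → ℝ) {E : Type*} [NormedAddCommGroup E]
    [SecondCountableTopology E] (p : ℝ≥0∞) {g : (Fin d → ℝ) → E} (hg : Continuous g) :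
    MemLp g p (measure α β) := by
  obtain ⟨C, hC⟩ := isCompact_cube.exists_bound_of_continuousOn hg.continuousOn
  refine MemLp.of_bound hg.aestronglyMeasurable C ?_
  filter_upwards [ae_mem_cube α β] with x hx using hC x hx

theorem polyFun_add (α β : Fin d → ℝ) (c c' : (Fin d → ℕ) →₀ ℝ) (x : Fin d → ℝ) :
    polyFun α β (c + c') x = polyFun α β c x + polyFun α β c' x :=
  Finsupp.sum_add_index' (by simp) (by intros; ring)

theorem polyFun_smul (α β : Fin d → ℝ) (r : ℝ) (c : (Fin d → ℕ) →₀ ℝ) (x : Fin d → ℝ) :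
    polyFun α β (r • c) x = r * polyFun α β c x := by
  rw [polyFun, Finsupp.sum_smul_index' (by simp), polyFun, Finsupp.mul_sum]
  simp [mul_assoc]

theorem rieszPoly_add (α β : Fin d → ℝ) (i : Fin d) (c c' : (Fin d → ℕ) →₀ ℝ) (x : Fin d → ℝ) :
    rieszPoly α β i (c + c') x = rieszPoly α β i c x + rieszPoly α β i c' x :=
  Finsupp.sum_add_index' (by simp) (by intros; ring)

theorem rieszPoly_smul (α β : Fin d → ℝ) (i : Fin d) (r : ℝ) (c : (Fin d → ℕ) →₀ ℝ)
    (x : Fin d → ℝ) : rieszPoly α β i (r • c) x = r * rieszPoly α β i c x := by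
  rw [rieszPoly, Finsupp.sum_smul_index' (by simp), rieszPoly, Finsupp.mul_sum]
  simp [mul_assoc]

/-- The vector of Riesz transforms of a polynomial. -/
noncomputable def vecPoly (α β : Fin d → ℝ) (c : (Fin d → ℕ) →₀ ℝ) (x : Fin d → ℝ) :
    EuclideanSpace ℝ (Fin d) :=
  WithLp.toLp 2 fun i => √(1 - x i ^ 2) * rieszPoly α β i c x

theorem continuous_vecPoly (α β : Fin d → ℝ) (c : (Fin d → ℕ) →₀ ℝ) :
    Continuous (vecPoly α β c) := by
  have := fun i => continuous_rieszPoly α β i c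
  refine (PiLp.continuous_toLp 2 _).comp (continuous_pi fun i => ?_)
  fun_prop

theorem norm_vecPoly (α β : Fin d → ℝ) (c : (Fin d → ℕ) →₀ ℝ) (x : Fin d → ℝ) (p : ℝ) :
    ‖vecPoly α β c x‖ ^ p = rieszSq α β c x ^ (p / 2) := by
  rw [EuclideanSpace.norm_eq, Real.sqrt_eq_rpow, ← Real.rpow_mul (by positivity)]
  congr 1
  · exact Finset.sum_congr rfl fun i _ => by rw [Real.norm_eq_abs, sq_abs]; rfl
  · ring

/-- Polynomials as elements of `L^p`. -/
noncomputable def polyLp (α β : Fin d → ℝ) (p : ℝ≥0∞) :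
    ((Fin d → ℕ) →₀ ℝ) →ₗ[ℝ] Lp ℝ p (measure α β) where
  toFun c := (memLp_of_continuous_of_exponent α β p (continuous_polyFun α β c)).toLp _
  map_add' c c' := by
    rw [← MemLp.toLp_add]
    exact MemLp.toLp_congr _ _ (Eventually.of_forall fun x => polyFun_add α β c c' x)
  map_smul' r c := by
    rw [RingHom.id_apply, ← MemLp.toLp_const_smul]
    exact MemLp.toLp_congr _ _ (Eventually.of_forall fun x => polyFun_smul α β r c x)

theorem coeFn_polyLp (α β : Fin d → ℝ) (p : ℝ≥0∞) (c : (Fin d → ℕ) →₀ ℝ) :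
    polyLp α β p c =ᵐ[measure α β] polyFun α β c :=
  MemLp.coeFn_toLp (memLp_of_continuous_of_exponent α β p (continuous_polyFun α β c))

/-- The Riesz transforms of polynomials as elements of `L^p`. -/
noncomputable def vecLp (α β : Fin d → ℝ) (p : ℝ≥0∞) :
    ((Fin d → ℕ) →₀ ℝ) →ₗ[ℝ] Lp (EuclideanSpace ℝ (Fin d)) p (measure α β) where
  toFun c := (memLp_of_continuous_of_exponent α β p (continuous_vecPoly α β c)).toLp _
  map_add' c c' := by
    rw [← MemLp.toLp_add]
    refine MemLp.toLp_congr _ _ (Eventually.of_forall fun x => ?_)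
    ext i
    simp [vecPoly, rieszPoly_add, mul_add]
  map_smul' r c := by
    rw [RingHom.id_apply, ← MemLp.toLp_const_smul]
    refine MemLp.toLp_congr _ _ (Eventually.of_forall fun x => ?_)
    ext i
    simp [vecPoly, rieszPoly_smul]
    ring

theorem coeFn_vecLp (α β : Fin d → ℝ) (p : ℝ≥0∞) (c : (Fin d → ℕ) →₀ ℝ) :
    vecLp α β p c =ᵐ[measure α β] vecPoly α β c :=
  MemLp.coeFn_toLp (memLp_of_continuous_of_exponent α β p (continuous_vecPoly α β c))

section

variable {α β : Fin d → ℝ} (hα : ∀ i, -(1 / 2 : ℝ) ≤ α i) (hβ : ∀ i, -(1 / 2 : ℝ) ≤ β i)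
include hα hβ

theorem norm_vecLp_le {p : ℝ≥0∞} (hp1 : 1 < p) (hp : p < ∞) {c : (Fin d → ℕ) →₀ ℝ}
    (hc : c 0 = 0) :
    ‖vecLp α β p c‖ ≤ 24 * (pStar p.toReal - 1) * ‖polyLp α β p c‖ := by
  have hP : 1 < p.toReal := by
    rw [← ENNReal.toReal_one]
    exact (ENNReal.toReal_lt_toReal ENNReal.one_ne_top hp.ne).2 hp1
  have hp0 : p ≠ 0 := (zero_lt_one.trans hp1).ne'
  set P := p.toReal with hPdef
  have hpq : P.HolderConjugate (P / (P - 1)) := Real.HolderConjugate.conjExponent hP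
  have h := integral_rieszSq_le hα hβ hpq hc
  have hC : 0 ≤ 24 * (pStar P - 1) := by
    have := le_max_left P (P / (P - 1))
    simp only [pStar]
    linarith
  have hP0 : P ≠ 0 := by linarith
  rw [Lp.norm_def, Lp.norm_def, eLpNorm_congr_ae (coeFn_vecLp α β p c),
    eLpNorm_congr_ae (coeFn_polyLp α β p c),
    MemLp.eLpNorm_eq_integral_rpow_norm hp0 hp.ne
      (memLp_of_continuous_of_exponent α β p (continuous_vecPoly α β c)),
    MemLp.eLpNorm_eq_integral_rpow_norm hp0 hp.ne
      (memLp_of_continuous_of_exponent α β p (continuous_polyFun α β c))]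
  have h1 : ∀ x, ‖polyFun α β c x‖ ^ P = (polyFun α β c x ^ 2) ^ (P / 2) := by
    intro x
    rw [← sq_abs, ← Real.rpow_natCast, ← Real.rpow_mul (abs_nonneg _), Real.norm_eq_abs]
    congr 1
    push_cast; ring
  simp only [← hPdef, norm_vecPoly, h1]
  have n1 : 0 ≤ ∫ x, rieszSq α β c x ^ (P / 2) ∂(measure α β) :=
    integral_nonneg fun x => Real.rpow_nonneg (rieszSq_nonneg c x) _
  have n2 : 0 ≤ ∫ x, (polyFun α β c x ^ 2) ^ (P / 2) ∂(measure α β) :=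
    integral_nonneg fun x => Real.rpow_nonneg (sq_nonneg _) _
  rw [ENNReal.toReal_ofReal (Real.rpow_nonneg n1 _), ENNReal.toReal_ofReal (Real.rpow_nonneg n2 _)]
  calc (∫ x, rieszSq α β c x ^ (P / 2) ∂(measure α β)) ^ P⁻¹
      ≤ ((24 * (pStar P - 1)) ^ P * ∫ x, (polyFun α β c x ^ 2) ^ (P / 2) ∂(measure α β)) ^ P⁻¹ :=
        Real.rpow_le_rpow n1 h (by positivity)
    _ = _ := by
        rw [Real.mul_rpow (Real.rpow_nonneg hC _) n2, Real.rpow_rpow_inv hC hP0]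

/-- Bounded continuous functions are dense in `L^r` for finite `r`, and polynomials approximate them
uniformly on the cube. For a probability measure uniform smallness bounds the `L^r` norm. -/
theorem exists_polyFun_eLpNorm_sub_le {r : ℝ≥0∞} (hr1 : 1 ≤ r) (hr : r ≠ ∞)
    {f : (Fin d → ℝ) → ℝ} (hf : MemLp f r (measure α β)) {ε : ℝ} (hε : 0 < ε) :
    ∃ c, eLpNorm (f - polyFun α β c) r (measure α β) ≤ ENNReal.ofReal ε := by
  have := isProbabilityMeasure_measure hα hβ
  obtain ⟨g, hg, hgm⟩ := hf.exists_boundedContinuous_eLpNorm_sub_le hr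
    (ε := ENNReal.ofReal (ε / 2)) (by simpa using hε)
  obtain ⟨c, hc⟩ := exists_phi_approx hα hβ g.continuous (half_pos hε)
  refine ⟨c, ?_⟩
  have h1 : eLpNorm (⇑g - polyFun α β c) r (measure α β) ≤ ENNReal.ofReal (ε / 2) := by
    refine (eLpNorm_le_of_ae_bound (C := ε / 2) ?_).trans (by simp)
    filter_upwards [ae_mem_cube α β] with x hx
    rw [Pi.sub_apply, norm_sub_rev]
    exact (hc x hx).le
  have h2 : f - polyFun α β c = (f - ⇑g) + (⇑g - polyFun α β c) := by abel
  have hP := (memLp_of_continuous_of_exponent α β r (continuous_polyFun α β c))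
  rw [h2]
  refine (eLpNorm_add_le (hf.sub hgm).1 (hgm.sub hP).1 hr1).trans ((add_le_add hg h1).trans ?_)
  rw [← ENNReal.ofReal_add (by positivity) (by positivity), add_halves]

-- On a probability space approximation in `L^r` controls all smaller exponents, so one polynomial
-- can serve in `L²` and `L^p` at once.
omit hα hβ in
theorem norm_sub_polyLp_le {r s : ℝ≥0∞} [IsProbabilityMeasure (measure α β)] (hsr : s ≤ r)
    (f : Lp ℝ s (measure α β)) {f' : (Fin d → ℝ) → ℝ} (hf : f =ᵐ[measure α β] f')
    (hf' : AEStronglyMeasurable f' (measure α β))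
    {c : (Fin d → ℕ) →₀ ℝ} {ε : ℝ} (hε : 0 < ε)
    (hc : eLpNorm (f' - polyFun α β c) r (measure α β) ≤ ENNReal.ofReal ε) :
    ‖f - polyLp α β s c‖ ≤ ε := by
  rw [Lp.norm_def]
  have h1 : ⇑(f - polyLp α β s c) =ᵐ[measure α β] f' - polyFun α β c := by
    filter_upwards [Lp.coeFn_sub f (polyLp α β s c), hf, coeFn_polyLp α β s c] with x h1 h2 h3
    rw [h1, Pi.sub_apply, Pi.sub_apply, h2, h3]
  rw [eLpNorm_congr_ae h1]
  refine ENNReal.toReal_le_of_le_ofReal hε.le (le_trans ?_ hc)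
  exact eLpNorm_le_eLpNorm_of_exponent_le hsr
    (hf'.sub (continuous_polyFun α β c).aestronglyMeasurable)

theorem denseRange_polyLp {p : ℝ≥0∞} [Fact (1 ≤ p)] (hp : p ≠ ∞) :
    DenseRange (polyLp α β p) := by
  have := isProbabilityMeasure_measure hα hβ
  rw [Metric.denseRange_iff]
  intro f ε hε
  obtain ⟨c, hc⟩ := exists_polyFun_eLpNorm_sub_le hα hβ Fact.out hp (Lp.memLp f) (half_pos hε)
  refine ⟨c, ?_⟩
  rw [dist_eq_norm]
  exact (norm_sub_polyLp_le le_rfl f ae_eq_rfl (Lp.aestronglyMeasurable f) (half_pos hε)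
    hc).trans_lt (half_lt_self hε)

/-! ### The Riesz transforms on `L²` -/

omit hα hβ in
theorem inner_toLp_continuous {f g : (Fin d → ℝ) → ℝ} (hf : MemLp f 2 (measure α β))
    (hg : MemLp g 2 (measure α β)) :
    inner ℝ (hf.toLp f) (hg.toLp g) = ∫ x, f x * g x ∂(measure α β) := by
  rw [L2.inner_def]
  refine integral_congr_ae ?_
  filter_upwards [hf.coeFn_toLp, hg.coeFn_toLp] with x h1 h2
  rw [h1, h2]
  simp [mul_comm]

omit hα hβ in
/-- `φ_k` as an element of `L²`. -/
noncomputable def phiL2 (α β : Fin d → ℝ) (k : Fin d → ℕ) : Lp ℝ 2 (measure α β) :=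
  (memLp_of_continuous α β (continuous_phi α β k)).toLp _

omit hα hβ in
/-- `δ_i φ_k` as an element of `L²`. -/
noncomputable def deltaL2 (α β : Fin d → ℝ) (i : Fin d) (k : Fin d → ℕ) :
    Lp ℝ 2 (measure α β) :=
  (memLp_delta_phi α β i k).toLp _

theorem orthonormal_phiL2 : Orthonormal ℝ (phiL2 α β) := by
  rw [orthonormal_iff_ite]
  intro k l
  rw [phiL2, phiL2, inner_toLp_continuous, integral_phi_mul_phi hα hβ]

theorem inner_deltaL2 (i : Fin d) (k l : Fin d → ℕ) :
    inner ℝ (deltaL2 α β i k) (deltaL2 α β i l) =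
      if k = l then eigenvalue1 (α i) (β i) (k i) else 0 := by
  rw [deltaL2, deltaL2, inner_toLp_continuous, ← integral_grad_mul_grad hα hβ]
  refine integral_congr_ae ?_
  filter_upwards [ae_mem_cube α β] with x hx
  rw [delta_phi_eq, delta_phi_eq]
  have := Real.mul_self_sqrt (one_sub_sq_nonneg hx i)
  linear_combination grad α β i k x * grad α β i l x * this

omit hα hβ in
theorem rieszTerm_eq (i : Fin d) (f : Lp ℝ 2 (measure α β)) (k : {k : Fin d → ℕ // k ≠ 0}) :
    rieszTerm α β i f k =
      inner ℝ (phiL2 α β k.1) f • ((√(eigenvalue α β k.1))⁻¹ • deltaL2 α β i k.1) := by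
  have : ∫ x, f x * phi α β k.1 x ∂(measure α β) = inner ℝ (phiL2 α β k.1) f := by
    rw [L2.inner_def]
    refine integral_congr_ae ?_
    filter_upwards [(memLp_of_continuous α β (continuous_phi α β k.1)).coeFn_toLp] with x hx
    simp [phiL2, hx]
  rw [rieszTerm, this, smul_smul, mul_comm]
  rfl

/-- The vectors `λ_k^{-1/2} δ_i φ_k` are orthogonal with norms at most one, because `‖δ_i φ_k‖²` is
one of the nonnegative summands of `λ_k`. -/
theorem riesz_summable_and_norm_le (i : Fin d) (f : Lp ℝ 2 (measure α β)) :
    Summable (rieszTerm α β i f) ∧ ‖riesz α β i f‖ ≤ ‖f‖ := by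
  have hon : Orthonormal ℝ fun k : {k : Fin d → ℕ // k ≠ 0} => phiL2 α β k.1 :=
    (orthonormal_phiL2 hα hβ).comp _ Subtype.val_injective
  have := summable_and_norm_tsum_le hon
    (v := fun k => (√(eigenvalue α β k.1))⁻¹ • deltaL2 α β i k.1) ?_ ?_ f
  · simp only [← rieszTerm_eq] at this
    exact this
  · intro k l hkl
    rw [inner_smul_left, inner_smul_right, inner_deltaL2 hα hβ,
      if_neg fun h => hkl (Subtype.ext h), mul_zero, mul_zero]
  · intro k
    have hpos := eigenvalue_pos hα hβ k.2
    have h1 : ‖(√(eigenvalue α β k.1))⁻¹ • deltaL2 α β i k.1‖ ^ 2 ≤ 1 := by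
      rw [norm_smul, mul_pow, ← real_inner_self_eq_norm_sq (deltaL2 α β i k.1), inner_deltaL2 hα hβ, if_pos rfl,
        norm_inv, inv_pow, Real.norm_of_nonneg (Real.sqrt_nonneg _), Real.sq_sqrt hpos.le,
        inv_mul_le_iff₀ hpos, mul_one]
      exact eigenvalue1_le_eigenvalue hα hβ i k.1
    exact (sq_le_one_iff₀ (norm_nonneg _)).1 h1

theorem riesz_sub (i : Fin d) (f g : Lp ℝ 2 (measure α β)) :
    riesz α β i (f - g) = riesz α β i f - riesz α β i g := by
  rw [riesz, riesz, riesz, ← (riesz_summable_and_norm_le hα hβ i f).1.tsum_sub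
    (riesz_summable_and_norm_le hα hβ i g).1]
  congr 1
  funext k
  rw [rieszTerm_eq, rieszTerm_eq, rieszTerm_eq, inner_sub_right, sub_smul]

omit hα hβ in
theorem polyLp_two_eq_sum (c : (Fin d → ℕ) →₀ ℝ) :
    polyLp α β 2 c = ∑ k ∈ c.support, c k • phiL2 α β k := by
  have h1 : c = ∑ k ∈ c.support, c k • Finsupp.single k 1 := by
    conv_lhs => rw [← Finsupp.sum_single c]
    exact Finset.sum_congr rfl fun k _ => by simp
  have h2 : ∀ k, polyLp α β 2 (Finsupp.single k 1) = phiL2 α β k := by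
    intro k
    refine MemLp.toLp_congr (memLp_of_continuous_of_exponent α β 2 (continuous_polyFun α β _)) _
      (Eventually.of_forall fun x => ?_)
    simp [polyFun]
  conv_lhs => rw [h1, map_sum]
  exact Finset.sum_congr rfl fun k _ => by rw [map_smul, h2]

omit hα hβ in
theorem deltaL2_zero (hα : ∀ i, -(1 / 2 : ℝ) ≤ α i) (hβ : ∀ i, -(1 / 2 : ℝ) ≤ β i) (i : Fin d) :
    deltaL2 α β i 0 = 0 := by
  rw [← inner_self_eq_zero (𝕜 := ℝ), inner_deltaL2 hα hβ]
  simp [eigenvalue1]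

theorem riesz_polyLp (i : Fin d) (c : (Fin d → ℕ) →₀ ℝ) :
    riesz α β i (polyLp α β 2 c) =ᵐ[measure α β]
      fun x => √(1 - x i ^ 2) * rieszPoly α β i c x := by
  set F : (Fin d → ℕ) → Lp ℝ 2 (measure α β) := fun k =>
    c k • ((√(eigenvalue α β k))⁻¹ • deltaL2 α β i k) with hF
  have h1 : ∀ k, inner ℝ (phiL2 α β k) (polyLp α β 2 c) = c k := by
    intro k
    rw [polyLp_two_eq_sum]
    exact (orthonormal_phiL2 hα hβ).inner_right_finsupp c k
  have h2 : riesz α β i (polyLp α β 2 c) = ∑ k ∈ c.support, F k := by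
    rw [riesz]
    simp only [rieszTerm_eq, h1]
    -- The index 0 may be restored because `δ_i φ_0 = 0`; the series is then a finite sum over the
    -- support of `c`.
    change ∑' k : {k : Fin d → ℕ | k ≠ 0}, F k = _
    rw [tsum_subtype_eq_of_support_subset (f := F), tsum_eq_sum]
    · intro k hk
      simp [hF, Finsupp.notMem_support_iff.1 hk]
    · intro k hk h0
      exact hk (by simp [hF, h0, deltaL2_zero hα hβ])
  have h3 : ∀ s : Finset (Fin d → ℕ), ⇑(∑ k ∈ s, F k) =ᵐ[measure α β] fun x =>
      ∑ k ∈ s, √(1 - x i ^ 2) * (c k * ((√(eigenvalue α β k))⁻¹ * grad α β i k x)) := by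
    intro s
    induction s using Finset.induction_on with
    | empty =>
      simp only [Finset.sum_empty]
      exact Lp.coeFn_zero _ _ _
    | insert k s hk ih =>
      simp only [Finset.sum_insert hk]
      filter_upwards [ih, Lp.coeFn_add (F k) (∑ l ∈ s, F l),
        Lp.coeFn_smul (c k) ((√(eigenvalue α β k))⁻¹ • deltaL2 α β i k),
        Lp.coeFn_smul (√(eigenvalue α β k))⁻¹ (deltaL2 α β i k),
        (memLp_delta_phi α β i k).coeFn_toLp] with x e1 e2 e3 e4 e5
      rw [e2, Pi.add_apply, e1, e3, Pi.smul_apply, e4, Pi.smul_apply, deltaL2, e5, delta_phi_eq,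
        smul_eq_mul, smul_eq_mul]
      ring
  rw [h2]
  filter_upwards [h3 c.support] with x hx
  rw [hx, rieszPoly, Finsupp.sum, Finset.mul_sum]

theorem rieszVec_polyLp (c : (Fin d → ℕ) →₀ ℝ) :
    rieszVec α β (polyLp α β 2 c) =ᵐ[measure α β] vecPoly α β c := by
  filter_upwards [ae_all_iff.2 fun i => riesz_polyLp hα hβ i c] with x hx
  simp only [rieszVec, vecPoly, hx]

end

end JacobiRiesz

/-! ### Extension to `L^p` -/

namespace JacobiRiesz

open Set Filter Topology

/-- The mean is a contraction for the `L^p` norm. -/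
theorem abs_integral_sub_le {Ω : Type*} [MeasurableSpace Ω] {μ : Measure Ω}
    [IsProbabilityMeasure μ] {p : ℝ≥0∞} [hp : Fact (1 ≤ p)] (f g : Lp ℝ p μ) :
    |∫ x, f x ∂μ - ∫ x, g x ∂μ| ≤ ‖f - g‖ := by
  rw [← integral_sub (integral_norm_le_norm_Lp hp.out f).1 (integral_norm_le_norm_Lp hp.out g).1]
  refine (norm_integral_le_integral_norm fun x => f x - g x).trans
    (le_trans (le_of_eq ?_) (integral_norm_le_norm_Lp hp.out (f - g)).2)
  refine integral_congr_ae ?_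
  filter_upwards [Lp.coeFn_sub f g] with x hx
  rw [hx, Pi.sub_apply]

theorem continuous_integral_Lp {Ω : Type*} [MeasurableSpace Ω] {μ : Measure Ω}
    [IsProbabilityMeasure μ] {p : ℝ≥0∞} [Fact (1 ≤ p)] :
    Continuous fun f : Lp ℝ p μ => ∫ x, f x ∂μ :=
  (LipschitzWith.mk_one fun f g => by
    rw [dist_eq_norm, dist_eq_norm]; exact abs_integral_sub_le f g).continuous

variable {d : ℕ} {α β : Fin d → ℝ}

/-- At `k = 0` the eigenvalue vanishes and the inverse of zero is zero, in agreement with the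
omission of this index from the Riesz series. -/
theorem vecLp_single_zero (p : ℝ≥0∞) (r : ℝ) : vecLp α β p (Finsupp.single 0 r) = 0 := by
  refine Lp.ext ?_
  filter_upwards [coeFn_vecLp α β p (Finsupp.single 0 r),
    Lp.coeFn_zero (EuclideanSpace ℝ (Fin d)) p (measure α β)] with x h1 h2
  rw [h1, h2]
  ext i
  simp [vecPoly, rieszPoly, eigenvalue]

theorem phi_zero (hα : ∀ i, -(1 / 2 : ℝ) ≤ α i) (hβ : ∀ i, -(1 / 2 : ℝ) ≤ β i) (x : Fin d → ℝ) :
    phi α β 0 x = 1 := by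
  simp [phi, jacobiN_zero (hα _) (hβ _)]

theorem integral_polyLp (hα : ∀ i, -(1 / 2 : ℝ) ≤ α i) (hβ : ∀ i, -(1 / 2 : ℝ) ≤ β i)
    (p : ℝ≥0∞) (c : (Fin d → ℕ) →₀ ℝ) : ∫ x, polyLp α β p c x ∂(measure α β) = c 0 := by
  rw [integral_congr_ae (coeFn_polyLp α β p c)]
  simp only [polyFun, Finsupp.sum]
  rw [integral_finsetSum _ fun k _ =>
    (memLp_of_continuous α β ((continuous_phi α β k).const_mul _)).integrable one_le_two]
  have h : ∀ k, ∫ x, c k * phi α β k x ∂(measure α β) = if k = 0 then c k else 0 := by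
    intro k
    have := integral_phi_mul_phi hα hβ k 0
    simp only [phi_zero hα hβ, mul_one] at this
    rw [integral_const_mul, this, mul_ite, mul_one, mul_zero]
  simp only [h]
  rw [Finset.sum_ite_eq']
  split_ifs with h0
  · rfl
  · exact (Finsupp.notMem_support_iff.1 h0).symm

theorem norm_polyLp_single_zero_le (hα : ∀ i, -(1 / 2 : ℝ) ≤ α i)
    (hβ : ∀ i, -(1 / 2 : ℝ) ≤ β i) (p : ℝ≥0∞) : ‖polyLp α β p (Finsupp.single 0 1)‖ ≤ 1 := by
  have := isProbabilityMeasure_measure hα hβ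
  have h : ‖polyLp α β p (Finsupp.single 0 1)‖ ≤
      (measureUnivNNReal (measure α β) : ℝ) ^ p.toReal⁻¹ * 1 := by
    refine Lp.norm_le_of_ae_bound zero_le_one ?_
    filter_upwards [coeFn_polyLp α β p (Finsupp.single 0 1)] with x hx
    rw [hx]
    simp [polyFun, phi_zero hα hβ]
  simpa [measureUnivNNReal] using h

section

variable (hα : ∀ i, -(1 / 2 : ℝ) ≤ α i) (hβ : ∀ i, -(1 / 2 : ℝ) ≤ β i) {p : ℝ≥0∞}
  (hp1 : 1 < p) (hp : p < ∞)

include hα hβ hp1 hp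

/-- Constants are annihilated, so the mean-zero bound applies after subtracting the mean. In this
form it holds for every polynomial, and no density argument inside the mean-zero subspace is needed.
-/
theorem norm_vecLp_le_sub_mean (c : (Fin d → ℕ) →₀ ℝ) :
    ‖vecLp α β p c‖ ≤ 24 * (pStar p.toReal - 1) *
      ‖polyLp α β p c - (∫ x, polyLp α β p c x ∂(measure α β)) •
        polyLp α β p (Finsupp.single 0 1)‖ := by
  have h := norm_vecLp_le hα hβ hp1 hp (c := c - Finsupp.single 0 (c 0)) (by simp)
  rw [map_sub, vecLp_single_zero, sub_zero, map_sub] at h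
  rw [integral_polyLp hα hβ, ← map_smul]
  simpa using h

omit hα hβ in
theorem pStar_sub_one_nonneg : 0 ≤ 24 * (pStar p.toReal - 1) := by
  have hP : 1 < p.toReal := by
    rw [← ENNReal.toReal_one]
    exact (ENNReal.toReal_lt_toReal ENNReal.one_ne_top hp.ne).2 hp1
  have := le_max_left p.toReal (p.toReal / (p.toReal - 1))
  simp only [pStar]
  linarith

variable [Fact (1 ≤ p)]

/-- The factor 2 pays for subtracting the mean. This cruder bound serves only to construct the
extension. -/
theorem norm_vecLp_le_mul_norm (c : (Fin d → ℕ) →₀ ℝ) :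
    ‖vecLp α β p c‖ ≤ 24 * (pStar p.toReal - 1) * 2 * ‖polyLp α β p c‖ := by
  have := isProbabilityMeasure_measure hα hβ
  refine (norm_vecLp_le_sub_mean hα hβ hp1 hp c).trans ?_
  rw [mul_assoc _ 2]
  refine mul_le_mul_of_nonneg_left ?_ (pStar_sub_one_nonneg hp1 hp)
  have h1 := integral_norm_le_norm_Lp hp1.le (polyLp α β p c)
  have h2 := (norm_integral_le_integral_norm fun x => polyLp α β p c x).trans h1.2
  refine (norm_sub_le _ _).trans ?_
  rw [norm_smul, two_mul]
  exact add_le_add le_rfl ((mul_le_of_le_one_right (norm_nonneg _)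
    (norm_polyLp_single_zero_le hα hβ p)).trans h2)

theorem exists_clm_polyLp :
    ∃ T : Lp ℝ p (measure α β) →L[ℝ] Lp (EuclideanSpace ℝ (Fin d)) p (measure α β),
      (∀ c, T (polyLp α β p c) = vecLp α β p c) ∧
      ∀ f : Lp ℝ p (measure α β), ∫ x, f x ∂(measure α β) = 0 →
        ‖T f‖ ≤ 24 * (pStar p.toReal - 1) * ‖f‖ := by
  have := isProbabilityMeasure_measure hα hβ
  have hd := denseRange_polyLp hα hβ hp.ne
  set T := (vecLp α β p).extendOfNorm (polyLp α β p)
  have hT : ∀ c, T (polyLp α β p c) = vecLp α β p c :=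
    LinearMap.extendOfNorm_eq hd ⟨_, norm_vecLp_le_mul_norm hα hβ hp1 hp⟩
  -- Both sides are continuous in `f`, so the estimate with the better constant passes from
  -- polynomials to all of `L^p`.
  have key : ∀ f : Lp ℝ p (measure α β), ‖T f‖ ≤ 24 * (pStar p.toReal - 1) *
      ‖f - (∫ x, f x ∂(measure α β)) • polyLp α β p (Finsupp.single 0 1)‖ := by
    intro f
    refine hd.induction_on (p := fun f => ‖T f‖ ≤ 24 * (pStar p.toReal - 1) *
      ‖f - (∫ x, f x ∂(measure α β)) • polyLp α β p (Finsupp.single 0 1)‖) f ?_ fun c => ?_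
    · have := continuous_integral_Lp (μ := measure α β) (p := p)
      exact isClosed_le (by fun_prop) (by fun_prop)
    · rw [hT]
      exact norm_vecLp_le_sub_mean hα hβ hp1 hp c
  refine ⟨T, hT, fun f hf => ?_⟩
  have := key f
  rwa [hf, zero_smul, sub_zero] at this

/-- A function in `L² ∩ L^p` lies in `L^max(2,p)`, still a finite exponent, so one polynomial
approximates it in both norms. `T` and the Riesz series agree on polynomials and both are bounded,
hence their difference is arbitrarily small in `L¹`. -/
theorem extendsRiesz_of_polyLp
    {T : Lp ℝ p (measure α β) →L[ℝ] Lp (EuclideanSpace ℝ (Fin d)) p (measure α β)}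
    (hT : ∀ c, T (polyLp α β p c) = vecLp α β p c) : ExtendsRiesz α β p T := by
  have := isProbabilityMeasure_measure hα hβ
  intro f g hfg
  have hcomp : ∀ i, ∀ᵐ x ∂(measure α β), T g x i - riesz α β i f x = 0 := by
    intro i
    have i1 : Integrable (fun x => T g x i) (measure α β) :=
      (integral_norm_le_norm_Lp hp1.le (T g)).1.eval_piLp i
    have i2 := (integral_norm_le_norm_Lp one_le_two (riesz α β i f)).1
    have hbound : ∀ ε > 0, ∫ x, ‖T g x i - riesz α β i f x‖ ∂(measure α β) ≤ (‖T‖ + 1) * ε := by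
      intro ε hε
      have hmem : MemLp f (max 2 p) (measure α β) := by
        rcases max_choice 2 p with h | h <;> rw [h]
        · exact Lp.memLp f
        · exact (Lp.memLp g).ae_eq hfg.symm
      obtain ⟨c, hc⟩ := exists_polyFun_eLpNorm_sub_le hα hβ
        (hp1.le.trans (le_max_right 2 p)) (max_lt ENNReal.ofNat_lt_top hp).ne hmem hε
      have n1 := norm_sub_polyLp_le (le_max_left 2 p) f ae_eq_rfl hmem.1 hε hc
      have n2 := norm_sub_polyLp_le (le_max_right 2 p) g hfg.symm hmem.1 hε hc
      have m1 := integral_norm_le_norm_Lp hp1.le (T (g - polyLp α β p c))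
      have m2 := integral_norm_le_norm_Lp one_le_two (riesz α β i (f - polyLp α β 2 c))
      have b1 : ‖T (g - polyLp α β p c)‖ ≤ ‖T‖ * ε :=
        (T.le_opNorm _).trans (mul_le_mul_of_nonneg_left n2 (norm_nonneg _))
      have b2 := (riesz_summable_and_norm_le hα hβ i (f - polyLp α β 2 c)).2.trans n1
      have hle : ∫ x, ‖T g x i - riesz α β i f x‖ ∂(measure α β) ≤
          ∫ x, (‖T (g - polyLp α β p c) x‖ + ‖riesz α β i (f - polyLp α β 2 c) x‖)
            ∂(measure α β) := by
        refine integral_mono_ae (i1.sub i2).norm (m1.1.norm.add m2.1.norm) ?_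
        rw [map_sub, hT, riesz_sub hα hβ]
        filter_upwards [Lp.coeFn_sub (T g) (vecLp α β p c),
          Lp.coeFn_sub (riesz α β i f) (riesz α β i (polyLp α β 2 c)),
          coeFn_vecLp α β p c, riesz_polyLp hα hβ i c] with x e1 e2 e3 e4
        rw [e1, e2, Pi.sub_apply, Pi.sub_apply, e3, e4]
        have h1 := PiLp.norm_apply_le (T g x - vecPoly α β c x) i
        have h2 : (T g x - vecPoly α β c x) i =
            T g x i - √(1 - x i ^ 2) * rieszPoly α β i c x := rfl
        rw [h2] at h1
        rw [norm_sub_rev (riesz α β i f x)]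
        refine le_trans ?_ (add_le_add h1 le_rfl)
        refine le_trans (le_of_eq ?_) (norm_add_le _ _)
        congr 1
        ring
      rw [integral_add m1.1.norm m2.1.norm] at hle
      calc _ ≤ _ := hle
        _ ≤ ‖T‖ * ε + ε := add_le_add (m1.2.trans b1) (m2.2.trans b2)
        _ = _ := by ring
    have h0 : ∫ x, ‖T g x i - riesz α β i f x‖ ∂(measure α β) = 0 := by
      refine le_antisymm (le_of_forall_pos_le_add fun ε hε => ?_)
        (integral_nonneg fun _ => norm_nonneg _)
      have hpos : 0 < ‖T‖ + 1 := by positivity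
      have := hbound (ε / (‖T‖ + 1)) (by positivity)
      rwa [mul_div_cancel₀ _ hpos.ne', ← zero_add ε] at this
    filter_upwards [(integral_eq_zero_iff_of_nonneg (fun _ => norm_nonneg _)
      (i1.sub i2).norm).1 h0] with x hx using norm_eq_zero.1 hx
  filter_upwards [ae_all_iff.2 hcomp] with x hx
  ext i
  exact sub_eq_zero.1 (hx i)

-- Polynomials lie in `L² ∩ L^p` and are dense in `L^p`, so they determine any extension.
omit hp1 in
theorem eq_of_extendsRiesz
    {T T' : Lp ℝ p (measure α β) →L[ℝ] Lp (EuclideanSpace ℝ (Fin d)) p (measure α β)}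
    (hT : ∀ c, T (polyLp α β p c) = vecLp α β p c) (hT' : ExtendsRiesz α β p T') : T' = T := by
  refine DFunLike.coe_injective
    ((denseRange_polyLp hα hβ hp.ne).equalizer T'.continuous T.continuous (funext fun c => ?_))
  simp only [Function.comp_apply, hT]
  refine Lp.ext ?_
  refine (hT' (polyLp α β 2 c) (polyLp α β p c)
    ((coeFn_polyLp α β 2 c).trans (coeFn_polyLp α β p c).symm)).trans ?_
  exact (rieszVec_polyLp hα hβ c).trans (coeFn_vecLp α β p c).symm

end

end JacobiRiesz

/-- On `L²` the series defining each Riesz transform converges, the vector of Riesz transforms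
has a unique bounded extension `T` from `L² ∩ L^p` to `L^p`, and `T` satisfies the bound on
functions with mean zero. -/
theorem theorem5p3 (d : ℕ) (α β : Fin d → ℝ)
    (hα : ∀ i, -(1 / 2 : ℝ) ≤ α i) (hβ : ∀ i, -(1 / 2 : ℝ) ≤ β i)
    (p : ℝ≥0∞) [Fact (1 ≤ p)] (hp1 : 1 < p) (hp : p < ∞) :
    (∀ (i : Fin d) (f : Lp ℝ 2 (JacobiRiesz.measure α β)),
      Summable (JacobiRiesz.rieszTerm α β i f)) ∧
    ∃ T : Lp ℝ p (JacobiRiesz.measure α β) →L[ℝ]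
        Lp (EuclideanSpace ℝ (Fin d)) p (JacobiRiesz.measure α β),
      JacobiRiesz.ExtendsRiesz α β p T ∧
      (∀ T', JacobiRiesz.ExtendsRiesz α β p T' → T' = T) ∧
      ∀ f : Lp ℝ p (JacobiRiesz.measure α β),
        ∫ x, f x ∂(JacobiRiesz.measure α β) = 0 →
          ‖T f‖ ≤ 24 * (JacobiRiesz.pStar p.toReal - 1) * ‖f‖ := by
  refine ⟨fun i f => (JacobiRiesz.riesz_summable_and_norm_le hα hβ i f).1, ?_⟩
  obtain ⟨T, hT, hbound⟩ := JacobiRiesz.exists_clm_polyLp hα hβ hp1 hp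
  exact ⟨T, JacobiRiesz.extendsRiesz_of_polyLp hα hβ hp1 hp hT,
    fun T' hT' => JacobiRiesz.eq_of_extendsRiesz hα hβ hp hT hT', hbound⟩
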